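/- Conventions. A monochromatic tree is a finite rooted full binary tree; $I$ is the trivial tree (one leaf), $Y$ the caret, $\rho$ a right-vine (start with a caret and repeatedly glue carets on the last leaf). For a monochromatic tree $x$ with at least two leaves let $\mathcal F_x=\mathrm{FS}\langle a,b\mid x(a)=\rho(b)\rangle$ be the forest-skein category presented by two colours $a,b$ and the single skein relation identifying $x$ with all its vertices coloured by $a$ with the right-vine $\rho$ having as many leaves as $x$ and all its vertices coloured by $b$. Let $X\in\{F,T,V\}$. Denote by $\mathcal F_x^X$ the category of pairs $(f,\pi)$, where $f$ is a forest of $\mathcal F_x$ and $\pi$ is a trivial ($X=F$), cyclic ($X=T$), respectively arbitrary ($X=V$) permutation of its leaves. When it is an Ore category (left-cancellative, with common right-multiples), let $G^X$ be the isotropy group at the object $1$ of its fraction groupoid. Let $\alpha:G^V\curvearrowright\mathfrak C$ be the canonical action on $\mathfrak C=\varprojlim_t\mathrm{Leaf}(t)$, the inverse limit over all trees $t$ of $\mathcal F_x$ of their leaf sets, and let $\Gamma^X=G^X/\ker(\alpha|_{G^X})$. Let $E^V=\mathfrak C$, let $E^F$ be the quotient of $\mathfrak C$ obtained by identifying the two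 points of each jump $(q^-,q^+)$ of its total order (endpoints are kept), and let $E^T$ be the further quotient in which the minimum and the maximum of $\mathfrak C$ are also identified. The canonical action induces an action of $\Gamma^X$ on $E^X$ by homeomorphisms. Thompson's group $X$ (the group obtained in the same way from one colour and no skein relation) is mapped to $\Gamma^X$ by colouring all vertices by $a$. Let $Z$ be a Hausdorff space and $B\subset\mathrm{Homeo}(Z)$ a subgroup. A point $z$ is a singular point of $f\in\mathrm{Homeo}(Z)$ if $f$ agrees with no element of $B$ on any neighbourhood of $z$; $\mathrm{sing}(f)$ is the set of such points. A group $\Gamma\subset\mathrm{Homeo}(Z)$ is a finite germ extension of $B$ (Belk, Hyde, Matucci) if (1) $B\subset\Gamma$ is the set of the elements of $\Gamma$ without singular points; (2) $\mathrm{sing}(\gamma)$ is finite for every $\gamma\in\Gamma$; (3) for all $\gamma\in\Gamma$ and $z\in\mathrm{sing}(\gamma)$ there is $\eta\in\Gamma$ with the same germ as $\gamma$ at $z$ and $\mathrm{sing}(\eta)=\{z\}$. It is non-trivial if $\Gamma\neq B$. Theorem. Let $x$ be a monochromatic tree with at least two leaves and $X\in\{F,T,V\}$. The category $\mathcal F_x^X$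 is Ore, so that $G^X$ and $\Gamma^X$ are defined; $\Gamma^X$ acts faithfully on $E^X$, the map $X\to\Gamma^X$ is injective, and $\Gamma^X$ is a finite germ extension of $X$ (as groups of homeomorphisms of $E^X$). This extension is non-trivial if and only if $x\neq\rho$. Corollary. Let $t$ be a monochromatic tree with at least two leaves, and let $G_t^X$ and $J_t^X$ be the groups $G^X$ of $\mathcal F_x$ for $x=Y(t\otimes I)$ and $x=Y(t\otimes Y)$ respectively. Then $G_t^X$ and $J_t^X$ act faithfully on the corresponding spaces $E^X$, and they are non-trivial finite germ extensions of $X$. -/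

import Mathlib

open CategoryTheory Topology

namespace ForestSkein

/-! ### Free coloured trees and skein presentations -/

/-- Finite rooted full binary trees whose interior vertices are coloured by `S` and whose leaves
carry labels in `β`. `FreeTree S Unit` is the set of free trees over the colour set `S`, and
`FreeTree Unit Unit` is the set of monochromatic trees. -/
inductive FreeTree (S : Type) (β : Type) : Type
  | leaf (b : β) : FreeTree S β
  | node (c : S) (l r : FreeTree S β) : FreeTree S β

namespace FreeTree

variable {S S' β γ δ : Type}

/-- The number of leaves. -/
def size : FreeTree S β → ℕ
  | leaf _ => 1
  | node _ l r => l.size + r.size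

/-- The number of interior vertices, that is, of carets. -/
def carets : FreeTree S β → ℕ
  | leaf _ => 0
  | node _ l r => l.carets + r.carets + 1

/-- The labels of the leaves, read from left to right. -/
def leaves : FreeTree S β → List β
  | leaf b => [b]
  | node _ l r => l.leaves ++ r.leaves

/-- Glue the tree `f b` on every leaf labelled `b`. -/
def bind : FreeTree S β → (β → FreeTree S γ) → FreeTree S γ
  | leaf b, f => f b
  | node c l r, f => node c (l.bind f) (r.bind f)

/-- Change the colours of the interior vertices. -/
def recolour (φ : S → S') : FreeTree S β → FreeTree S' β
  | leaf b => leaf b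
  | node c l r => node (φ c) (l.recolour φ) (r.recolour φ)

/-- Number the leaves `k, k + 1, k + 2, ...` from left to right. -/
def number : FreeTree S β → ℕ → FreeTree S ℕ
  | leaf _, k => leaf k
  | node c l r, k => node c (l.number k) (r.number (k + l.size))

/-- Glue the tree `f i` on the `i`-th leaf (leaves are counted from `0`, from left to right). -/
def graft (t : FreeTree S β) (f : ℕ → FreeTree S γ) : FreeTree S γ := (t.number 0).bind f

/-- The monochromatic right-vine with `k` carets. -/
def rightVine : ℕ → FreeTree Unit Unit
  | 0 => leaf ()
  | k + 1 => node () (leaf ()) (rightVine k)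

theorem size_recolour (φ : S → S') (t : FreeTree S β) : (t.recolour φ).size = t.size := by
  induction t with
  | leaf b => rfl
  | node c l r hl hr => simp [recolour, size, hl, hr]

theorem size_eq_carets (t : FreeTree S β) : t.size = t.carets + 1 := by
  induction t with
  | leaf b => rfl
  | node c l r hl hr => simp only [size, carets]; omega

theorem carets_rightVine (k : ℕ) : (rightVine k).carets = k := by
  induction k with
  | zero => rfl
  | succ k ih => simp [rightVine, carets, ih]

theorem bind_assoc (t : FreeTree S β) (f : β → FreeTree S γ) (g : γ → FreeTree S δ) :
    (t.bind f).bind g = t.bind fun b => (f b).bind g := by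
  induction t with
  | leaf b => rfl
  | node c l r hl hr => simp [bind, hl, hr]

theorem bind_leaf (t : FreeTree S β) : t.bind leaf = t := by
  induction t with
  | leaf b => rfl
  | node c l r hl hr => simp [bind, hl, hr]

theorem recolour_bind (φ : S → S') (t : FreeTree S β) (f : β → FreeTree S γ) :
    (t.bind f).recolour φ = (t.recolour φ).bind fun b => (f b).recolour φ := by
  induction t with
  | leaf b => rfl
  | node c l r hl hr => simp [bind, recolour, hl, hr]

theorem leaves_recolour (φ : S → S') (t : FreeTree S β) : (t.recolour φ).leaves = t.leaves := by
  induction t with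
  | leaf b => rfl
  | node c l r hl hr => simp [leaves, recolour, hl, hr]

theorem leaves_bind (t : FreeTree S β) (f : β → FreeTree S γ) :
    (t.bind f).leaves = t.leaves.flatMap fun b => (f b).leaves := by
  induction t with
  | leaf b => simp [bind, leaves]
  | node c l r hl hr => simp [bind, leaves, hl, hr]

theorem leaves_number (t : FreeTree S β) (k : ℕ) :
    (t.number k).leaves = List.range' k t.size := by
  induction t generalizing k with
  | leaf b => simp [number, leaves, size]
  | node c l r hl hr => simp [number, leaves, size, hl, hr, List.range'_append_1]

theorem leaves_graft (t : FreeTree S β) (f : ℕ → FreeTree S γ) :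
    (t.graft f).leaves = (List.range' 0 t.size).flatMap fun b => (f b).leaves := by
  rw [graft, leaves_bind, leaves_number]

theorem leaves_ne_nil (t : FreeTree S β) : t.leaves ≠ [] := by
  induction t with
  | leaf b => simp [leaves]
  | node c l r hl hr => simp [leaves, hl]

end FreeTree

/-- A skein presentation over the colour set `S`: a set of pairs of free trees (the skein
relations) having the same number of leaves. -/
structure SkeinPresentation (S : Type) where
  rel : FreeTree S Unit → FreeTree S Unit → Prop
  size_eq : ∀ {u v}, rel u v → u.size = v.size

namespace SkeinPresentation

variable {S : Type} (P : SkeinPresentation S) {β γ δ : Type}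

/-- The smallest equivalence relation on (leaf-labelled) free trees that contains the skein
relations and is compatible with gluing: skein relations may be applied anywhere inside a tree. -/
inductive Equiv : FreeTree S β → FreeTree S β → Prop
  | skein {u v : FreeTree S Unit} (h : P.rel u v) (f : ℕ → FreeTree S β) :
      Equiv (u.graft f) (v.graft f)
  | refl (t : FreeTree S β) : Equiv t t
  | symm {t t' : FreeTree S β} : Equiv t t' → Equiv t' t
  | trans {t t' t'' : FreeTree S β} : Equiv t t' → Equiv t' t'' → Equiv t t''
  | node (c : S) {l l' r r' : FreeTree S β} : Equiv l l' → Equiv r r' →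
      Equiv (FreeTree.node c l r) (FreeTree.node c l' r')

/-- The setoid of skein equivalence. -/
def setoid (β : Type) : Setoid (FreeTree S β) where
  r := P.Equiv
  iseqv := ⟨.refl, .symm, .trans⟩

/-- Trees of the presented forest-skein category, with leaves labelled in `β`: labelled free trees
up to skein relations. -/
def Tree (β : Type) : Type := Quotient (P.setoid β)

variable {P}

theorem Equiv.leaves_eq {t t' : FreeTree S β} (h : P.Equiv t t') : t.leaves = t'.leaves := by
  induction h with
  | skein h f => rw [FreeTree.leaves_graft, FreeTree.leaves_graft, P.size_eq h]
  | refl t => rfl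
  | symm _ ih => exact ih.symm
  | trans _ _ ih ih' => exact ih.trans ih'
  | node c _ _ ih ih' => simp [FreeTree.leaves, ih, ih']

theorem Equiv.bind_left {t t' : FreeTree S β} (h : P.Equiv t t') (f : β → FreeTree S γ) :
    P.Equiv (t.bind f) (t'.bind f) := by
  induction h with
  | skein h g =>
    simp only [FreeTree.graft, FreeTree.bind_assoc]
    exact Equiv.skein h fun i => (g i).bind f
  | refl t => exact .refl _
  | symm _ ih => exact ih.symm
  | trans _ _ ih ih' => exact ih.trans ih'
  | node c _ _ ih ih' => exact .node c ih ih'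

theorem Equiv.bind_right (t : FreeTree S β) {f f' : β → FreeTree S γ}
    (h : ∀ b, P.Equiv (f b) (f' b)) : P.Equiv (t.bind f) (t.bind f') := by
  induction t with
  | leaf b => exact h b
  | node c l r hl hr => exact .node c hl hr

namespace Tree

/-- The class of a free tree. -/
def mk (P : SkeinPresentation S) (t : FreeTree S β) : P.Tree β := Quotient.mk (P.setoid β) t

theorem mk_eq_mk {t t' : FreeTree S β} : mk P t = mk P t' ↔ P.Equiv t t' :=
  Quotient.eq (r := P.setoid β)

theorem exists_mk (t : P.Tree β) : ∃ t', mk P t' = t := Quotient.exists_rep t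

/-- The labels of the leaves of a tree, read from left to right. -/
def leaves (t : P.Tree β) : List β :=
  Quotient.lift (s := P.setoid β) FreeTree.leaves (fun _ _ h => Equiv.leaves_eq h) t

/-- The trivial tree. -/
def pure (b : β) : P.Tree β := mk P (FreeTree.leaf b)

/-- Glue the tree `f b` on every leaf labelled `b`. -/
noncomputable def bind (t : P.Tree β) (f : β → P.Tree γ) : P.Tree γ :=
  Quotient.lift (s := P.setoid β)
    (fun t => mk P (t.bind fun b => Quotient.out (s := P.setoid γ) (f b)))
    (fun _ _ h => mk_eq_mk.2 (Equiv.bind_left h _)) t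

theorem leaves_mk (t : FreeTree S β) : (mk P t).leaves = t.leaves := rfl

theorem mk_bind (t : FreeTree S β) (f : β → FreeTree S γ) :
    (mk P t).bind (fun b => mk P (f b)) = mk P (t.bind f) :=
  mk_eq_mk.2 (Equiv.bind_right t fun b => Quotient.mk_out (s := P.setoid γ) (f b))

theorem exists_mk_family (f : β → P.Tree γ) : ∃ f' : β → FreeTree S γ, f = fun b => mk P (f' b) := by
  choose f' hf' using fun b => exists_mk (f b)
  exact ⟨f', funext fun b => (hf' b).symm⟩

theorem bind_assoc (t : P.Tree β) (f : β → P.Tree γ) (g : γ → P.Tree δ) :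
    (t.bind f).bind g = t.bind fun b => (f b).bind g := by
  obtain ⟨t, rfl⟩ := exists_mk t
  obtain ⟨f, rfl⟩ := exists_mk_family f
  obtain ⟨g, rfl⟩ := exists_mk_family g
  simp only [mk_bind, FreeTree.bind_assoc]

theorem pure_bind (b : β) (f : β → P.Tree γ) : (pure b : P.Tree β).bind f = f b := by
  obtain ⟨f, rfl⟩ := exists_mk_family f
  simp only [pure, mk_bind, FreeTree.bind]

theorem bind_pure (t : P.Tree β) : t.bind pure = t := by
  obtain ⟨t, rfl⟩ := exists_mk t
  exact (mk_bind t FreeTree.leaf).trans (by rw [FreeTree.bind_leaf])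

theorem leaves_pure (b : β) : (pure b : P.Tree β).leaves = [b] := rfl

theorem leaves_bind (t : P.Tree β) (f : β → P.Tree γ) :
    (t.bind f).leaves = t.leaves.flatMap fun b => (f b).leaves := by
  obtain ⟨t, rfl⟩ := exists_mk t
  obtain ⟨f, rfl⟩ := exists_mk_family f
  simp only [mk_bind, leaves_mk]
  exact FreeTree.leaves_bind t f

theorem leaves_ne_nil (t : P.Tree β) : t.leaves ≠ [] := by
  obtain ⟨t, rfl⟩ := exists_mk t
  exact FreeTree.leaves_ne_nil t

end Tree

end SkeinPresentation

/-! ### The forest-skein categories of type `F`, `T` and `V` -/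

/-- The three types of Thompson groups. -/
inductive ThompsonType : Type
  | F
  | T
  | V

/-- The list `L`, which records the labels in `Fin n` of the leaves of a forest from left to right,
is the identity, a cyclic permutation, respectively an arbitrary permutation. -/
def ThompsonType.Admissible {n : ℕ} (L : List (Fin n)) : ThompsonType → Prop
  | F => L = List.finRange n
  | T => L ~r List.finRange n
  | V => L.Perm (List.finRange n)

theorem ThompsonType.Admissible.perm {n : ℕ} {L : List (Fin n)} :
    ∀ {X : ThompsonType}, X.Admissible L → L.Perm (List.finRange n)
  | F, h => by rw [show L = List.finRange n from h]
  | T, h => List.IsRotated.perm h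
  | V, h => h

theorem ThompsonType.admissible_finRange (n : ℕ) :
    ∀ X : ThompsonType, X.Admissible (List.finRange n)
  | F => rfl
  | T => List.IsRotated.refl _
  | V => List.Perm.refl _

theorem isRotated_flatMap {β γ : Type} {L L' : List β} (h : L ~r L') (g : β → List γ) :
    L.flatMap g ~r L'.flatMap g := by
  obtain ⟨k, rfl⟩ := h
  induction k generalizing L with
  | zero => simpa using List.IsRotated.refl _
  | succ k ih =>
    cases L with
    | nil => simp
    | cons a L =>
      rw [List.rotate_cons_succ]
      refine List.IsRotated.trans ?_ ih
      simp only [List.flatMap_cons, List.flatMap_append, List.flatMap_nil, List.append_nil]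
      exact List.isRotated_append

/-- If `L` and `L'` have the same type, so have the lists obtained by replacing labels by lists. -/
theorem ThompsonType.Admissible.flatMap {m n : ℕ} {L L' : List (Fin m)}
    {g : Fin m → List (Fin n)} : ∀ {X : ThompsonType}, X.Admissible L → X.Admissible L' →
      X.Admissible (L'.flatMap g) → X.Admissible (L.flatMap g)
  | F, h, h', hg => by
    rw [show L = _ from h]; rw [show L' = _ from h'] at hg; exact hg
  | T, h, h', hg => (isRotated_flatMap (List.IsRotated.trans h (List.IsRotated.symm h')) g).trans hg
  | V, h, h', hg => (List.Perm.flatMap_right g (List.Perm.trans h (List.Perm.symm h'))).trans hg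

/-- Morphisms of the forest-skein category of type `X` with `m` roots and `n` leaves. A pair
`(f, π)` consisting of a forest `f` and of a permutation `π` of its leaves is encoded as the forest
`f` in which the leaf number `π i` carries the label `i`. -/
@[ext]
structure Forest {S : Type} (P : SkeinPresentation S) (X : ThompsonType) (m n : ℕ) : Type where
  tree : Fin m → P.Tree (Fin n)
  admissible : X.Admissible ((List.finRange m).flatMap fun i => (tree i).leaves)

namespace Forest

variable {S : Type} {P : SkeinPresentation S} {X : ThompsonType} {k l m n : ℕ}

/-- All labels of the leaves of a forest, from left to right. -/
def leaves (f : Forest P X m n) : List (Fin n) :=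
  (List.finRange m).flatMap fun i => (f.tree i).leaves

theorem flatMap_leaves_comp (f : Fin k → P.Tree (Fin m)) (g : Fin m → P.Tree (Fin n)) :
    ((List.finRange k).flatMap fun i => ((f i).bind g).leaves) =
      ((List.finRange k).flatMap fun i => (f i).leaves).flatMap fun j => (g j).leaves := by
  simp only [SkeinPresentation.Tree.leaves_bind, List.flatMap_assoc]

/-- The identity forest. -/
def id (P : SkeinPresentation S) (X : ThompsonType) (n : ℕ) : Forest P X n n where
  tree i := .pure i
  admissible := by
    have : ((List.finRange n).flatMap fun i => (SkeinPresentation.Tree.pure (P := P) i).leaves) =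
        List.finRange n := by
      simp only [SkeinPresentation.Tree.leaves_pure]
      exact List.flatMap_singleton' _
    rw [this]
    exact X.admissible_finRange n

/-- Vertical concatenation `f ∘ g`: the tree of `g` with number `i` is glued on the leaf of `f`
labelled `i`. -/
noncomputable def comp (f : Forest P X k m) (g : Forest P X m n) : Forest P X k n where
  tree i := (f.tree i).bind g.tree
  admissible := by
    rw [flatMap_leaves_comp]
    exact f.admissible.flatMap (X.admissible_finRange m) g.admissible

theorem leaves_comp (f : Forest P X k m) (g : Forest P X m n) :
    (f.comp g).leaves = f.leaves.flatMap fun j => (g.tree j).leaves :=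
  flatMap_leaves_comp _ _

end Forest

/-- The forest-skein category of type `X` presented by `P`; its objects are the natural numbers. -/
structure ForestCategory {S : Type} (P : SkeinPresentation S) (X : ThompsonType) : Type where
  of ::
  card : ℕ

/-- A forest with `r` roots and `l` leaves is an arrow `r ⟶ l`, so that `f ≫ g` is the vertical
concatenation `f ∘ g`. -/
noncomputable instance {S : Type} (P : SkeinPresentation S) (X : ThompsonType) :
    Category (ForestCategory P X) where
  Hom r l := Forest P X r.card l.card
  id r := Forest.id P X r.card
  comp f g := f.comp g
  id_comp f := by
    ext i
    exact SkeinPresentation.Tree.pure_bind _ _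
  comp_id f := by
    ext i
    exact SkeinPresentation.Tree.bind_pure _
  assoc f g h := by
    ext i
    exact SkeinPresentation.Tree.bind_assoc _ _ _

/-! ### Ore categories and their groups of fractions -/

/-- A category is Ore if it is left-cancellative and has common right-multiples (`f ≫ g` is
written `f ∘ g` in the language of forests). -/
structure IsOre (D : Type) [Category D] : Prop where
  cancel : ∀ {c d e : D} (f : c ⟶ d) (p q : d ⟶ e), f ≫ p = f ≫ q → p = q
  multiple : ∀ {c d e : D} (f : c ⟶ d) (g : c ⟶ e), ∃ (z : D) (p : d ⟶ z) (q : e ⟶ z),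
    f ≫ p = g ≫ q

/-- Pairs `(f, g)` of arrows out of `d` with the same end. -/
structure FractionPair {D : Type} [Category D] (d : D) : Type where
  {obj : D}
  num : d ⟶ obj
  den : d ⟶ obj

/-- The relation `(f, g) ∼ (f ∘ p, g ∘ p)`. -/
inductive FractionPair.Grow {D : Type} [Category D] {d : D} :
    FractionPair d → FractionPair d → Prop
  | mk {x y : D} (f g : d ⟶ x) (p : x ⟶ y) : Grow ⟨f, g⟩ ⟨f ≫ p, g ≫ p⟩

/-- The isotropy group at `d` of the fraction groupoid of an Ore category: classes `[f, g]` of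
pairs for the equivalence relation generated by `(f, g) ∼ (f ∘ p, g ∘ p)`. -/
def FractionGroup {D : Type} [Category D] (_h : IsOre D) (d : D) : Type :=
  Quot (FractionPair.Grow (d := d))

namespace FractionGroup

variable {D : Type} [Category D] {h : IsOre D} {d : D}

/-- The fraction `[f, g]`. -/
def frac (h : IsOre D) {x : D} (f g : d ⟶ x) : FractionGroup h d := Quot.mk _ ⟨f, g⟩

theorem frac_comp {x y : D} (f g : d ⟶ x) (p : x ⟶ y) :
    frac h (f ≫ p) (g ≫ p) = frac h f g :=
  (Quot.sound (FractionPair.Grow.mk f g p)).symm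

theorem exists_frac (a : FractionGroup h d) : ∃ (x : D) (f g : d ⟶ x), a = frac h f g := by
  obtain ⟨⟨f, g⟩, rfl⟩ := Quot.exists_rep a
  exact ⟨_, f, g, rfl⟩

/-- The product of two pairs, computed from a chosen common right-multiple of the inner arrows. -/
noncomputable def mulPair (h : IsOre D) (a b : FractionPair d) : FractionGroup h d :=
  frac h (a.num ≫ (h.multiple a.den b.num).choose_spec.choose)
    (b.den ≫ (h.multiple a.den b.num).choose_spec.choose_spec.choose)

theorem frac_eq_of_multiples {x y z z' : D} (f g : d ⟶ x) (f' g' : d ⟶ y) (p : x ⟶ z) (q : y ⟶ z)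
    (p' : x ⟶ z') (q' : y ⟶ z') (hpq : g ≫ p = f' ≫ q) (hpq' : g ≫ p' = f' ≫ q') :
    frac h (f ≫ p) (g' ≫ q) = frac h (f ≫ p') (g' ≫ q') := by
  obtain ⟨w, u, v, huv⟩ := h.multiple (g ≫ p) (g ≫ p')
  have h1 : p ≫ u = p' ≫ v := h.cancel g _ _ (by simpa using huv)
  have h2 : q ≫ u = q' ≫ v := by
    apply h.cancel f'
    rw [← Category.assoc, ← Category.assoc, ← hpq, ← hpq', huv]
  rw [← frac_comp (f ≫ p) _ u, ← frac_comp (f ≫ p') _ v]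
  simp only [Category.assoc, h1, h2]

theorem mulPair_eq {x y z : D} (f g : d ⟶ x) (f' g' : d ⟶ y) (p : x ⟶ z) (q : y ⟶ z)
    (hpq : g ≫ p = f' ≫ q) : mulPair h ⟨f, g⟩ ⟨f', g'⟩ = frac h (f ≫ p) (g' ≫ q) :=
  frac_eq_of_multiples f g f' g' _ _ p q
    (h.multiple g f').choose_spec.choose_spec.choose_spec hpq

/-- The product of fractions, determined by `[f, g] * [g, k] = [f, k]`. -/
noncomputable instance : Mul (FractionGroup h d) where
  mul := Quot.lift₂ (mulPair h)
    (by
      rintro ⟨f, g⟩ _ _ ⟨f', g', r⟩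
      obtain ⟨z, p, q, hpq⟩ := h.multiple g (f' ≫ r)
      rw [mulPair_eq f g f' g' p (r ≫ q) (by simpa using hpq),
        mulPair_eq f g (f' ≫ r) (g' ≫ r) p q hpq, Category.assoc])
    (by
      rintro _ _ ⟨f', g'⟩ ⟨f, g, r⟩
      obtain ⟨z, p, q, hpq⟩ := h.multiple (g ≫ r) f'
      rw [mulPair_eq f g f' g' (r ≫ p) q (by simpa using hpq),
        mulPair_eq (f ≫ r) (g ≫ r) f' g' p q hpq, Category.assoc])

instance : One (FractionGroup h d) where
  one := frac h (𝟙 d) (𝟙 d)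

/-- The inverse `[g, f]` of `[f, g]`. -/
instance : Inv (FractionGroup h d) where
  inv := Quot.lift (fun a => frac h a.den a.num) (by
    rintro _ _ ⟨f, g, r⟩
    exact (frac_comp g f r).symm)

theorem inv_frac {x : D} (f g : d ⟶ x) : (frac h f g)⁻¹ = frac h g f := rfl

theorem frac_mul_frac {x : D} (f g k : d ⟶ x) : frac h f g * frac h g k = frac h f k := by
  have := mulPair_eq (h := h) f g g k (𝟙 x) (𝟙 x) rfl
  rw [Category.comp_id, Category.comp_id] at this
  exact this

theorem frac_self {x : D} (f : d ⟶ x) : frac h f f = 1 := by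
  rw [← Category.id_comp f, frac_comp]; rfl

/-- Two fractions have representatives that can be multiplied directly. -/
theorem exists_frac₂ (a b : FractionGroup h d) :
    ∃ (x : D) (f g k : d ⟶ x), a = frac h f g ∧ b = frac h g k := by
  obtain ⟨x, f, g, rfl⟩ := exists_frac a
  obtain ⟨y, f', g', rfl⟩ := exists_frac b
  obtain ⟨z, p, q, hpq⟩ := h.multiple g f'
  refine ⟨z, f ≫ p, g ≫ p, g' ≫ q, (frac_comp _ _ _).symm, ?_⟩
  rw [hpq, frac_comp]

noncomputable instance : Group (FractionGroup h d) where
  mul_assoc a b c := by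
    obtain ⟨x, f, g, k, rfl, rfl⟩ := exists_frac₂ a b
    obtain ⟨y, k', l, rfl⟩ := exists_frac c
    obtain ⟨z, p, q, hpq⟩ := h.multiple k k'
    rw [← frac_comp f g p, ← frac_comp g k p, ← frac_comp k' l q, ← hpq]
    simp only [frac_mul_frac]
  one_mul a := by
    obtain ⟨x, f, g, rfl⟩ := exists_frac a
    rw [← frac_self f, frac_mul_frac]
  mul_one a := by
    obtain ⟨x, f, g, rfl⟩ := exists_frac a
    rw [← frac_self g, frac_mul_frac]
  inv_mul_cancel a := by
    obtain ⟨x, f, g, rfl⟩ := exists_frac a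
    rw [inv_frac, frac_mul_frac, frac_self]

/-- A map from pairs to a group that is invariant under growing and multiplicative on composable
pairs is a morphism on fractions. -/
noncomputable def lift {G : Type} [Group G] (φ : ∀ {x : D}, (d ⟶ x) → (d ⟶ x) → G)
    (hgrow : ∀ {x y : D} (f g : d ⟶ x) (p : x ⟶ y), φ (f ≫ p) (g ≫ p) = φ f g)
    (hmul : ∀ {x : D} (f g k : d ⟶ x), φ f k = φ f g * φ g k) : FractionGroup h d →* G :=
  MonoidHom.mk' (Quot.lift (fun a => φ a.num a.den) (by
      rintro _ _ ⟨f, g, r⟩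
      exact (hgrow f g r).symm)) (by
    intro a b
    obtain ⟨x, f, g, k, rfl, rfl⟩ := exists_frac₂ a b
    rw [frac_mul_frac]
    exact hmul f g k)

/-- A functor between Ore categories induces a morphism `[f, g] ↦ [Φ f, Φ g]` between groups of
fractions. -/
noncomputable def map {E : Type} [Category E] (h : IsOre D) (h' : IsOre E) (Φ : D ⥤ E) (d : D) :
    FractionGroup h d →* FractionGroup h' (Φ.obj d) :=
  lift (fun f g => frac h' (Φ.map f) (Φ.map g))
    (fun f g p => by rw [Φ.map_comp, Φ.map_comp, frac_comp])
    (fun f g k => by rw [frac_mul_frac])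

end FractionGroup

/-! ### Forest-skein groups and the embedding of Thompson groups -/

section Groups

variable {S : Type}

/-- The `X`-type forest-skein group: the isotropy group at `1` of the fraction groupoid of the
forest-skein category of type `X`. -/
abbrev FSGroup {P : SkeinPresentation S} {X : ThompsonType} (h : IsOre (ForestCategory P X)) :
    Type :=
  FractionGroup h (ForestCategory.of 1)

/-- The inclusion of the forest-skein category of type `X` into the one of type `V`. -/
def Forest.toV {P : SkeinPresentation S} {X : ThompsonType} {m n : ℕ} (f : Forest P X m n) :
    Forest P .V m n where
  tree := f.tree
  admissible := f.admissible.perm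

/-- The inclusion functor of the category of type `X` into the one of type `V`. -/
noncomputable def inclusionV (P : SkeinPresentation S) (X : ThompsonType) :
    ForestCategory P X ⥤ ForestCategory P .V where
  obj r := ⟨r.card⟩
  map f := Forest.toV f
  map_id _ := rfl
  map_comp _ _ := rfl

/-- The presentation with one colour and no skein relation. Its forest-skein groups are the
Thompson groups `F`, `T` and `V`. -/
def thompson : SkeinPresentation Unit where
  rel _ _ := False
  size_eq h := h.elim

/-- Colouring all the interior vertices of a monochromatic tree by `a`. -/
def SkeinPresentation.Tree.colour (P : SkeinPresentation S) (a : S) {β : Type}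
    (t : thompson.Tree β) : P.Tree β :=
  Quotient.lift (s := thompson.setoid β) (fun t => Tree.mk P (t.recolour fun _ => a))
    (fun t t' h => by
      refine Tree.mk_eq_mk.2 ?_
      change thompson.Equiv t t' at h
      induction h with
      | skein h f => exact h.elim
      | refl t => exact .refl _
      | symm _ ih => exact ih.symm
      | trans _ _ ih ih' => exact ih.trans ih'
      | node c _ _ ih ih' => exact .node _ ih ih') t

theorem SkeinPresentation.Tree.leaves_colour (P : SkeinPresentation S) (a : S) {β : Type}
    (t : thompson.Tree β) : (t.colour P a).leaves = t.leaves := by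
  obtain ⟨t, rfl⟩ := Tree.exists_mk t
  exact FreeTree.leaves_recolour _ t

theorem SkeinPresentation.Tree.colour_bind (P : SkeinPresentation S) (a : S) {β γ : Type}
    (t : thompson.Tree β) (f : β → thompson.Tree γ) :
    (t.bind f).colour P a = (t.colour P a).bind fun b => (f b).colour P a := by
  obtain ⟨t, rfl⟩ := Tree.exists_mk t
  obtain ⟨f, rfl⟩ := Tree.exists_mk_family f
  rw [Tree.mk_bind]
  refine Eq.trans (congrArg (Tree.mk P) (FreeTree.recolour_bind _ t f)) ?_
  exact (Tree.mk_bind _ _).symm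

/-- The `a`-vertex colouring functor. -/
noncomputable def colouring (P : SkeinPresentation S) (a : S) (X : ThompsonType) :
    ForestCategory thompson X ⥤ ForestCategory P X where
  obj r := ⟨r.card⟩
  map f :=
    { tree := fun i => (f.tree i).colour P a
      admissible := by
        simp only [SkeinPresentation.Tree.leaves_colour]
        exact f.admissible }
  map_id _ := rfl
  map_comp f g := by
    refine Forest.ext (funext fun i => ?_)
    exact SkeinPresentation.Tree.colour_bind P a _ _

end Groups

/-! ### The canonical action -/

section Canonical

variable {S : Type} (P : SkeinPresentation S)

/-- The space `𝕮`, the inverse limit of the leaf sets of the trees: a point chooses a leaf `x(t)` of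
every tree `t`, in such a way that the leaf `x(t ∘ f)` of `t ∘ f` lies in the tree of `f` that is
glued on the leaf `x(t)` of `t`. -/
@[ext]
structure CanonicalSpace : Type where
  leaf : ∀ {n : ℕ}, Forest P .F 1 n → Fin n
  compat : ∀ {m n : ℕ} (t : Forest P .F 1 m) (f : Forest P .F m n),
    leaf (t.comp f) ∈ (f.tree (leaf t)).leaves

/-- The profinite topology. -/
instance : TopologicalSpace (CanonicalSpace P) :=
  TopologicalSpace.induced
    (fun x (t : Σ n : ℕ, Forest P .F 1 n) => (x.leaf t.2 : Fin t.1)) inferInstance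

variable {P}

namespace Forest

variable {X : ThompsonType} {k m n : ℕ}

theorem nodup_leaves (f : Forest P X m n) : f.leaves.Nodup :=
  (List.Perm.nodup_iff f.admissible.perm).2 (List.nodup_finRange n)

theorem mem_leaves (f : Forest P X m n) (j : Fin n) : j ∈ f.leaves :=
  (List.Perm.mem_iff f.admissible.perm).2 (List.mem_finRange j)

theorem length_leaves (f : Forest P X m n) : f.leaves.length = n :=
  (List.Perm.length_eq f.admissible.perm).trans List.length_finRange

theorem exists_mem_leaves (f : Forest P X m n) (j : Fin n) : ∃ i, j ∈ (f.tree i).leaves := by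
  simpa [leaves] using f.mem_leaves j

/-- A leaf belongs to only one tree of a forest. -/
theorem eq_of_mem_leaves (f : Forest P X m n) {i i' : Fin m} {j : Fin n}
    (h : j ∈ (f.tree i).leaves) (h' : j ∈ (f.tree i').leaves) : i = i' := by
  by_contra hne
  have := (List.nodup_flatMap.1 f.nodup_leaves).2
  have := (List.pairwise_iff_getElem.1 this)
  rcases lt_or_gt_of_ne hne with hlt | hlt
  · have h1 := this i i' (by simp) (by simp) hlt
    simp only [List.getElem_finRange, Function.onFun] at h1
    exact h1 h h'
  · have h1 := this i' i (by simp) (by simp) hlt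
    simp only [List.getElem_finRange, Function.onFun] at h1
    exact h1 h' h

/-- The permutation `k ↦` label of the `k`-th leaf. -/
noncomputable def perm (f : Forest P X m n) : Equiv.Perm (Fin n) :=
  Equiv.ofBijective (fun k => f.leaves.get (k.cast f.length_leaves.symm)) (by
    refine (Fintype.bijective_iff_injective_and_card _).2 ⟨?_, rfl⟩
    intro a b hab
    have := List.nodup_iff_injective_get.1 f.nodup_leaves hab
    simpa [Fin.ext_iff] using this)

theorem leaves_eq_map_perm (f : Forest P X m n) :
    f.leaves = (List.finRange n).map f.perm := by
  apply List.ext_getElem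
  · simp [f.length_leaves]
  · intro i h1 h2
    simp [perm]

theorem leaves_relabel_aux (f : Forest P X m n) (σ : Equiv.Perm (Fin n)) :
    ((List.finRange m).flatMap fun i =>
      ((f.tree i).bind fun j => SkeinPresentation.Tree.pure (P := P) (σ j)).leaves) =
      f.leaves.map σ := by
  rw [flatMap_leaves_comp]
  simp only [SkeinPresentation.Tree.leaves_pure]
  exact List.flatMap_pure_eq_map _ _

/-- Relabelling the leaves of a forest by a permutation. -/
noncomputable def relabel (f : Forest P X m n) (σ : Equiv.Perm (Fin n)) : Forest P .V m n where
  tree i := (f.tree i).bind fun j => .pure (σ j)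
  admissible := by
    rw [leaves_relabel_aux, leaves_eq_map_perm, List.map_map]
    exact Equiv.Perm.map_finRange_perm (f.perm.trans σ)

/-- The underlying planar forest, obtained by forgetting the permutation of the leaves. -/
noncomputable def plane (f : Forest P X m n) : Forest P .F m n where
  tree i := (f.tree i).bind fun j => .pure (f.perm.symm j)
  admissible := by
    rw [leaves_relabel_aux, leaves_eq_map_perm, List.map_map]
    simp [ThompsonType.Admissible]

/-- A permutation, as a forest of trivial trees. -/
def ofPerm (P : SkeinPresentation S) (σ : Equiv.Perm (Fin n)) : Forest P .V n n where
  tree i := .pure (σ i)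
  admissible := by
    have := Equiv.Perm.map_finRange_perm σ
    rw [← List.flatMap_pure_eq_map] at this
    exact this

theorem leaves_comp_ofPerm (f : Forest P .V m n) (σ : Equiv.Perm (Fin n)) :
    (f.comp (ofPerm P σ)).leaves = f.leaves.map σ := leaves_relabel_aux f σ

/-- A morphism of the category of type `V` is a planar forest followed by a permutation. -/
theorem plane_comp_perm (f : Forest P .V m n) : f.plane.toV.comp (ofPerm P f.perm) = f := by
  ext i
  change ((f.tree i).bind _).bind _ = f.tree i
  rw [SkeinPresentation.Tree.bind_assoc]
  conv_rhs => rw [← SkeinPresentation.Tree.bind_pure (f.tree i)]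
  congr 1
  funext j
  rw [SkeinPresentation.Tree.pure_bind]
  simp [ofPerm]

theorem comp_perm_symm (f : Forest P .V m n) : f.comp (ofPerm P f.perm.symm) = f.plane.toV := rfl

theorem perm_toV (t : Forest P .F m n) : t.toV.perm = Equiv.refl _ := by
  ext k
  have h1 : t.toV.leaves = (List.finRange n).map t.toV.perm := t.toV.leaves_eq_map_perm
  have h2 : t.toV.leaves = List.finRange n := t.admissible
  rw [h2] at h1
  have := congrArg (fun L => L[(k : ℕ)]?) h1
  simp at this
  simp [← this]

theorem plane_toV (t : Forest P .F m n) : t.toV.plane = t := by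
  ext i
  change (t.tree i).bind _ = t.tree i
  rw [perm_toV]
  exact SkeinPresentation.Tree.bind_pure _

theorem comp_assoc {l : ℕ} (f : Forest P X k l) (g : Forest P X l m) (e : Forest P X m n) :
    (f.comp g).comp e = f.comp (g.comp e) := by
  ext i
  exact SkeinPresentation.Tree.bind_assoc _ _ _

theorem id_comp (f : Forest P X m n) : (Forest.id P X m).comp f = f := by
  ext i
  exact SkeinPresentation.Tree.pure_bind _ _

theorem comp_id (f : Forest P X m n) : f.comp (Forest.id P X n) = f := by
  ext i
  exact SkeinPresentation.Tree.bind_pure _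

end Forest

namespace CanonicalSpace

variable {k m n : ℕ}

/-- The label of the leaf of a labelled tree that is chosen by a point `x` of `𝕮`. -/
noncomputable def label (x : CanonicalSpace P) (t : Forest P .V 1 n) : Fin n :=
  t.perm (x.leaf t.plane)

theorem label_toV (x : CanonicalSpace P) (t : Forest P .F 1 n) : x.label t.toV = x.leaf t := by
  rw [label, Forest.perm_toV, Forest.plane_toV]; rfl

theorem label_comp (x : CanonicalSpace P) (t : Forest P .V 1 m) (f : Forest P .V m n) :
    x.label (t.comp f) ∈ (f.tree (x.label t)).leaves := by
  let σ := (t.comp f).perm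
  let f' : Forest P .V m n := ((Forest.ofPerm P t.perm).comp f).comp (Forest.ofPerm P σ.symm)
  have key : t.plane.toV.comp f' = (t.comp f).plane.toV := by
    rw [← Forest.comp_perm_symm (t.comp f)]
    simp only [f', ← Forest.comp_assoc, Forest.plane_comp_perm]
    rfl
  have hL : f'.leaves = List.finRange n := by
    have h1 := congrArg Forest.leaves key
    rw [Forest.leaves_comp] at h1
    have h2 : t.plane.toV.leaves = List.finRange m := t.plane.admissible
    rw [h2] at h1
    exact h1.trans (t.comp f).plane.admissible
  let f'' : Forest P .F m n := ⟨f'.tree, hL⟩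
  have key' : t.plane.comp f'' = (t.comp f).plane := by
    ext i
    exact congrFun (congrArg Forest.tree key) i
  have := x.compat t.plane f''
  rw [key'] at this
  have h3 : (f''.tree (x.leaf t.plane)).leaves =
      ((f.tree (x.label t)).leaves).map σ.symm := by
    change (((SkeinPresentation.Tree.pure (P := P) (t.perm (x.leaf t.plane))).bind f.tree).bind
      fun j => .pure (σ.symm j)).leaves = _
    rw [SkeinPresentation.Tree.pure_bind, SkeinPresentation.Tree.leaves_bind]
    simp only [SkeinPresentation.Tree.leaves_pure]
    exact List.flatMap_pure_eq_map _ _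
  rw [h3, List.mem_map] at this
  obtain ⟨j, hj, hj'⟩ := this
  have : x.label (t.comp f) = j := by
    rw [label, ← hj']
    exact σ.apply_symm_apply j
  rwa [this]

/-- `y = [p, q] · x`: for all representatives `(p ∘ f, q ∘ f)` of the fraction, the leaf of `p ∘ f`
chosen by `y` carries the same label as the leaf of `q ∘ f` chosen by `x`. -/
def Moves (p q : Forest P .V 1 n) (x y : CanonicalSpace P) : Prop :=
  ∀ {k : ℕ} (f : Forest P .V n k), y.label (p.comp f) = x.label (q.comp f)

theorem Moves.symm {p q : Forest P .V 1 n} {x y : CanonicalSpace P} (h : Moves p q x y) :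
    Moves q p y x := fun f => (h f).symm

theorem Moves.trans {p q r : Forest P .V 1 n} {x y z : CanonicalSpace P} (h : Moves q r x y)
    (h' : Moves p q y z) : Moves p r x z := fun f => (h' f).trans (h f)

theorem Moves.comp {p q : Forest P .V 1 n} {x y : CanonicalSpace P} (h : Moves p q x y)
    (f : Forest P .V n m) : Moves (p.comp f) (q.comp f) x y := fun g => by
  rw [Forest.comp_assoc, Forest.comp_assoc]
  exact h _

theorem exists_multiple (h : IsOre (ForestCategory P .V)) (u : Forest P .V 1 m)
    (p : Forest P .V 1 n) :
    ∃ (l : ℕ) (e : Forest P .V m l) (f : Forest P .V n l), u.comp e = p.comp f := by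
  obtain ⟨z, e, f, hef⟩ := h.multiple (c := ⟨1⟩) (d := ⟨m⟩) (e := ⟨n⟩) u p
  exact ⟨z.card, e, f, hef⟩

theorem cancel (h : IsOre (ForestCategory P .V)) {l : ℕ} {u : Forest P .V l m}
    {e f : Forest P .V m n} (hef : u.comp e = u.comp f) : e = f :=
  h.cancel (c := ⟨l⟩) (d := ⟨m⟩) (e := ⟨n⟩) u e f hef

theorem mem_leaves_comp {l : ℕ} {e : Forest P .V m k} {s : Forest P .V k l} {i : Fin m} {j : Fin k}
    {a : Fin l} (hj : j ∈ (e.tree i).leaves) (ha : a ∈ (s.tree j).leaves) :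
    a ∈ ((e.comp s).tree i).leaves := by
  change a ∈ ((e.tree i).bind s.tree).leaves
  rw [SkeinPresentation.Tree.leaves_bind, List.mem_flatMap]
  exact ⟨j, hj, ha⟩

/-- The leaf of `u` below the leaf of a common multiple of `u` and `p` selected by `[p, q] · x`. -/
noncomputable def moveLeaf (h : IsOre (ForestCategory P .V)) (p q : Forest P .V 1 n)
    (x : CanonicalSpace P) (u : Forest P .F 1 m) : Fin m :=
  ((exists_multiple h u.toV p).choose_spec.choose.exists_mem_leaves
    (x.label (q.comp (exists_multiple h u.toV p).choose_spec.choose_spec.choose))).choose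

theorem moveLeaf_spec (h : IsOre (ForestCategory P .V)) (p q : Forest P .V 1 n)
    (x : CanonicalSpace P) (u : Forest P .F 1 m) {l : ℕ} (e : Forest P .V m l)
    (f : Forest P .V n l) (hef : u.toV.comp e = p.comp f) :
    x.label (q.comp f) ∈ (e.tree (moveLeaf h p q x u)).leaves := by
  generalize hi : moveLeaf h p q x u = i
  obtain ⟨l', e', f', hef', hmem⟩ : ∃ (l' : ℕ) (e' : Forest P .V m l') (f' : Forest P .V n l'),
      u.toV.comp e' = p.comp f' ∧ x.label (q.comp f') ∈ (e'.tree i).leaves :=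
    ⟨_, _, _, (exists_multiple h u.toV p).choose_spec.choose_spec.choose_spec, by
      rw [← hi]
      exact ((exists_multiple h u.toV p).choose_spec.choose.exists_mem_leaves _).choose_spec⟩
  obtain ⟨z, s, s', hs⟩ := exists_multiple h (u.toV.comp e) (u.toV.comp e')
  have h1 : e.comp s = e'.comp s' :=
    cancel h (u := u.toV) (by rw [← Forest.comp_assoc, hs, Forest.comp_assoc])
  have h2 : f.comp s = f'.comp s' :=
    cancel h (u := p) (by
      rw [← Forest.comp_assoc, ← Forest.comp_assoc, ← hef, ← hef', hs])
  obtain ⟨i', hi'⟩ := e.exists_mem_leaves (x.label (q.comp f))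
  have h3 : x.label (q.comp (f.comp s)) ∈ ((e.comp s).tree i').leaves :=
    mem_leaves_comp hi' (by rw [← Forest.comp_assoc]; exact x.label_comp _ _)
  have h4 : x.label (q.comp (f'.comp s')) ∈ ((e'.comp s').tree i).leaves :=
    mem_leaves_comp hmem (by rw [← Forest.comp_assoc]; exact x.label_comp _ _)
  rw [← h1, ← h2] at h4
  rwa [← (e.comp s).eq_of_mem_leaves h3 h4]

/-- The point `[p, q] · x`. -/
noncomputable def move (h : IsOre (ForestCategory P .V)) (p q : Forest P .V 1 n)
    (x : CanonicalSpace P) : CanonicalSpace P where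
  leaf u := moveLeaf h p q x u
  compat t g := by
    obtain ⟨l, e, f, hef⟩ := exists_multiple h (t.comp g).toV p
    have h1 := moveLeaf_spec h p q x (t.comp g) e f hef
    have h2 := moveLeaf_spec h p q x t (g.toV.comp e) f
      (by rw [← Forest.comp_assoc]; exact hef)
    change _ ∈ ((g.toV.tree _).bind e.tree).leaves at h2
    rw [SkeinPresentation.Tree.leaves_bind, List.mem_flatMap] at h2
    obtain ⟨j, hj, hj'⟩ := h2
    rw [e.eq_of_mem_leaves h1 hj']
    exact hj

theorem moves_move (h : IsOre (ForestCategory P .V)) (p q : Forest P .V 1 n)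
    (x : CanonicalSpace P) : Moves p q x (move h p q x) := fun f => by
  have := moveLeaf_spec h p q x (p.comp f).plane (Forest.ofPerm P (p.comp f).perm) f
    (Forest.plane_comp_perm _)
  exact (List.mem_singleton.1 this).symm

theorem Moves.unique (h : IsOre (ForestCategory P .V)) {p q : Forest P .V 1 n}
    {x y y' : CanonicalSpace P} (hy : Moves p q x y) (hy' : Moves p q x y') : y = y' := by
  ext m u : 3
  obtain ⟨l, e, f, hef⟩ := exists_multiple h u.toV p
  have h1 := y.label_comp u.toV e
  have h2 := y'.label_comp u.toV e
  rw [hef, hy f, ← hy' f, ← hef] at h1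
  simpa only [label_toV] using e.eq_of_mem_leaves h1 h2

theorem continuous_label (t : Forest P .V 1 n) :
    Continuous fun x : CanonicalSpace P => x.label t := by
  have h1 : Continuous fun x : CanonicalSpace P =>
      (fun (t : Σ n : ℕ, Forest P .F 1 n) => (x.leaf t.2 : Fin t.1)) := continuous_induced_dom
  have h2 : Continuous fun x : CanonicalSpace P => x.leaf t.plane :=
    (continuous_apply (⟨n, t.plane⟩ : Σ n : ℕ, Forest P .F 1 n)).comp h1
  exact (continuous_of_discreteTopology (f := t.perm)).comp h2

theorem continuous_move (h : IsOre (ForestCategory P .V)) (p q : Forest P .V 1 n) :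
    Continuous (move h p q) := by
  refine continuous_induced_rng.2 (continuous_pi fun u => ?_)
  obtain ⟨l, e, f, hef⟩ := exists_multiple h u.2.toV p
  choose r hr using fun a => e.exists_mem_leaves a
  have : (fun x : CanonicalSpace P => (move h p q x).leaf u.2) =
      fun x => r (x.label (q.comp f)) := by
    funext x
    exact e.eq_of_mem_leaves (moveLeaf_spec h p q x u.2 e f hef) (hr _)
  change Continuous fun x : CanonicalSpace P => (move h p q x).leaf u.2
  rw [this]
  exact (continuous_of_discreteTopology (f := r)).comp (continuous_label _)

theorem move_move (h : IsOre (ForestCategory P .V)) (p q r : Forest P .V 1 n)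
    (x : CanonicalSpace P) : move h p q (move h q r x) = move h p r x :=
  Moves.unique h (Moves.trans (moves_move h q r x) (moves_move h p q _)) (moves_move h p r x)

theorem move_self (h : IsOre (ForestCategory P .V)) (p : Forest P .V 1 n)
    (x : CanonicalSpace P) : move h p p x = x :=
  Moves.unique h (moves_move h p p x) fun _ => rfl

/-- The homeomorphism `x ↦ [p, q] · x` of `𝕮`. -/
noncomputable def moveHomeo (h : IsOre (ForestCategory P .V)) (p q : Forest P .V 1 n) :
    CanonicalSpace P ≃ₜ CanonicalSpace P where
  toFun := move h p q
  invFun := move h q p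
  left_inv x := by rw [move_move, move_self]
  right_inv x := by rw [move_move, move_self]
  continuous_toFun := continuous_move h p q
  continuous_invFun := continuous_move h q p

end CanonicalSpace

/-- The canonical action `α` of the `V`-type forest-skein group on `𝕮`. -/
noncomputable def canonicalAction (h : IsOre (ForestCategory P .V)) :
    FSGroup h →* (CanonicalSpace P ≃ₜ CanonicalSpace P) :=
  FractionGroup.lift (fun p q => CanonicalSpace.moveHomeo h p q)
    (fun f g p => Homeomorph.ext fun x => CanonicalSpace.Moves.unique h
      (CanonicalSpace.moves_move h _ _ x) (CanonicalSpace.Moves.comp (CanonicalSpace.moves_move h f g x) p))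
    (fun f g k => Homeomorph.ext fun x => (CanonicalSpace.move_move h f g k x).symm)

end Canonical

/-! ### The spaces `E` and the rigid actions -/

section Rigid

variable {S : Type} {P : SkeinPresentation S}

/-- The leaf `j'` follows the leaf `j` among `n` leaves: in the linear order for the type `F`, in
the cyclic order for the type `T`, and never for the type `V`. -/
def ThompsonType.Follows {n : ℕ} (j j' : Fin n) : ThompsonType → Prop
  | F => (j : ℕ) + 1 = j'
  | T => ((j : ℕ) + 1) % n = j'
  | V => False

namespace CanonicalSpace

variable {n : ℕ}

/-- `x` is the smallest point of the cone of the `j`-th leaf of `t`: for every forest `f` it goes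
through the first leaf of the `j`-th tree of `f`. This is the point `[t, j]⁺`. -/
def IsFirst (x : CanonicalSpace P) (t : Forest P .F 1 n) (j : Fin n) : Prop :=
  ∀ {m : ℕ} (f : Forest P .F n m), (f.tree j).leaves.head? = some (x.leaf (t.comp f))

/-- `x` is the largest point of the cone of the `j`-th leaf of `t`: for every forest `f` it goes
through the last leaf of the `j`-th tree of `f`. This is the point `[t, j + 1]⁻` if the `j`-th leaf
of `t` is not the last one, and the maximum `ω` otherwise. -/
def IsLast (x : CanonicalSpace P) (t : Forest P .F 1 n) (j : Fin n) : Prop :=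
  ∀ {m : ℕ} (f : Forest P .F n m), (f.tree j).leaves.getLast? = some (x.leaf (t.comp f))

/-- The pairs of points to be identified: the jumps `(q⁻, q⁺)` for the type `F`, the jumps and the
pair `(ω, o)` formed by the maximum and the minimum for the type `T`, none for the type `V`. -/
def Glued (X : ThompsonType) (x y : CanonicalSpace P) : Prop :=
  ∃ (n : ℕ) (t : Forest P .F 1 n) (j j' : Fin n), X.Follows j j' ∧ x.IsLast t j ∧ y.IsFirst t j'

end CanonicalSpace

/-- The list form of `Follows`. -/
def ThompsonType.ListFollows {n : ℕ} (L : List (Fin n)) (a b : Fin n) : ThompsonType → Prop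
  | F => ∃ A B, L = A ++ a :: b :: B
  | T => ∃ C, L ~r b :: C ∧ (b :: C).getLast? = some a
  | V => False

namespace ThompsonType

variable {m n : ℕ}

theorem listFollows_iff (j j' : Fin n) :
    ∀ X : ThompsonType, X.ListFollows (List.finRange n) j j' ↔ X.Follows j j'
  | F => by
    constructor
    · rintro ⟨A, B, h⟩
      have h1 : (List.finRange n)[A.length]? = some j := by rw [h]; simp
      have h2 : (List.finRange n)[A.length + 1]? = some j' := by
        rw [h, List.getElem?_append_right (by omega)]; simp
      rw [List.getElem?_eq_some_iff] at h1 h2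
      obtain ⟨h1, h1'⟩ := h1
      obtain ⟨h2, h2'⟩ := h2
      simp only [List.getElem_finRange, Fin.ext_iff] at h1' h2'
      simp only [Fin.val_cast] at h1' h2'
      change (j : ℕ) + 1 = j'
      omega
    · intro h
      change (j : ℕ) + 1 = j' at h
      refine ⟨(List.finRange n).take j, (List.finRange n).drop (j + 2), ?_⟩
      have h1 : (j : ℕ) < (List.finRange n).length := by simp
      have h2 : (j : ℕ) + 1 < (List.finRange n).length := by rw [h]; simp
      conv_lhs => rw [← List.take_append_drop j (List.finRange n),
        List.drop_eq_getElem_cons h1, List.drop_eq_getElem_cons h2]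
      congr 2
      · ext; simp
      · congr 1
        ext; simp [← h]
  | T => by
    constructor
    · rintro ⟨C, hC, hl⟩
      obtain ⟨k, hk⟩ := hC
      have hlen : C.length + 1 = n := by
        have := congrArg List.length hk
        simpa using this.symm
      rw [List.getLast?_eq_getElem?, ← hk, List.getElem?_eq_some_iff] at hl
      obtain ⟨h1, h1'⟩ := hl
      have h2 : ((List.finRange n).rotate k)[0]? = some j' := by rw [hk]; rfl
      rw [List.getElem?_eq_some_iff] at h2
      obtain ⟨h2, h2'⟩ := h2
      rw [List.getElem_rotate] at h1' h2'
      simp [Fin.ext_iff] at h1' h2'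
      change ((j : ℕ) + 1) % n = j'
      rw [← h1', ← h2', Nat.mod_add_mod]
      rw [show n - 1 + k + 1 = k + n by omega, Nat.add_mod_right]
    · intro h
      change ((j : ℕ) + 1) % n = j' at h
      have hn : 0 < n := j.pos
      have hlen : ((List.finRange n).rotate j').length = n := by simp
      have h0 : ((List.finRange n).rotate j')[0]? = some j' := by
        rw [List.getElem?_eq_some_iff]
        refine ⟨by omega, ?_⟩
        rw [List.getElem_rotate]
        ext
        simp [Nat.mod_eq_of_lt j'.isLt]
      rcases hL : (List.finRange n).rotate j' with _ | ⟨b, C⟩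
      · rw [hL] at hlen; simp at hlen; omega
      · rw [hL] at h0
        simp at h0
        subst h0
        refine ⟨C, ⟨b, hL⟩, ?_⟩
        rw [← hL, List.getLast?_eq_getElem?, hlen, List.getElem?_eq_some_iff]
        refine ⟨by omega, ?_⟩
        rw [List.getElem_rotate]
        ext
        simp
        rw [← h, Nat.add_mod_mod, show n - 1 + ((j : ℕ) + 1) = j + n by omega, Nat.add_mod_right,
          Nat.mod_eq_of_lt j.isLt]
  | V => Iff.rfl

theorem head?_flatMap {β γ : Type} {L : List β} {g : β → List γ} {a : β} {b : γ}
    (h : L.head? = some a) (h' : (g a).head? = some b) : (L.flatMap g).head? = some b := by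
  cases L with
  | nil => simp at h
  | cons c L =>
    simp at h
    subst h
    simp [h']

theorem getLast?_flatMap {β γ : Type} {L : List β} {g : β → List γ} {a : β} {b : γ}
    (h : L.getLast? = some a) (h' : (g a).getLast? = some b) :
    (L.flatMap g).getLast? = some b := by
  obtain ⟨L', rfl⟩ := List.getLast?_eq_some_iff.1 h
  simp [h']

theorem ListFollows.flatMap {L : List (Fin m)} {g : Fin m → List (Fin n)} {j j' : Fin m}
    {a b : Fin n} (ha : (g j).getLast? = some a) (hb : (g j').head? = some b) :
    ∀ {X : ThompsonType}, X.ListFollows L j j' → X.ListFollows (L.flatMap g) a b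
  | F, ⟨A, B, h⟩ => by
    obtain ⟨A', hA'⟩ := List.getLast?_eq_some_iff.1 ha
    obtain ⟨B', hB'⟩ := List.head?_eq_some_iff.1 hb
    refine ⟨A.flatMap g ++ A', B' ++ B.flatMap g, ?_⟩
    rw [h]
    simp [hA', hB']
  | T, ⟨C, h, h'⟩ => by
    obtain ⟨B', hB'⟩ := List.head?_eq_some_iff.1 hb
    refine ⟨B' ++ C.flatMap g, ?_, ?_⟩
    · have := isRotated_flatMap h g
      simpa [hB'] using this
    · have := getLast?_flatMap h' ha
      simpa [hB'] using this
  | V, h => h.elim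

theorem ListFollows.map {L : List (Fin m)} {g : Fin m → Fin n} {a b : Fin m}
    {X : ThompsonType} (h : X.ListFollows L a b) : X.ListFollows (L.map g) (g a) (g b) := by
  rw [← List.flatMap_pure_eq_map]
  exact ListFollows.flatMap rfl rfl h

theorem ListFollows.congr {L L' : List (Fin n)} {a b : Fin n} :
    ∀ {X : ThompsonType}, X.Admissible L → X.Admissible L' → X.ListFollows L a b →
      X.ListFollows L' a b
  | F, h, h', h'' => by rw [show L' = L from Eq.trans h' (Eq.symm h)]; exact h''
  | T, h, h', ⟨C, hC, hl⟩ =>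
    ⟨C, (List.IsRotated.trans h' (List.IsRotated.symm h)).trans hC, hl⟩
  | V, _, _, h => h

end ThompsonType

namespace CanonicalSpace

variable {k m n : ℕ}

/-- The defining property of extreme points of cones extends to labelled forests. -/
theorem extreme_label (sel : ∀ {β : Type}, List β → Option β)
    (hmap : ∀ {β γ : Type} (g : β → γ) (L : List β), sel (L.map g) = (sel L).map g)
    {x : CanonicalSpace P} {t : Forest P .F 1 n} {j : Fin n}
    (hx : ∀ {m : ℕ} (f : Forest P .F n m), sel (f.tree j).leaves = some (x.leaf (t.comp f)))
    (f : Forest P .V n m) : sel (f.tree j).leaves = some (x.label (t.toV.comp f)) := by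
  have hL : f.leaves = (t.toV.comp f).leaves := by
    rw [Forest.leaves_comp, show t.toV.leaves = List.finRange n from t.admissible]; rfl
  let w := t.toV.comp f
  let f₁ := f.comp (Forest.ofPerm P w.perm.symm)
  have hf₁ : f₁.leaves = List.finRange m := by
    rw [Forest.leaves_comp_ofPerm, hL, Forest.leaves_eq_map_perm, List.map_map]
    simp [w]
  let f₂ : Forest P .F n m := ⟨f₁.tree, hf₁⟩
  have hw : t.comp f₂ = w.plane := by
    ext i
    have : t.toV.comp f₁ = w.plane.toV := by
      rw [← Forest.comp_perm_symm, ← Forest.comp_assoc]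
    exact congrFun (congrArg Forest.tree this) i
  have h1 := hx f₂
  have h2 : (f₂.tree j).leaves = (f.tree j).leaves.map w.perm.symm := by
    change ((f.tree j).bind fun i => SkeinPresentation.Tree.pure (w.perm.symm i)).leaves = _
    rw [SkeinPresentation.Tree.leaves_bind]
    simp only [SkeinPresentation.Tree.leaves_pure]
    exact List.flatMap_pure_eq_map _ _
  rw [h2, hmap, hw, Option.map_eq_some_iff] at h1
  obtain ⟨a, ha, ha'⟩ := h1
  rw [ha, label, ← ha', Equiv.apply_symm_apply]

/-- The action of a fraction sends extreme points of cones to extreme points of cones. -/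
theorem extreme_move (sel : ∀ {β : Type}, List β → Option β)
    (hmap : ∀ {β γ : Type} (g : β → γ) (L : List β), sel (L.map g) = (sel L).map g)
    (hflat : ∀ {β γ : Type} {L : List β} {g : β → List γ} {a : β} {b : γ}, sel L = some a →
      sel (g a) = some b → sel (L.flatMap g) = some b)
    (hsel : ∀ {β : Type} {L : List β}, L ≠ [] → ∃ a, sel L = some a)
    {x y : CanonicalSpace P} {p q : Forest P .V 1 m} (hxy : Moves p q x y)
    {t : Forest P .F 1 n} {j : Fin n}
    (hx : ∀ {m : ℕ} (f : Forest P .F n m), sel (f.tree j).leaves = some (x.leaf (t.comp f)))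
    {e : Forest P .V n k} {f : Forest P .V m k} (hef : t.toV.comp e = q.comp f) {a : Fin k}
    (ha : sel (e.tree j).leaves = some a) {l : ℕ} (g : Forest P .F k l) :
    sel (g.tree ((p.comp f).perm.symm a)).leaves = some (y.leaf ((p.comp f).plane.comp g)) := by
  let σ := (p.comp f).perm.symm
  let g' := (Forest.ofPerm P σ).comp g.toV
  have h1 : (p.comp f).plane.toV.comp g.toV = p.comp (f.comp g') := by
    rw [← Forest.comp_perm_symm]
    simp only [g', σ, Forest.comp_assoc]
  have h2 : y.leaf ((p.comp f).plane.comp g) = x.label (t.toV.comp (e.comp g')) := by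
    rw [← label_toV]
    change y.label ((p.comp f).plane.toV.comp g.toV) = _
    rw [h1, hxy, ← Forest.comp_assoc q, ← hef, Forest.comp_assoc]
  rw [h2, ← extreme_label sel hmap hx (e.comp g')]
  have h3 : ((e.comp g').tree j).leaves =
      (e.tree j).leaves.flatMap fun i => (g.tree (σ i)).leaves := by
    change ((e.tree j).bind fun i => (SkeinPresentation.Tree.pure (σ i)).bind g.tree).leaves = _
    simp only [SkeinPresentation.Tree.pure_bind, SkeinPresentation.Tree.leaves_bind]
  obtain ⟨b, hb⟩ := hsel (g.tree (σ a)).leaves_ne_nil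
  rw [h3, hflat (g := fun i => (g.tree (σ i)).leaves) ha hb]
  exact hb

/-- Fractions of type `X` preserve the pairs of points that are identified. -/
theorem Glued.move (h : IsOre (ForestCategory P .V)) {X : ThompsonType} {x y : CanonicalSpace P}
    (hxy : Glued X x y) (p q : Forest P X 1 n) :
    Glued X (move h p.toV q.toV x) (move h p.toV q.toV y) := by
  obtain ⟨m, t, j, j', hjj, hx, hy⟩ := hxy
  obtain ⟨k, e₀, f₀, hef₀⟩ := exists_multiple h t.toV q.toV
  let σ := (q.toV.comp f₀).perm.symm
  let e := e₀.comp (Forest.ofPerm P σ)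
  let f := f₀.comp (Forest.ofPerm P σ)
  have hef : t.toV.comp e = q.toV.comp f := by
    simp only [e, f, ← Forest.comp_assoc, hef₀]
  have hq : (q.toV.comp f).leaves = List.finRange k := by
    simp only [f, ← Forest.comp_assoc, Forest.leaves_comp_ofPerm]
    rw [Forest.leaves_eq_map_perm, List.map_map]
    simp [σ]
  have hadm : X.Admissible (q.toV.comp f).leaves := by
    rw [hq]; exact X.admissible_finRange k
  have hp : X.Admissible (p.toV.comp f).leaves := by
    rw [Forest.leaves_comp] at hadm ⊢
    exact ThompsonType.Admissible.flatMap p.admissible q.admissible hadm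
  obtain ⟨a, ha⟩ : ∃ a, (e.tree j).leaves.getLast? = some a :=
    ⟨_, List.getLast?_eq_some_getLast (e.tree j).leaves_ne_nil⟩
  obtain ⟨b, hb⟩ : ∃ b, (e.tree j').leaves.head? = some b :=
    ⟨_, List.head?_eq_some_head (e.tree j').leaves_ne_nil⟩
  have h1 : X.ListFollows (t.toV.comp e).leaves a b := by
    rw [Forest.leaves_comp]
    refine ThompsonType.ListFollows.flatMap ha hb ?_
    rw [show t.toV.leaves = List.finRange m from t.admissible]
    exact (X.listFollows_iff j j').2 hjj
  rw [hef] at h1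
  have h2 : X.ListFollows ((p.toV.comp f).leaves.map (p.toV.comp f).perm.symm)
      ((p.toV.comp f).perm.symm a) ((p.toV.comp f).perm.symm b) :=
    (h1.congr hadm hp).map
  have h3 : (p.toV.comp f).leaves.map (p.toV.comp f).perm.symm = List.finRange k := by
    rw [Forest.leaves_eq_map_perm, List.map_map]
    simp
  rw [h3] at h2
  refine ⟨k, (p.toV.comp f).plane, _, _, (ThompsonType.listFollows_iff _ _ X).1 h2, ?_, ?_⟩
  · intro l g
    exact extreme_move List.getLast? (fun g L => List.getLast?_map) ThompsonType.getLast?_flatMap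
      (fun hL => ⟨_, List.getLast?_eq_some_getLast hL⟩) (moves_move h p.toV q.toV x) hx hef ha g
  · intro l g
    exact extreme_move List.head? (fun g L => List.head?_map) ThompsonType.head?_flatMap
      (fun hL => ⟨_, List.head?_eq_some_head hL⟩) (moves_move h p.toV q.toV y) hy hef hb g

end CanonicalSpace

/-- The space on which the type `X` group acts: the Cantor-like space `𝕮` itself for the type `V`
(nothing is identified), the circle-like quotient `E^T` for the type `T`, and the interval-like
space `E`, with its two endpoints added, for the type `F`. -/
def RigidSpace (P : SkeinPresentation S) (X : ThompsonType) : Type :=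
  Quot (CanonicalSpace.Glued (P := P) X)

/-- The quotient topology. -/
instance (P : SkeinPresentation S) (X : ThompsonType) : TopologicalSpace (RigidSpace P X) :=
  inferInstanceAs (TopologicalSpace (Quot (CanonicalSpace.Glued (P := P) X)))

/-- The quotient map from `𝕮`. -/
def RigidSpace.mk {X : ThompsonType} (x : CanonicalSpace P) : RigidSpace P X := Quot.mk _ x

variable {X : ThompsonType}

/-- The inclusion of the `X`-type group into the `V`-type group. -/
noncomputable def toV (hX : IsOre (ForestCategory P X)) (hV : IsOre (ForestCategory P .V)) :
    FSGroup hX →* FSGroup hV :=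
  FractionGroup.map hX hV (inclusionV P X) (ForestCategory.of 1)

/-- The restriction of the canonical action `α` to the `X`-type group. -/
noncomputable def restrictedAction (hX : IsOre (ForestCategory P X))
    (hV : IsOre (ForestCategory P .V)) :
    FSGroup hX →* (CanonicalSpace P ≃ₜ CanonicalSpace P) :=
  (canonicalAction hV).comp (toV hX hV)

theorem glued_restrictedAction (hX : IsOre (ForestCategory P X))
    (hV : IsOre (ForestCategory P .V)) (g : FSGroup hX) {x y : CanonicalSpace P}
    (hxy : x.Glued X y) :
    (restrictedAction hX hV g x).Glued X (restrictedAction hX hV g y) := by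
  obtain ⟨n, p, q, rfl⟩ := FractionGroup.exists_frac g
  exact hxy.move hV p q

/-- The action of the `X`-type group on `E^X` induced by the canonical action. -/
noncomputable def rigidAction (hX : IsOre (ForestCategory P X))
    (hV : IsOre (ForestCategory P .V)) :
    FSGroup hX →* (RigidSpace P X ≃ₜ RigidSpace P X) where
  toFun g :=
    { toFun := Quot.map (restrictedAction hX hV g) fun _ _ => glued_restrictedAction hX hV g
      invFun := Quot.map (restrictedAction hX hV g⁻¹) fun _ _ => glued_restrictedAction hX hV g⁻¹
      left_inv := by
        rintro ⟨x⟩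
        refine congrArg (Quot.mk _) ?_
        rw [map_inv]
        exact (restrictedAction hX hV g).symm_apply_apply x
      right_inv := by
        rintro ⟨x⟩
        refine congrArg (Quot.mk _) ?_
        rw [map_inv]
        exact (restrictedAction hX hV g).apply_symm_apply x
      continuous_toFun :=
        continuous_quot_lift _ (continuous_quot_mk.comp (restrictedAction hX hV g).continuous)
      continuous_invFun :=
        continuous_quot_lift _ (continuous_quot_mk.comp (restrictedAction hX hV g⁻¹).continuous) }
  map_one' := by
    ext x
    obtain ⟨x, rfl⟩ := Quot.exists_rep x
    refine congrArg (Quot.mk _) ?_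
    rw [map_one]; rfl
  map_mul' g g' := by
    ext x
    obtain ⟨x, rfl⟩ := Quot.exists_rep x
    refine congrArg (Quot.mk _) ?_
    rw [map_mul]; rfl

theorem rigidAction_mk (hX : IsOre (ForestCategory P X)) (hV : IsOre (ForestCategory P .V))
    (g : FSGroup hX) (x : CanonicalSpace P) :
    rigidAction hX hV g (RigidSpace.mk x) = RigidSpace.mk (restrictedAction hX hV g x) := rfl

/-- The group `Γ^X`, the quotient of the `X`-type group by the kernel of the canonical action. -/
abbrev FaithfulQuotient (hX : IsOre (ForestCategory P X)) (hV : IsOre (ForestCategory P .V)) :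
    Type :=
  FSGroup hX ⧸ (restrictedAction hX hV).ker

/-- The action of `Γ^X` on `E^X`. -/
noncomputable def faithfulAction (hX : IsOre (ForestCategory P X))
    (hV : IsOre (ForestCategory P .V)) :
    FaithfulQuotient hX hV →* (RigidSpace P X ≃ₜ RigidSpace P X) :=
  QuotientGroup.lift _ (rigidAction hX hV) fun g hg => by
    ext x
    obtain ⟨x, rfl⟩ := Quot.exists_rep x
    refine (rigidAction_mk hX hV g x).trans ?_
    rw [MonoidHom.mem_ker.1 hg]; rfl

/-- The morphism from the Thompson group `X` to `Γ^X` given by the `a`-vertex colouring. -/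
noncomputable def thompsonToQuotient (h₀ : IsOre (ForestCategory thompson X))
    (hX : IsOre (ForestCategory P X)) (hV : IsOre (ForestCategory P .V)) (a : S) :
    FSGroup h₀ →* FaithfulQuotient hX hV :=
  (QuotientGroup.mk' _).comp (FractionGroup.map h₀ hX (colouring P a X) (ForestCategory.of 1))

end Rigid

/-! ### Finite germ extensions -/

section FiniteGermExtensions

variable {Z : Type} [TopologicalSpace Z]

/-- The singular points of `f` with respect to `B`: the points `z` such that `f` does not agree with
any element of `B` on any neighbourhood of `z`. -/
def singularSet (B : Subgroup (Z ≃ₜ Z)) (f : Z ≃ₜ Z) : Set Z :=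
  {z | ¬ ∃ b ∈ B, ∃ U ∈ 𝓝 z, Set.EqOn f b U}

/-- The group `Γ` of homeomorphisms of `Z` is a finite germ extension of the group `B`. -/
structure IsFiniteGermExtension (B Γ : Subgroup (Z ≃ₜ Z)) : Prop where
  t2 : T2Space Z
  le : B ≤ Γ
  mem_iff : ∀ f ∈ Γ, f ∈ B ↔ singularSet B f = ∅
  finite : ∀ f ∈ Γ, (singularSet B f).Finite
  exists_germ : ∀ f ∈ Γ, ∀ z ∈ singularSet B f,
    ∃ g ∈ Γ, (∃ U ∈ 𝓝 z, Set.EqOn g f U) ∧ singularSet B g = {z}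

end FiniteGermExtensions

/-! ### Two colours and one relation -/

/-- The two colours. -/
inductive Colour : Type
  | a
  | b

/-- The presentation `⟨a, b | x(a) = ρ(b)⟩`, where `x` is a monochromatic tree and `ρ` is the
right-vine with as many leaves as `x`. -/
def vinePresentation (x : FreeTree Unit Unit) : SkeinPresentation Colour where
  rel u v := u = x.recolour (fun _ => .a) ∧
    v = (FreeTree.rightVine x.carets).recolour (fun _ => .b)
  size_eq := by
    rintro u v ⟨rfl, rfl⟩
    rw [FreeTree.size_recolour, FreeTree.size_recolour, FreeTree.size_eq_carets,
      FreeTree.size_eq_carets, FreeTree.carets_rightVine]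

/-- The image of `Γ^X` in the group of homeomorphisms of `E^X`. -/
noncomputable def gammaGroup {S : Type} {P : SkeinPresentation S}
    (h : ∀ X, IsOre (ForestCategory P X)) (X : ThompsonType) :
    Subgroup (RigidSpace P X ≃ₜ RigidSpace P X) :=
  (faithfulAction (h X) (h .V)).range

/-- The image of the Thompson group `X`, embedded in `Γ^X` by the `a`-vertex colouring, in the group
of homeomorphisms of `E^X`. -/
noncomputable def thompsonGroup {S : Type} {P : SkeinPresentation S}
    (h₀ : ∀ X, IsOre (ForestCategory thompson X)) (h : ∀ X, IsOre (ForestCategory P X)) (a : S)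
    (X : ThompsonType) : Subgroup (RigidSpace P X ≃ₜ RigidSpace P X) :=
  ((faithfulAction (h X) (h .V)).comp (thompsonToQuotient (h₀ X) (h X) (h .V) a)).range

end ForestSkein

open ForestSkein

namespace ForestSkein

/-! ### Grafting -/

namespace FreeTree

variable {S S' β γ δ : Type}

/-! Let `n` be the number of carets of `x` and `r` the depth of its last leaf. A caret `b` whose
right branch is topped by `x(a)` can be traded for a caret `b` on the last leaf of `x(a)`, because
both trees are the right-vine `ρ(b)` with one more caret (`equiv_shift`). Pulling such carets
upwards, a deep `a`-coloured tree becomes equivalent to one with root `b` whose remaining carets `b`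
lie far down on the right spine (`exists_equiv_node_b`). By induction every tree divides all
sufficiently deep `a`-coloured trees, with quotients that are `a`-coloured except far along their
right spines (`vine_dividesDeep`). This yields common multiples. Left-cancellation follows from a
description of equivalence at the root: a skein move there changes the root colour, and two
successive ones undo each other (`rootRel_of_equiv`).

As deep `a`-coloured trees are cofinal, the canonical space is the Cantor space, on which `a` reads
one digit. Gluing `x` repeatedly on its own last leaf cuts the complement of the maximum `1^∞` into
cells numbered `0, 1, 2, ...`. A caret `b` has the cell `0` as its left branch, and its right branch
is embedded by moving each cell to the next one and fixing the maximum. The skein relation holds in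
this model (`loc_skein`). Binary expansion realises `E^F` as an interval and `E^T` as a circle; only
countably many points are identified, so elements can be compared on the Cantor space.

Every element is a fraction with an `a`-coloured numerator, whose denominator is an `a`-coloured
tree `q` followed by a forest whose right spines begin with `N` vertices `a`; here `q` does not
depend on `N` (`exists_resolution`). Recolouring the forest by `a` gives an element of `X` and
changes the action only inside the cones `w 1^N`, where `w` runs over the addresses of the leaves of
`q`. Hence only the images of the finitely many points `w 1^∞` can be singular, and recolouring all
trees but one isolates a singular point. Without singular points, the end of each spine locates
points as a subtree of the numerator does, so the forest can be made monochromatic and the element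
lies in `X`.

For `x ≠ ρ`, the fraction of the caret `b` by the caret `a` is not in `X`. Otherwise the shift of
the cells would replace prefixes near the maximum, hence everywhere by self-similarity; the cell
`0`, which is the complement of its image, would be the cone `0`, and all cells would be those of a
right-vine.

In the corollary, a trivially acting element has denominators whose spine words act as powers of
`a`. Such words can be rewritten by `b^n = a^r` and `b a^r = a^r b`; for the two families, normal
forms show that a word acting as a power of `a` can be rewritten as one. The element is then a
fraction of `a`-coloured trees, hence trivial. -/

theorem number_bind (t : FreeTree S β) (k : ℕ) (f : ℕ → FreeTree S γ) :
    (t.number k).bind f = t.graft fun i => f (k + i) := by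
  induction t generalizing k f with
  | leaf b => simp [number, graft, bind]
  | node c l r hl hr =>
    change node c ((l.number k).bind f) ((r.number (k + l.size)).bind f) =
      node c ((l.number 0).bind _) ((r.number (0 + l.size)).bind _)
    rw [hl k, hr (k + l.size), hl 0, hr (0 + l.size)]
    simp only [Nat.zero_add, Nat.add_assoc]

theorem graft_leaf (b : β) (f : ℕ → FreeTree S γ) : (leaf b).graft f = f 0 := rfl

theorem graft_node (c : S) (l r : FreeTree S β) (f : ℕ → FreeTree S γ) :
    (node c l r).graft f = node c (l.graft f) (r.graft fun i => f (l.size + i)) := by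
  change node c ((l.number 0).bind f) ((r.number (0 + l.size)).bind f) = _
  rw [number_bind r, Nat.zero_add]
  rfl

theorem size_pos (t : FreeTree S β) : 0 < t.size := by
  rw [size_eq_carets]; omega

theorem graft_congr (t : FreeTree S β) {f f' : ℕ → FreeTree S γ} (h : ∀ i < t.size, f i = f' i) :
    t.graft f = t.graft f' := by
  induction t generalizing f f' with
  | leaf b => exact h 0 (by simp [size])
  | node c l r hl hr =>
    simp only [size] at h
    rw [graft_node, graft_node, hl fun i hi => h i (by omega), hr fun i hi => h _ (by omega)]

theorem bind_congr (t : FreeTree S β) {f f' : β → FreeTree S γ} (h : ∀ b ∈ t.leaves, f b = f' b) :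
    t.bind f = t.bind f' := by
  induction t with
  | leaf b => exact h b (by simp [leaves])
  | node c l r hl hr =>
    simp only [leaves, List.mem_append] at h
    rw [bind, bind, hl fun b hb => h b (.inl hb), hr fun b hb => h b (.inr hb)]

theorem graft_bind (t : FreeTree S β) (f : ℕ → FreeTree S γ) (g : γ → FreeTree S δ) :
    (t.graft f).bind g = t.graft fun i => (f i).bind g := bind_assoc _ _ _

theorem recolour_number (φ : S → S') (t : FreeTree S β) (k : ℕ) :
    (t.number k).recolour φ = (t.recolour φ).number k := by
  induction t generalizing k with
  | leaf b => rfl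
  | node c l r hl hr => simp [number, recolour, hl, hr, size_recolour]

theorem recolour_graft (φ : S → S') (t : FreeTree S β) (f : ℕ → FreeTree S γ) :
    (t.graft f).recolour φ = (t.recolour φ).graft fun i => (f i).recolour φ := by
  rw [graft, recolour_bind, recolour_number, graft]

theorem recolour_recolour {S'' : Type} (φ : S → S') (φ' : S' → S'') (t : FreeTree S β) :
    (t.recolour φ).recolour φ' = t.recolour (φ' ∘ φ) := by
  induction t with
  | leaf b => rfl
  | node c l r hl hr => simp [recolour, hl, hr]

theorem recolour_unit (φ : Unit → Unit) (t : FreeTree Unit β) : t.recolour φ = t := by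
  induction t with
  | leaf b => rfl
  | node c l r hl hr => simp [recolour, hl, hr]

theorem length_leaves (t : FreeTree S β) : t.leaves.length = t.size := by
  induction t with
  | leaf b => rfl
  | node c l r hl hr => simp [leaves, size, hl, hr]

theorem rightVine_graft (k : ℕ) (φ : Unit → S) (f : ℕ → FreeTree S γ) :
    ((rightVine (k + 1)).recolour φ).graft f =
      node (φ ()) (f 0) (((rightVine k).recolour φ).graft fun i => f (i + 1)) := by
  rw [rightVine, recolour, graft_node]
  simp [recolour, graft_leaf, size, Nat.add_comm]

/-- A right-vine with an additional caret on its last leaf. -/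
theorem rightVine_graft_last (k : ℕ) (φ : Unit → S) (f : ℕ → FreeTree S γ) :
    ((rightVine (k + 1)).recolour φ).graft f =
      ((rightVine k).recolour φ).graft fun i =>
        if i < k then f i else node (φ ()) (f k) (f (k + 1)) := by
  induction k generalizing f with
  | zero => rw [rightVine_graft]; rfl
  | succ k ih =>
    rw [rightVine_graft, ih, rightVine_graft]
    simp

theorem size_rightVine (k : ℕ) : (rightVine k).size = k + 1 := by
  rw [size_eq_carets, carets_rightVine]

/-- The smallest depth of a leaf. -/
def minDepth : FreeTree S β → ℕ
  | leaf _ => 0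
  | node _ l r => min l.minDepth r.minDepth + 1

theorem minDepth_le_minDepth_bind (t : FreeTree S β) (f : β → FreeTree S γ) :
    t.minDepth ≤ (t.bind f).minDepth := by
  induction t with
  | leaf b => simp [minDepth]
  | node c l r hl hr => simp only [minDepth, bind]; omega

theorem le_minDepth_bind (t : FreeTree S β) (f : β → FreeTree S γ) {D : ℕ}
    (h : ∀ b ∈ t.leaves, D ≤ (f b).minDepth) : D ≤ (t.bind f).minDepth := by
  induction t with
  | leaf b => exact h b (by simp [leaves])
  | node c l r hl hr =>
    simp only [leaves, List.mem_append] at h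
    have h1 := hl fun b hb => h b (.inl hb)
    have h2 := hr fun b hb => h b (.inr hb)
    simp only [minDepth, bind]; omega

/-- A deep tree is obtained by grafting deep trees on a given tree. -/
theorem exists_eq_graft (t : FreeTree Unit β) (T : FreeTree Unit γ) {D : ℕ}
    (h : D + t.carets ≤ T.minDepth) :
    ∃ f : ℕ → FreeTree Unit γ, T = t.graft f ∧ ∀ i, D ≤ (f i).minDepth := by
  induction t generalizing T with
  | leaf b => exact ⟨fun _ => T, rfl, fun _ => h⟩
  | node c l r hl hr =>
    cases T with
    | leaf b => simp [minDepth, carets] at h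
    | node c' l' r' =>
      simp only [minDepth, carets] at h
      obtain ⟨f, hf, hf'⟩ := hl l' (by omega)
      obtain ⟨g, hg, hg'⟩ := hr r' (by omega)
      refine ⟨fun i => if i < l.size then f i else g (i - l.size), ?_, fun i => ?_⟩
      · rw [graft_node, hf, hg]
        congr 1
        · exact graft_congr _ fun i hi => by simp [hi]
        · exact graft_congr _ fun i hi => by simp
      · dsimp only
        split_ifs
        exacts [hf' _, hg' _]

/-- The full monochromatic tree of depth `D`. -/
def full : ℕ → (ℕ → γ) → FreeTree Unit γ
  | 0, φ => leaf (φ 0)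
  | D + 1, φ => node () (full D φ) (full D fun i => φ (2 ^ D + i))

theorem minDepth_full (D : ℕ) (φ : ℕ → γ) : (full D φ).minDepth = D := by
  induction D generalizing φ with
  | zero => rfl
  | succ D ih => simp [full, minDepth, ih]

theorem leaves_full (D : ℕ) (φ : ℕ → γ) : (full D φ).leaves = (List.range (2 ^ D)).map φ := by
  induction D generalizing φ with
  | zero => rfl
  | succ D ih =>
    rw [full, leaves, ih, ih, pow_succ, Nat.mul_two, List.range_add, List.map_append, List.map_map]
    rfl

end FreeTree

/-! ### Skein equivalence, cancellation and equivalence below the root -/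

namespace SkeinPresentation

variable {S : Type} {P : SkeinPresentation S} {β γ δ : Type}

theorem Equiv.graft_congr (t : FreeTree S β) {f f' : ℕ → FreeTree S γ}
    (h : ∀ i < t.size, P.Equiv (f i) (f' i)) : P.Equiv (t.graft f) (t.graft f') := by
  induction t generalizing f f' with
  | leaf b => exact h 0 (by simp [FreeTree.size])
  | node c l r hl hr =>
    simp only [FreeTree.size] at h
    rw [FreeTree.graft_node, FreeTree.graft_node]
    exact .node c (hl fun i hi => h i (by omega)) (hr fun i hi => h _ (by omega))

theorem Equiv.size_eq {t t' : FreeTree S β} (h : P.Equiv t t') : t.size = t'.size := by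
  rw [← FreeTree.length_leaves, ← FreeTree.length_leaves, h.leaves_eq]

theorem Equiv.of_eq {t t' : FreeTree S β} (h : t = t') : P.Equiv t t' := h ▸ .refl _

/-- Carets can be cancelled. -/
def NodeCancel (P : SkeinPresentation S) : Prop :=
  ∀ {β : Type} (c : S) (l r l' r' : FreeTree S β),
    P.Equiv (.node c l r) (.node c l' r') → P.Equiv l l' ∧ P.Equiv r r'

/-- Peeling off the carets of `t` one by one turns cancellation of single carets into
left-cancellation by trees. -/
theorem NodeCancel.bind (h : P.NodeCancel) (t : FreeTree S β) {f f' : β → FreeTree S γ}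
    (hf : P.Equiv (t.bind f) (t.bind f')) : ∀ b ∈ t.leaves, P.Equiv (f b) (f' b) := by
  induction t with
  | leaf b =>
    intro b' hb'
    rw [List.mem_singleton.1 hb']
    exact hf
  | node c l r hl hr =>
    have := h _ _ _ _ _ hf
    intro b hb
    rcases List.mem_append.1 hb with hb | hb
    exacts [hl this.1 b hb, hr this.2 b hb]

/-- `t` and `t'` are equivalent without applying a skein relation at the root. -/
def Below (P : SkeinPresentation S) : FreeTree S β → FreeTree S β → Prop
  | .leaf b, .leaf b' => b = b'
  | .node c l r, .node c' l' r' => c = c' ∧ P.Equiv l l' ∧ P.Equiv r r'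
  | _, _ => False

theorem Below.refl (t : FreeTree S β) : P.Below t t := by
  cases t with
  | leaf b => rfl
  | node c l r => exact ⟨rfl, .refl _, .refl _⟩

theorem Below.symm {t t' : FreeTree S β} (h : P.Below t t') : P.Below t' t := by
  cases t <;> cases t' <;> simp only [Below] at h ⊢
  · exact h.symm
  · exact ⟨h.1.symm, h.2.1.symm, h.2.2.symm⟩

theorem Below.trans {t t' t'' : FreeTree S β} (h : P.Below t t') (h' : P.Below t' t'') :
    P.Below t t'' := by
  cases t <;> cases t' <;> cases t'' <;> simp only [Below] at h h' ⊢
  · exact Eq.trans h h'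
  · exact ⟨h.1.trans h'.1, h.2.1.trans h'.2.1, h.2.2.trans h'.2.2⟩

end SkeinPresentation

theorem thompson_eq_of_equiv {β : Type} {t t' : FreeTree Unit β} (h : thompson.Equiv t t') :
    t = t' := by
  induction h with
  | skein h f => exact h.elim
  | refl t => rfl
  | symm _ ih => exact ih.symm
  | trans _ _ ih ih' => exact ih.trans ih'
  | node c _ _ ih ih' => rw [ih, ih']

theorem thompson_nodeCancel : thompson.NodeCancel := by
  intro β c l r l' r' h
  have := thompson_eq_of_equiv h
  injection this with h1 h2 h3
  exact ⟨.of_eq h2, .of_eq h3⟩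

/-! ### Cancellation of carets -/

section VineCancel

open SkeinPresentation FreeTree

variable {x : FreeTree Unit Unit} {β : Type}

/-- The tree `x(a)`. -/
abbrev aTree {γ : Type} (t : FreeTree Unit γ) : FreeTree Colour γ := t.recolour fun _ => .a

/-- The tree `ρ(b)` with `k` carets. -/
abbrev bVine (k : ℕ) : FreeTree Colour Unit := (rightVine k).recolour fun _ => .b

theorem equiv_vine (f : ℕ → FreeTree Colour β) :
    (vinePresentation x).Equiv ((aTree x).graft f) ((bVine x.carets).graft f) :=
  SkeinPresentation.Equiv.skein (P := vinePresentation x) ⟨rfl, rfl⟩ f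

/-- The description of skein equivalence at the root. -/
def RootRel (x : FreeTree Unit Unit) (t t' : FreeTree Colour β) : Prop :=
  (vinePresentation x).Below t t' ∨
  (∃ f : ℕ → FreeTree Colour β, (vinePresentation x).Below t ((aTree x).graft f) ∧
    (vinePresentation x).Below t' ((bVine x.carets).graft f)) ∨
  (∃ f : ℕ → FreeTree Colour β, (vinePresentation x).Below t ((bVine x.carets).graft f) ∧
    (vinePresentation x).Below t' ((aTree x).graft f))

theorem RootRel.symm {t t' : FreeTree Colour β} (h : RootRel x t t') : RootRel x t' t := by
  rcases h with h | ⟨f, h, h'⟩ | ⟨f, h, h'⟩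
  exacts [.inl h.symm, .inr (.inr ⟨f, h', h⟩), .inr (.inl ⟨f, h', h⟩)]

/-- The carets of `u` are cancelled from the root. Cancellation is assumed only below the size `N`,
because `hC` will be an induction hypothesis. -/
theorem equiv_of_graft_equiv {P : SkeinPresentation Colour} {N : ℕ}
    (hC : ∀ (c : Colour) (l r l' r' : FreeTree Colour β), (node c l r).size < N →
      P.Equiv (node c l r) (node c l' r') → P.Equiv l l' ∧ P.Equiv r r')
    {γ : Type} (u : FreeTree Colour γ) {f f' : ℕ → FreeTree Colour β} (hN : (u.graft f).size < N)
    (h : P.Equiv (u.graft f) (u.graft f')) : ∀ i < u.size, P.Equiv (f i) (f' i) := by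
  induction u generalizing f f' with
  | leaf b =>
    intro i hi
    simp only [size, Nat.lt_one_iff] at hi
    subst hi; exact h
  | node c l r hl hr =>
    rw [graft_node] at hN
    rw [graft_node, graft_node] at h
    obtain ⟨h1, h2⟩ := hC _ _ _ _ _ hN h
    simp only [size] at hN ⊢
    intro i hi
    by_cases hil : i < l.size
    · exact hl (by omega) h1 i hil
    · have := hr (f := fun i => f (l.size + i)) (f' := fun i => f' (l.size + i)) (by omega) h2
        (i - l.size) (by omega)
      simpa only [Nat.add_sub_cancel' (not_lt.1 hil)] using this

/-- `Below` already splits the root caret, so cancellation is needed only in the branches, which are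
strictly smaller. This allows size `N` itself and closes the induction in `rootRel_of_equiv`. -/
theorem equiv_of_graft_below {P : SkeinPresentation Colour} {N : ℕ}
    (hC : ∀ (c : Colour) (l r l' r' : FreeTree Colour β), (node c l r).size < N →
      P.Equiv (node c l r) (node c l' r') → P.Equiv l l' ∧ P.Equiv r r')
    {γ : Type} (c : Colour) (l r : FreeTree Colour γ) {f f' : ℕ → FreeTree Colour β}
    (hN : ((node c l r).graft f).size ≤ N)
    (h : P.Below ((node c l r).graft f) ((node c l r).graft f')) :
    ∀ i < (node c l r).size, P.Equiv (f i) (f' i) := by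
  rw [graft_node] at hN
  rw [graft_node, graft_node] at h
  obtain ⟨-, h1, h2⟩ := h
  have hp1 := size_pos (l.graft f)
  have hp2 := size_pos (r.graft fun i => f (l.size + i))
  simp only [size] at hN ⊢
  intro i hi
  by_cases hil : i < l.size
  · exact equiv_of_graft_equiv hC l (by omega) h1 i hil
  · have := equiv_of_graft_equiv hC r (f := fun i => f (l.size + i))
      (f' := fun i => f' (l.size + i)) (by omega) h2 (i - l.size) (by omega)
    simpa only [Nat.add_sub_cancel' (not_lt.1 hil)] using this

theorem below_graft {P : SkeinPresentation Colour} {γ : Type} (c : Colour)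
    (l r : FreeTree Colour γ) {f f' : ℕ → FreeTree Colour β}
    (h : ∀ i < (node c l r).size, P.Equiv (f i) (f' i)) :
    P.Below ((node c l r).graft f) ((node c l r).graft f') := by
  rw [graft_node, graft_node]
  simp only [size] at h
  exact ⟨rfl, .graft_congr _ fun i hi => h i (by omega), .graft_congr _ fun i hi => h _ (by omega)⟩

/-- The critical case is a skein move at the root followed by the reverse move: the middle tree is
decomposed twice over the same skein tree, cancellation in its smaller parts identifies the grafted
families, and no move remains. Two moves in the same direction are impossible, as the middle tree
would have a root of both colours. -/
theorem RootRel.trans {x₁ x₂ : FreeTree Unit Unit} {N : ℕ}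
    (hC : ∀ (c : Colour) (l r l' r' : FreeTree Colour β), (node c l r).size < N →
      (vinePresentation (node () x₁ x₂)).Equiv (node c l r) (node c l' r') →
        (vinePresentation (node () x₁ x₂)).Equiv l l' ∧
          (vinePresentation (node () x₁ x₂)).Equiv r r')
    {t t' t'' : FreeTree Colour β} (hN : t'.size ≤ N)
    (h : RootRel (node () x₁ x₂) t t') (h' : RootRel (node () x₁ x₂) t' t'') :
    RootRel (node () x₁ x₂) t t'' := by
  have hsize : (bVine (node () x₁ x₂).carets).size = (aTree (node () x₁ x₂)).size := by
    rw [size_recolour, size_recolour, size_rightVine, size_eq_carets]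
  have hb : bVine (node () x₁ x₂).carets =
    node .b (leaf ()) (bVine (x₁.carets + x₂.carets)) := rfl
  have ha : aTree (node () x₁ x₂) = node .a (aTree x₁) (aTree x₂) := rfl
  have hsz : ∀ {s s' : FreeTree Colour β}, (vinePresentation (node () x₁ x₂)).Below s s' →
      s.size = s'.size := by
    intro s s' hs
    cases s <;> cases s' <;> simp only [Below] at hs
    · rfl
    · simp only [size, hs.2.1.size_eq, hs.2.2.size_eq]
  have hab : ∀ f f' : ℕ → FreeTree Colour β, ¬ (vinePresentation (node () x₁ x₂)).Below
      ((aTree (node () x₁ x₂)).graft f) ((bVine (node () x₁ x₂).carets).graft f') := by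
    intro f f' h
    rw [ha, hb, graft_node, graft_node] at h
    exact Colour.noConfusion h.1
  rcases h with h | ⟨f, h1, h2⟩ | ⟨f, h1, h2⟩
  · rcases h' with h' | ⟨f, h1, h2⟩ | ⟨f, h1, h2⟩
    exacts [.inl (h.trans h'), .inr (.inl ⟨f, h.trans h1, h2⟩), .inr (.inr ⟨f, h.trans h1, h2⟩)]
  · rcases h' with h' | ⟨f', h1', h2'⟩ | ⟨f', h1', h2'⟩
    · exact .inr (.inl ⟨f, h1, h'.symm.trans h2⟩)
    · exact (hab _ _ (h1'.symm.trans h2)).elim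
    · have h3 := h2.symm.trans h1'
      have h4 : ∀ i < (bVine (node () x₁ x₂).carets).size,
          (vinePresentation (node () x₁ x₂)).Equiv (f i) (f' i) := by
        exact equiv_of_graft_below hC _ _ _ ((hsz h2).symm.trans_le hN) h3
      refine .inl ((h1.trans ?_).trans h2'.symm)
      exact below_graft _ _ _ fun i hi => h4 i (by rw [hsize]; exact hi)
  · rcases h' with h' | ⟨f', h1', h2'⟩ | ⟨f', h1', h2'⟩
    · exact .inr (.inr ⟨f, h1, h'.symm.trans h2⟩)
    · have h3 := h2.symm.trans h1'
      have h4 : ∀ i < (aTree (node () x₁ x₂)).size,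
          (vinePresentation (node () x₁ x₂)).Equiv (f i) (f' i) := by
        exact equiv_of_graft_below hC _ _ _ ((hsz h2).symm.trans_le hN) h3
      refine .inl ((h1.trans ?_).trans h2'.symm)
      exact below_graft _ _ _ fun i hi => h4 i (by rw [← hsize]; exact hi)
    · exact (hab _ _ (h2.symm.trans h1')).elim

/-- The outer induction, on the number of leaves, provides cancellation in smaller trees. The inner
one runs over the derivation of the equivalence, and only transitivity uses the outer one. -/
theorem rootRel_of_equiv {x₁ x₂ : FreeTree Unit Unit} (N : ℕ) {t t' : FreeTree Colour β}
    (h : (vinePresentation (node () x₁ x₂)).Equiv t t') (hN : t.size ≤ N) :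
    RootRel (node () x₁ x₂) t t' := by
  induction N using Nat.strong_induction_on generalizing t t' with
  | _ N ih =>
    have hC : ∀ (c : Colour) (l r l' r' : FreeTree Colour β), (node c l r).size < N →
        (vinePresentation (node () x₁ x₂)).Equiv (node c l r) (node c l' r') →
          (vinePresentation (node () x₁ x₂)).Equiv l l' ∧
            (vinePresentation (node () x₁ x₂)).Equiv r r' := by
      intro c l r l' r' hlt heq
      rcases ih _ hlt heq le_rfl with h | ⟨f, h1, h2⟩ | ⟨f, h1, h2⟩
      · exact h.2
      · exact (Colour.noConfusion (h1.1.symm.trans h2.1) : False).elim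
      · exact (Colour.noConfusion (h1.1.symm.trans h2.1) : False).elim
    clear ih
    induction h with
    | skein h f =>
      obtain ⟨rfl, rfl⟩ := h
      exact .inr (.inl ⟨f, .refl _, .refl _⟩)
    | refl t => exact .inl (.refl _)
    | symm h ih => exact (ih (by rw [h.size_eq]; exact hN)).symm
    | trans h h' ih ih' =>
      have h1 : _ ≤ N := h.size_eq ▸ hN
      exact (ih hN).trans hC h1 (ih' h1)
    | node c h h' => exact .inl ⟨rfl, h, h'⟩

/-- A skein move at the root changes the colour of the root, so two equivalent trees with the same
root colour are related by the first alternative of `RootRel`, which gives the branches. -/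
theorem vine_nodeCancel (hx : 2 ≤ x.size) : (vinePresentation x).NodeCancel := by
  cases x with
  | leaf b => simp [size] at hx
  | node c x₁ x₂ =>
    intro β c l r l' r' h
    rcases rootRel_of_equiv _ h le_rfl with h | ⟨f, h1, h2⟩ | ⟨f, h1, h2⟩
    · exact h.2
    · exact (Colour.noConfusion (h1.1.symm.trans h2.1) : False).elim
    · exact (Colour.noConfusion (h1.1.symm.trans h2.1) : False).elim

end VineCancel

end ForestSkein


namespace ForestSkein

open SkeinPresentation FreeTree

/-! ### Deep trees are multiples -/

section Spine

variable {β γ δ : Type}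

/-- `Spine D v w t`: the tree `t` is a right-vine with colours `w`, on whose last leaf `v` is glued,
and on whose other leaves `a`-coloured trees of depth at least `D` are glued. -/
inductive Spine (D : ℕ) (v : FreeTree Colour γ) : List Colour → FreeTree Colour γ → Prop
  | nil : Spine D v [] v
  | cons (c : Colour) {w : List Colour} (s : FreeTree Unit γ) {t : FreeTree Colour γ} :
      D ≤ s.minDepth → Spine D v w t → Spine D v (c :: w) (node c (aTree s) t)

theorem Spine.mono {D D' : ℕ} {v t : FreeTree Colour γ} {w : List Colour} (h : Spine D v w t)
    (hD : D' ≤ D) : Spine D' v w t := by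
  induction h with
  | nil => exact .nil
  | cons c s hs _ ih => exact .cons c s (hD.trans hs) ih

theorem Spine.append {D : ℕ} {v v' t : FreeTree Colour γ} {w w' : List Colour}
    (h : Spine D v w t) (h' : Spine D v' w' v) : Spine D v' (w ++ w') t := by
  induction h with
  | nil => exact h'
  | cons c s hs _ ih => exact .cons c s hs ih

theorem Spine.exists_of_append {D : ℕ} {v t : FreeTree Colour γ} {w w' : List Colour}
    (h : Spine D v (w ++ w') t) : ∃ u, Spine D u w t ∧ Spine D v w' u := by
  induction w generalizing t with
  | nil => exact ⟨t, .nil, h⟩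
  | cons c w ih =>
    cases h with
    | cons _ s hs h =>
      obtain ⟨u, hu, hu'⟩ := ih h
      exact ⟨u, .cons c s hs hu, hu'⟩

theorem aTree_bind (t : FreeTree Unit β) (f : β → FreeTree Unit γ) :
    aTree (t.bind f) = (aTree t).bind fun b => aTree (f b) := recolour_bind _ _ _

theorem aTree_graft (t : FreeTree Unit β) (f : ℕ → FreeTree Unit γ) :
    aTree (t.graft f) = (aTree t).graft fun i => aTree (f i) := recolour_graft _ _ _

/-- Gluing `a`-coloured trees on all leaves but the last one. -/
theorem Spine.bind_dropLast {D : ℕ} {v t : FreeTree Colour γ} {w : List Colour} (h : Spine D v w t)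
    (κ : γ → FreeTree Colour δ) (hκ : ∀ c ∈ t.leaves.dropLast, ∃ u, κ c = aTree u) :
    Spine D (v.bind κ) w (t.bind κ) := by
  induction h with
  | nil => exact .nil
  | @cons c w s t hs _ ih =>
    rw [FreeTree.leaves, List.dropLast_append_of_ne_nil (leaves_ne_nil _), leaves_recolour] at hκ
    have h1 : ∀ c : γ, ∃ u : FreeTree Unit δ, c ∈ s.leaves → κ c = aTree u := by
      intro c
      by_cases hc : c ∈ s.leaves
      · obtain ⟨u, hu⟩ := hκ c (List.mem_append_left _ hc)
        exact ⟨u, fun _ => hu⟩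
      -- For labels outside `s` any tree will do. As `δ` is not assumed inhabited, its label is
      -- taken from `κ c`.
      · exact ⟨s.bind fun _ => full 0 fun _ => (κ c).leaves.head (leaves_ne_nil _),
          fun h => (hc h).elim⟩
    choose κ' hκ' using h1
    have h2 : (aTree s).bind κ = aTree (s.bind κ') := by
      rw [aTree_bind]
      exact bind_congr _ fun c hc => hκ' c (by rwa [leaves_recolour] at hc)
    rw [FreeTree.bind, h2]
    exact .cons c _ (hs.trans (minDepth_le_minDepth_bind _ _))
      (ih fun c hc => hκ c (List.mem_append_right _ hc))

/-- Gluing deep `a`-coloured trees on all leaves. -/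
theorem Spine.bind_aTree {D D' : ℕ} {v t : FreeTree Colour γ} {w : List Colour} (h : Spine D v w t)
    (κ : γ → FreeTree Unit δ) (hκ : ∀ c, D' ≤ (κ c).minDepth) :
    Spine D' (v.bind fun c => aTree (κ c)) w (t.bind fun c => aTree (κ c)) := by
  induction h with
  | nil => exact .nil
  | @cons c w s t hs _ ih =>
    rw [FreeTree.bind, ← aTree_bind]
    exact .cons c _ (le_minDepth_bind _ _ fun c _ => hκ c) ih

theorem le_minDepth_graft (t : FreeTree Unit β) (f : ℕ → FreeTree Unit γ) {D : ℕ}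
    (h : ∀ i < t.size, D ≤ (f i).minDepth) : D ≤ (t.graft f).minDepth := by
  induction t generalizing f with
  | leaf b => exact h 0 (by simp [size])
  | node c l r hl hr =>
    simp only [size] at h
    have h1 := hl f fun i hi => h i (by omega)
    have h2 := hr (fun i => f (l.size + i)) fun i hi => h _ (by omega)
    rw [graft_node, minDepth]; omega

/-- The depth of the last leaf. -/
def lastDepth {S : Type} : FreeTree S β → ℕ
  | .leaf _ => 0
  | .node _ _ r => lastDepth r + 1

theorem minDepth_le_lastDepth (t : FreeTree Unit β) : t.minDepth ≤ lastDepth t := by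
  induction t with
  | leaf b => exact le_rfl
  | node c l r hl hr => simp only [minDepth, lastDepth]; omega

/-- Only the last grafted tree lies at the end of the right spine of `u`. All the others are
absorbed, together with the left parts of `u`, into `a`-coloured branches. -/
theorem spine_graft {D : ℕ} (u : FreeTree Unit β) (σ : ℕ → FreeTree Colour γ)
    (h : ∀ i, i + 1 < u.size → ∃ s : FreeTree Unit γ, σ i = aTree s ∧ D ≤ s.minDepth) :
    Spine D (σ (u.size - 1)) (List.replicate (lastDepth u) .a) ((aTree u).graft σ) := by
  induction u generalizing σ with
  | leaf b => exact .nil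
  | node c l r hl hr =>
    have hp := size_pos r
    simp only [size] at h
    have h1 := hr (fun i => σ (l.size + i)) fun i hi => h _ (by omega)
    have : Nonempty (FreeTree Unit γ) :=
      ⟨full 0 fun _ => (σ 0).leaves.head (leaves_ne_nil _)⟩
    choose! τ hτ using h
    have h2 : (aTree l).graft σ = aTree (l.graft τ) := by
      rw [aTree_graft]
      exact FreeTree.graft_congr _ fun i hi => (hτ i (by rw [size_recolour] at hi; omega)).1
    have h3 : (aTree (node c l r)).graft σ =
        node .a (aTree (l.graft τ)) ((aTree r).graft fun i => σ (l.size + i)) := by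
      rw [← h2]
      change (node Colour.a (aTree l) (aTree r)).graft σ = _
      rw [graft_node, size_recolour]
    rw [h3, lastDepth, List.replicate_succ]
    refine .cons _ _ (le_minDepth_graft _ _ fun i hi => (hτ i (by omega)).2) ?_
    simp only [size]
    rw [Nat.add_sub_assoc hp]
    exact h1

/-- A branch of depth `D + u.carets` contains the corresponding left part of `u` with `D` levels to
spare, so a copy of `u` can be split off at the top of the spine. -/
theorem Spine.exists_graft {D : ℕ} (u : FreeTree Unit β) {v t : FreeTree Colour γ}
    {w : List Colour}
    (h : Spine (D + u.carets) v (List.replicate (lastDepth u) .a ++ w) t) :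
    ∃ σ : ℕ → FreeTree Colour γ, t = (aTree u).graft σ ∧
      (∀ i, i + 1 < u.size → ∃ s : FreeTree Unit γ, σ i = aTree s ∧ D ≤ s.minDepth) ∧
      Spine D v w (σ (u.size - 1)) := by
  induction u generalizing t with
  | leaf b =>
    refine ⟨fun _ => t, rfl, fun i hi => ?_, h⟩
    simp [size] at hi
  | node c l r hl hr =>
    rw [lastDepth, List.replicate_succ, List.cons_append] at h
    cases h with
    | @cons _ _ s t hs h =>
      simp only [carets] at h hs
      obtain ⟨σ, rfl, hσ, hσ'⟩ := hr (h.mono (by omega))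
      obtain ⟨f, rfl, hf⟩ := exists_eq_graft (D := D) l s (by omega)
      have hp := size_pos r
      refine ⟨fun i => if i < l.size then aTree (f i) else σ (i - l.size), ?_, fun i hi => ?_, ?_⟩
      · change _ = (node Colour.a (aTree l) (aTree r)).graft _
        rw [graft_node, aTree_graft, size_recolour]
        congr 1
        · refine FreeTree.graft_congr _ fun i hi => ?_
          rw [size_recolour] at hi
          simp [hi]
        · exact FreeTree.graft_congr _ fun i hi => by simp
      · simp only [size] at hi
        dsimp only
        split_ifs with h'
        · exact ⟨f i, rfl, hf i⟩
        · exact hσ _ (by omega)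
      · have h1 : ¬ (node c l r).size - 1 < l.size := by simp only [size]; omega
        have h2 : (node c l r).size - 1 - l.size = r.size - 1 := by simp only [size]; omega
        simp only [h1, if_false, h2]
        exact hσ'

theorem spine_aTree (T : FreeTree Unit γ) :
    ∃ c, Spine 0 (leaf c) (List.replicate (lastDepth T) .a) (aTree T) := by
  induction T with
  | leaf b => exact ⟨b, .nil⟩
  | node c l r hl hr =>
    obtain ⟨c, hc⟩ := hr
    exact ⟨c, .cons _ l (Nat.zero_le _) hc⟩

theorem spine_bVine (k : ℕ) (σ : ℕ → FreeTree Unit γ) :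
    Spine 0 (aTree (σ k)) (List.replicate k .b) ((bVine k).graft fun i => aTree (σ i)) := by
  induction k generalizing σ with
  | zero => exact .nil
  | succ k ih =>
    rw [rightVine_graft]
    exact .cons _ _ (Nat.zero_le _) (ih fun i => σ (i + 1))

/-- The first `N` colours of the spine are `a`. -/
def IsSpine (N : ℕ) (t : FreeTree Colour γ) : Prop :=
  ∃ w c, Spine 0 (leaf c) (List.replicate N .a ++ w) t

theorem isSpine_aTree {N : ℕ} {T : FreeTree Unit γ} (h : N ≤ T.minDepth) : IsSpine N (aTree T) := by
  obtain ⟨c, hc⟩ := spine_aTree T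
  refine ⟨List.replicate (lastDepth T - N) .a, c, ?_⟩
  rw [List.replicate_append_replicate,
    Nat.add_sub_cancel' (h.trans (minDepth_le_lastDepth T))]
  exact hc

variable {x : FreeTree Unit Unit}

/-- Replace `x(a)` by the vine `ρ(b)`. The caret `b` above it makes a vine with one more caret,
which is also `ρ(b)` with a caret `b` on its last leaf; then replace this `ρ(b)` by `x(a)`. -/
theorem equiv_shift (hx : 2 ≤ x.size) (s : FreeTree Colour γ) (σ : ℕ → FreeTree Colour γ) :
    (vinePresentation x).Equiv (node .b s ((aTree x).graft σ))
      ((aTree x).graft fun i => if i = 0 then s else if i < x.carets then σ (i - 1) else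
        node .b (σ (x.carets - 1)) (σ x.carets)) := by
  have hn : 1 ≤ x.carets := by rw [size_eq_carets] at hx; omega
  refine (Equiv.node _ (.refl _) (equiv_vine σ)).trans (.trans (.of_eq ?_) (equiv_vine _).symm)
  have h1 := rightVine_graft x.carets (fun _ => Colour.b) fun i => if i = 0 then s else σ (i - 1)
  simp only [if_true, Nat.add_eq_zero_iff, one_ne_zero, and_false, if_false,
    Nat.add_sub_cancel] at h1
  rw [← h1, rightVine_graft_last]
  refine FreeTree.graft_congr _ fun i hi => ?_
  rw [size_recolour, size_rightVine] at hi
  rcases Nat.eq_zero_or_pos i with rfl | hi'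
  · simp [show 0 < x.carets from hn]
  · have h0 : x.carets ≠ 0 := by omega
    simp [hi'.ne', h0]

/-- A deep `a`-coloured tree is equivalent to a tree whose root has the colour `b`, and whose other
vertices have the colour `a` with the exception of a part far to the right. -/
theorem exists_equiv_node_b (hx : 2 ≤ x.size) (d M : ℕ) : ∃ D, ∀ (γ : Type) (T : FreeTree Unit γ),
    D ≤ T.minDepth → ∃ (s : FreeTree Unit γ) (T' : FreeTree Unit (Option γ))
      (v : FreeTree Colour γ) (L : List γ) (w : List Colour) (c : γ),
      (vinePresentation x).Equiv (aTree T)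
        (node .b (aTree s) ((aTree T').bind fun o => o.elim v leaf)) ∧
      d ≤ s.minDepth ∧ min d M ≤ T'.minDepth ∧ T'.leaves = L.map some ++ [none] ∧
      Spine 0 (leaf c) w v := by
  have hn : 1 ≤ x.carets := by rw [size_eq_carets] at hx; omega
  obtain ⟨n, hn'⟩ : ∃ n, x.carets = n + 1 := ⟨x.carets - 1, by omega⟩
  -- Each round carries a caret `b` up through one more copy of `x(a)` and thereby deepens `T'` by
  -- at least one level. The depth is capped at `d` because the other branches are only known to
  -- have depth `d`.
  induction M with
  | zero =>
    refine ⟨d + x.carets, fun γ T hT => ?_⟩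
    obtain ⟨u, rfl, hu⟩ := exists_eq_graft x T hT
    obtain ⟨c, hc⟩ := spine_aTree (u (n + 1))
    refine ⟨u 0, leaf none, (bVine n).graft fun i => aTree (u (i + 1)), [], _, c, ?_, hu 0,
      by simp [minDepth], rfl, (spine_bVine n fun i => u (i + 1)).append hc⟩
    rw [aTree_graft]
    refine (equiv_vine _).trans (.of_eq ?_)
    rw [hn', rightVine_graft]
    rfl
  | succ M ih =>
    obtain ⟨D, hD⟩ := ih
    refine ⟨max d D + x.carets, fun γ T hT => ?_⟩
    obtain ⟨τ, rfl, hτ⟩ := exists_eq_graft x T hT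
    obtain ⟨s, T', v, L, w, c, h1, h2, h3, h4, h5⟩ :=
      hD γ (τ x.carets) ((le_max_right _ _).trans (hτ _))
    -- `equiv_shift` is used from right to left: `τ 0` becomes the left branch of the new root, the
    -- middle branches move down by one index, and the branches `s` and `T'` of the old caret `b`
    -- take the last two places.
    let σ : ℕ → FreeTree Unit γ := fun i => if i < n then τ (i + 1) else s
    let σ' : ℕ → FreeTree Unit (Option γ) := fun i =>
      if i < x.carets then (σ i).bind fun c => leaf (some c) else T'
    have hκ : ∀ u : FreeTree Unit γ, (aTree (u.bind fun c => leaf (some c))).bind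
        (fun o : Option γ => o.elim v leaf) = aTree u := by
      intro u
      rw [aTree_bind, bind_assoc]
      exact bind_leaf _
    refine ⟨τ 0, x.graft σ', v, ((List.range' 0 x.carets).flatMap fun i => (σ i).leaves) ++ L, w, c,
      ?_, (le_max_left _ _).trans (hτ _), ?_, ?_, h5⟩
    · rw [aTree_graft x σ', graft_bind]
      refine .trans ?_ (equiv_shift hx _ _).symm
      rw [aTree_graft]
      refine .graft_congr _ fun i hi => ?_
      rw [size_recolour, size_eq_carets] at hi
      split_ifs with h6 h7
      · rw [h6]; exact .refl _
      · have h8 : i - 1 < x.carets := by omega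
        have h9 : i - 1 < n := by omega
        have h10 : i - 1 + 1 = i := by omega
        simp only [σ', h8, if_true, hκ]
        simp only [σ, h9, if_true, h10]
        exact .refl _
      · have h8 : i = x.carets := by omega
        have h9 : x.carets - 1 < x.carets := by omega
        have h10 : ¬ x.carets - 1 < n := by omega
        simp only [σ', h9, if_true, hκ, lt_irrefl, if_false]
        simp only [σ, h10, if_false]
        rw [h8]
        exact h1
    · have hall : ∀ i, min d M ≤ (σ' i).minDepth := by
        intro i
        simp only [σ', σ]
        split_ifs
        · exact (min_le_left _ _).trans (((le_max_left _ _).trans (hτ _)).trans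
            (minDepth_le_minDepth_bind _ _))
        · exact (min_le_left _ _).trans (h2.trans (minDepth_le_minDepth_bind _ _))
        · exact h3
      -- The root caret of `x` adds one level above the grafted trees, all of depth at least `min d
      -- M`.
      cases x with
      | leaf b => simp [carets] at hn
      | node c l r =>
        have e1 := le_minDepth_graft l σ' fun i _ => hall i
        have e2 := le_minDepth_graft r (fun i => σ' (l.size + i)) fun i _ => hall _
        rw [graft_node, minDepth]
        omega
    · rw [leaves_graft, size_eq_carets, List.range'_1_concat, List.flatMap_append, List.map_append,
        List.append_assoc]
      congr 1
      · rw [List.map_flatMap]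
        refine List.flatMap_congr fun i hi => ?_
        have : i < x.carets := by simpa using List.mem_range'_1.1 hi
        simp only [σ', this, if_true, leaves_bind, leaves]
        exact List.flatMap_pure_eq_map _ _
      · simp [σ', h4]

end Spine

/-- Every tree with distinct labels divides all the deep `a`-coloured trees, with quotients that
satisfy `Q`. -/
def DividesDeep {S : Type} (P : SkeinPresentation S) (a : S)
    (Q : ∀ γ : Type, FreeTree S γ → Prop) : Prop :=
  ∀ (β : Type) (t : FreeTree S β), t.leaves.Nodup → ∃ D, ∀ (γ : Type) (T : FreeTree Unit γ),
    D ≤ T.minDepth → ∃ f : β → FreeTree S γ, P.Equiv (t.bind f) (T.recolour fun _ => a) ∧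
      ∀ b ∈ t.leaves, Q γ (f b)

theorem thompson_dividesDeep : DividesDeep thompson () fun _ _ => True := by
  intro β t ht
  induction t with
  | leaf b => exact ⟨0, fun γ T _ => ⟨fun _ => T.recolour fun _ => (), .refl _, fun _ _ => trivial⟩⟩
  | node c l r hl hr =>
    rw [FreeTree.leaves, List.nodup_append] at ht
    obtain ⟨D₁, h₁⟩ := hl ht.1
    obtain ⟨D₂, h₂⟩ := hr ht.2.1
    refine ⟨max D₁ D₂ + 1, fun γ T hT => ?_⟩
    cases T with
    | leaf b => simp [minDepth] at hT
    | node c' l' r' =>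
      simp only [minDepth] at hT
      obtain ⟨f, hf, -⟩ := h₁ γ l' (by omega)
      obtain ⟨g, hg, -⟩ := h₂ γ r' (by omega)
      classical
      refine ⟨fun b => if b ∈ l.leaves then f b else g b, ?_, fun _ _ => trivial⟩
      refine .node () (.trans (.of_eq ?_) hf) (.trans (.of_eq ?_) hg)
      · exact bind_congr _ fun b hb => by simp [hb]
      · refine bind_congr _ fun b hb => ?_
        have : b ∉ l.leaves := fun hb' => ht.2.2 b hb' b hb rfl
        simp [this]

/-- By induction on `t`. Below a root `a`, the tree `T` is split at its root. For a root `b`, `T` is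
first rewritten with root `b`; its right branch is then `a`-coloured apart from the tree `v` on the
marked leaf `none`, so the induction hypothesis applies to `T'`, and `v` is glued back afterwards.
-/
theorem vine_dividesDeep {x : FreeTree Unit Unit} (hx : 2 ≤ x.size) (N : ℕ) :
    DividesDeep (vinePresentation x) .a fun _ => IsSpine N := by
  intro β t ht
  induction t with
  | leaf b => exact ⟨N, fun γ T hT => ⟨fun _ => aTree T, .refl _, fun _ _ => isSpine_aTree hT⟩⟩
  | node c l r hl hr =>
    rw [FreeTree.leaves, List.nodup_append] at ht
    obtain ⟨D₁, h₁⟩ := hl ht.1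
    obtain ⟨D₂, h₂⟩ := hr ht.2.1
    cases c with
    | a =>
      refine ⟨max D₁ D₂ + 1, fun γ T hT => ?_⟩
      cases T with
      | leaf b => simp [minDepth] at hT
      | node c' l' r' =>
        simp only [minDepth] at hT
        obtain ⟨f, hf, hf'⟩ := h₁ γ l' (by omega)
        obtain ⟨g, hg, hg'⟩ := h₂ γ r' (by omega)
        classical
        have hl' : ∀ b ∈ r.leaves, b ∉ l.leaves := fun b hb hb' => ht.2.2 b hb' b hb rfl
        refine ⟨fun b => if b ∈ l.leaves then f b else g b, ?_, fun b hb => ?_⟩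
        · refine .node _ (.trans (.of_eq ?_) hf) (.trans (.of_eq ?_) hg)
          · exact bind_congr _ fun b hb => by simp [hb]
          · exact bind_congr _ fun b hb => by simp [hl' b hb]
        · rcases List.mem_append.1 hb with hb | hb
          · simpa [hb] using hf' b hb
          · simpa [hl' b hb] using hg' b hb
    | b =>
      obtain ⟨D, hD⟩ := exists_equiv_node_b hx (max D₁ D₂) (max D₁ D₂)
      refine ⟨D, fun γ T hT => ?_⟩
      obtain ⟨s, T', v, L, w, c, e1, e2, e3, e4, e5⟩ := hD γ T hT
      rw [min_self] at e3
      obtain ⟨f, hf, hf'⟩ := h₁ γ s ((le_max_left _ _).trans e2)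
      obtain ⟨g, hg, hg'⟩ := h₂ (Option γ) T' ((le_max_right _ _).trans e3)
      classical
      have hl' : ∀ b ∈ r.leaves, b ∉ l.leaves := fun b hb hb' => ht.2.2 b hb' b hb rfl
      refine ⟨fun b => if b ∈ l.leaves then f b else (g b).bind fun o => o.elim v leaf, ?_,
        fun b hb => ?_⟩
      · refine .trans (.node _ (.trans (.of_eq ?_) hf) (.trans (.of_eq ?_)
          (hg.bind_left fun o => o.elim v leaf))) e1.symm
        · exact bind_congr _ fun b hb => by simp [hb]
        · rw [bind_assoc]
          exact bind_congr _ fun b hb => by simp [hl' b hb]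
      · rcases List.mem_append.1 hb with hb | hb
        · simpa [hb] using hf' b hb
        · simp only [hl' b hb, if_false]
          -- The leaves of the quotients `g b` are consecutive blocks of the leaves of `T'`, where
          -- `none` occurs only at the very end. So `none` can only be the last leaf of `g b`, and
          -- gluing `v` there prolongs the spine without spoiling any branch.
          have hnone : none ∉ (g b).leaves.dropLast := by
            have h6 := hg.leaves_eq
            rw [leaves_recolour, e4, leaves_bind] at h6
            obtain ⟨A, B, hAB⟩ := List.append_of_mem hb
            rw [hAB] at h6
            simp only [List.flatMap_append, List.flatMap_cons] at h6
            intro hmem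
            obtain ⟨A', B', hAB'⟩ := List.append_of_mem hmem
            rw [← List.dropLast_append_getLast (leaves_ne_nil (g b)), hAB'] at h6
            have h7 := congrArg List.dropLast h6
            have : none ∈ L.map some := by
              rw [List.dropLast_concat] at h7
              rw [← h7]
              simp only [List.append_assoc, List.cons_append]
              rw [List.dropLast_append_of_ne_nil (by simp),
                List.dropLast_append_of_ne_nil (by simp), List.dropLast_cons_of_ne_nil (by simp)]
              simp
            simp at this
          obtain ⟨w', o, h6⟩ := hg' b hb
          have h7 := h6.bind_dropLast (fun o => o.elim v leaf) fun o ho => by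
            cases o with
            | none => exact (hnone ho).elim
            | some c => exact ⟨leaf c, rfl⟩
          cases o with
          | none => exact ⟨w' ++ w, c, by rw [← List.append_assoc]; exact h7.append e5⟩
          | some c => exact ⟨w', c, h7⟩

end ForestSkein


namespace ForestSkein

open SkeinPresentation FreeTree

/-! ### The Ore property -/

section Ore

variable {S : Type} {P : SkeinPresentation S} {X : ThompsonType} {k m n : ℕ}

/-- The forest obtained by colouring the vertices of a monochromatic forest by `a`. -/
def Forest.colour (P : SkeinPresentation S) (a : S) (f : Forest thompson X m n) :
    Forest P X m n where
  tree i := (f.tree i).colour P a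
  admissible := by
    simp only [Tree.leaves_colour]
    exact f.admissible

theorem Forest.colour_comp (P : SkeinPresentation S) (a : S) (f : Forest thompson X k m)
    (g : Forest thompson X m n) : (f.comp g).colour P a = (f.colour P a).comp (g.colour P a) :=
  Forest.ext (funext fun _ => Tree.colour_bind P a _ _)

/-- The labels of the `i`-th tree of `fullForest`. -/
def fullLabel (k D : ℕ) (i : Fin k) (j : ℕ) : Fin (k * 2 ^ D) :=
  ⟨(i * 2 ^ D + j) % (k * 2 ^ D), Nat.mod_lt _ (Nat.mul_pos i.pos (by positivity))⟩

theorem flatMap_fullLabel (k D : ℕ) :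
    ((List.finRange k).flatMap fun i => (List.range (2 ^ D)).map (fullLabel k D i)) =
      List.finRange (k * 2 ^ D) := by
  apply List.map_injective_iff.2 Fin.val_injective
  rw [List.map_coe_finRange_eq_range, List.map_flatMap]
  have h1 : ∀ i : Fin k, List.map Fin.val ((List.range (2 ^ D)).map (fullLabel k D i)) =
      (List.range (2 ^ D)).map fun j => (i : ℕ) * 2 ^ D + j := by
    intro i
    rw [List.map_map]
    refine List.map_congr_left fun j hj => ?_
    have hj' := List.mem_range.1 hj
    -- The reduction in `fullLabel` merely provides a value for every `j`; it has no effect on the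
    -- labels that occur.
    refine Nat.mod_eq_of_lt ?_
    calc (i : ℕ) * 2 ^ D + j < (i + 1) * 2 ^ D := by rw [Nat.add_one_mul]; omega
      _ ≤ k * 2 ^ D := Nat.mul_le_mul_right _ i.isLt
  simp only [h1]
  have h2 : ∀ k : ℕ, ((List.range k).flatMap fun i =>
      (List.range (2 ^ D)).map fun j => i * 2 ^ D + j) = List.range (k * 2 ^ D) := by
    intro k
    induction k with
    | zero => simp
    | succ k ih => rw [List.range_succ, List.flatMap_append, ih, Nat.add_one_mul, List.range_add]; simp
  rw [← h2, ← List.map_coe_finRange_eq_range (n := k), List.flatMap_map]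

/-- The monochromatic forest that consists of `k` full trees of depth `D`. -/
def fullForest (X : ThompsonType) (k D : ℕ) : Forest thompson X k (k * 2 ^ D) where
  tree i := Tree.mk _ (full D (fullLabel k D i))
  admissible := by
    simp only [Tree.leaves_mk, leaves_full]
    rw [flatMap_fullLabel]
    exact X.admissible_finRange _

theorem Forest.nodup_leaves_tree (f : Forest P X m n) (i : Fin m) : (f.tree i).leaves.Nodup :=
  (List.nodup_flatMap.1 f.nodup_leaves).1 i (List.mem_finRange i)

/-- Every forest divides the full monochromatic forests of sufficiently large depth. -/
theorem Forest.exists_comp_eq_full {a : S} {Q : ∀ γ : Type, FreeTree S γ → Prop}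
    (hD : DividesDeep P a Q) (f : Forest P X k n) : ∃ D₀, ∀ D ≥ D₀,
      ∃ e : Forest P X n (k * 2 ^ D), f.comp e = (fullForest X k D).colour P a ∧
        ∀ j, ∃ t, e.tree j = Tree.mk P t ∧ Q _ t := by
  choose t ht using fun i => Tree.exists_mk (f.tree i)
  have hnd : ∀ i, (t i).leaves.Nodup := fun i => by
    have := f.nodup_leaves_tree i
    rwa [← ht i] at this
  choose D hD using fun i => hD _ (t i) (hnd i)
  refine ⟨Finset.univ.sup D, fun D' hD' => ?_⟩
  choose e he he' using fun i => hD i _ (full D' (fullLabel k D' i)) (by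
    rw [minDepth_full]
    exact (Finset.le_sup (f := D) (Finset.mem_univ i)).trans hD')
  -- The tree of `f` that owns the leaf `j`; the quotients of the separate trees are assembled along
  -- this map.
  choose r hr using fun j => f.exists_mem_leaves j
  have key : ∀ i, (f.tree i).bind (fun j => Tree.mk P (e (r j) j)) =
      ((fullForest X k D').colour P a).tree i := by
    intro i
    rw [← ht i, Tree.mk_bind]
    refine Tree.mk_eq_mk.2 (.trans (.of_eq ?_) (he i))
    refine bind_congr _ fun j hj => ?_
    have h1 : j ∈ (f.tree i).leaves := by rw [← ht i]; exact hj
    rw [f.eq_of_mem_leaves (hr j) h1]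
  let e' : Forest P X n (k * 2 ^ D') :=
    { tree := fun j => Tree.mk P (e (r j) j)
      admissible := by
        refine (X.admissible_finRange n).flatMap f.admissible ?_
        rw [← Forest.flatMap_leaves_comp]
        simp only [key]
        exact ((fullForest X k D').colour P a).admissible }
  refine ⟨e', Forest.ext (funext key), fun j => ⟨_, rfl, he' _ _ ?_⟩⟩
  have := hr j
  rwa [← ht] at this

/-- Two forests with the same roots divide a common full `a`-coloured forest as soon as it is deep
enough. For cancellation, the tree of `f` that contains the leaf `j` is peeled off caret by caret.
-/
theorem isOre_of_dividesDeep {a : S} {Q : ∀ γ : Type, FreeTree S γ → Prop}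
    (hD : DividesDeep P a Q) (hC : P.NodeCancel) (X : ThompsonType) :
    IsOre (ForestCategory P X) where
  cancel := by
    rintro ⟨c⟩ ⟨d⟩ ⟨e⟩ f p q h
    refine Forest.ext (funext fun j => ?_)
    obtain ⟨i, hi⟩ := Forest.exists_mem_leaves f j
    have h1 : (Forest.tree f i).bind (Forest.tree p) = (Forest.tree f i).bind (Forest.tree q) :=
      congrFun (congrArg Forest.tree h) i
    obtain ⟨t, ht⟩ := Tree.exists_mk (Forest.tree f i)
    obtain ⟨p', hp'⟩ := Tree.exists_mk_family (Forest.tree p)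
    obtain ⟨q', hq'⟩ := Tree.exists_mk_family (Forest.tree q)
    rw [← ht] at h1 hi
    rw [hp', hq', Tree.mk_bind, Tree.mk_bind] at h1
    change p.tree j = q.tree j
    have h2 := hC.bind t (Tree.mk_eq_mk.1 h1) j hi
    exact (congrFun hp' j).trans ((Tree.mk_eq_mk.2 h2).trans (congrFun hq' j).symm)
  multiple := by
    rintro ⟨c⟩ ⟨d⟩ ⟨e⟩ f g
    obtain ⟨D₁, h₁⟩ := Forest.exists_comp_eq_full hD f
    obtain ⟨D₂, h₂⟩ := Forest.exists_comp_eq_full hD g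
    obtain ⟨p, hp, -⟩ := h₁ (max D₁ D₂) (le_max_left _ _)
    obtain ⟨q, hq, -⟩ := h₂ (max D₁ D₂) (le_max_right _ _)
    exact ⟨⟨_⟩, p, q, hp.trans hq.symm⟩

theorem thompson_isOre (X : ThompsonType) : IsOre (ForestCategory thompson X) :=
  isOre_of_dividesDeep thompson_dividesDeep thompson_nodeCancel X

theorem vine_isOre {x : FreeTree Unit Unit} (hx : 2 ≤ x.size) (X : ThompsonType) :
    IsOre (ForestCategory (vinePresentation x) X) :=
  isOre_of_dividesDeep (vine_dividesDeep hx 0) (vine_nodeCancel hx) X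

end Ore

/-! ### The Cantor space -/

/-- The Cantor space of infinite binary sequences. -/
abbrev Cantor : Type := ℕ → Bool

namespace Cantor

/-- The sequence without its first entry. -/
def tail (z : Cantor) : Cantor := fun i => z (i + 1)

/-- The sequence with an additional first entry. -/
def cons (b : Bool) (z : Cantor) : Cantor
  | 0 => b
  | i + 1 => z i

@[simp] theorem cons_zero (b : Bool) (z : Cantor) : cons b z 0 = b := rfl

@[simp] theorem cons_succ (b : Bool) (z : Cantor) (i : ℕ) : cons b z (i + 1) = z i := rfl

@[simp] theorem tail_cons (b : Bool) (z : Cantor) : tail (cons b z) = z := rfl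

@[simp] theorem cons_tail (z : Cantor) : cons (z 0) (tail z) = z := by
  funext i; cases i <;> rfl

theorem cons_inj {b b' : Bool} {z z' : Cantor} : cons b z = cons b' z' ↔ b = b' ∧ z = z' := by
  refine ⟨fun h => ⟨congrFun h 0, congrArg tail h⟩, ?_⟩
  rintro ⟨rfl, rfl⟩; rfl

/-- The sequence with a prefix. -/
def app : List Bool → Cantor → Cantor
  | [], z => z
  | b :: w, z => cons b (app w z)

@[simp] theorem app_nil (z : Cantor) : app [] z = z := rfl

@[simp] theorem app_cons (b : Bool) (w : List Bool) (z : Cantor) :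
    app (b :: w) z = cons b (app w z) := rfl

theorem app_append (w w' : List Bool) (z : Cantor) : app (w ++ w') z = app w (app w' z) := by
  induction w with
  | nil => rfl
  | cons b w ih => simp [ih]

theorem app_injective (w : List Bool) : Function.Injective (app w) := by
  induction w with
  | nil => exact Function.injective_id
  | cons b w ih => exact fun z z' h => ih (cons_inj.1 h).2

theorem app_length_add (w : List Bool) (z : Cantor) (i : ℕ) : app w z (w.length + i) = z i := by
  induction w with
  | nil => simp
  | cons b w ih => rw [List.length_cons, add_right_comm, app_cons, cons_succ, ih]

/-- The constant sequence. -/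
def const (b : Bool) : Cantor := fun _ => b

@[simp] theorem cons_const (b : Bool) : cons b (const b) = const b := by
  funext i; cases i <;> rfl

@[simp] theorem tail_const (b : Bool) : tail (const b) = const b := rfl

theorem app_replicate_const (b : Bool) (k : ℕ) : app (List.replicate k b) (const b) = const b := by
  induction k with
  | zero => rfl
  | succ k ih => simp [List.replicate_succ, ih]

theorem app_eq_const {w : List Bool} {z : Cantor} {b : Bool} (h : app w z = const b) :
    w = List.replicate w.length b ∧ z = const b := by
  induction w with
  | nil => exact ⟨rfl, h⟩
  | cons c w ih =>
    rw [← cons_const, app_cons, cons_inj] at h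
    obtain ⟨h1, h2⟩ := ih h.2
    refine ⟨?_, h2⟩
    rw [List.length_cons, List.replicate_succ, h.1, ← h1]

/-- The first entries of a sequence. -/
theorem exists_eq_app (z : Cantor) (N : ℕ) : ∃ w z', w.length = N ∧ z = app w z' := by
  induction N generalizing z with
  | zero => exact ⟨[], z, rfl, rfl⟩
  | succ N ih =>
    obtain ⟨w, z', hw, hz⟩ := ih (tail z)
    exact ⟨z 0 :: w, z', by simp [hw], by rw [app_cons, ← hz, cons_tail]⟩

/-- Two words that are equal as maps are equal. -/
theorem app_left_injective {w w' : List Bool} (h : ∀ z, app w z = app w' z) : w = w' := by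
  induction w generalizing w' with
  | nil =>
    cases w' with
    | nil => rfl
    | cons b w' => simpa [const] using congrFun (h (const !b)) 0
  | cons b w ih =>
    cases w' with
    | nil => simpa [const] using congrFun (h (const !b)) 0
    | cons b' w' =>
      rw [(cons_inj.1 (h (const b))).1, ih fun z => (cons_inj.1 (h z)).2]

end Cantor

end ForestSkein


namespace ForestSkein

open SkeinPresentation FreeTree Cantor

/-! ### Locating points of the Cantor space in trees -/

section Locate

variable {S S' β γ : Type}

/-- If each colour `c` splits the Cantor space by means of `step c`, then a tree sends a point to
the label of a leaf and to a point below this leaf. -/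
def loc (step : S → Cantor → Bool × Cantor) : FreeTree S β → Cantor → β × Cantor
  | .leaf b, z => (b, z)
  | .node c l r, z =>
    bif (step c z).1 then loc step r (step c z).2 else loc step l (step c z).2

variable {step : S → Cantor → Bool × Cantor}

theorem loc_node_false {c : S} (l r : FreeTree S β) {z y : Cantor} (h : step c z = (false, y)) :
    loc step (node c l r) z = loc step l y := by simp [loc, h]

theorem loc_node_true {c : S} (l r : FreeTree S β) {z y : Cantor} (h : step c z = (true, y)) :
    loc step (node c l r) z = loc step r y := by simp [loc, h]

theorem loc_bind (t : FreeTree S β) (f : β → FreeTree S γ) (z : Cantor) :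
    loc step (t.bind f) z = loc step (f (loc step t z).1) (loc step t z).2 := by
  induction t generalizing z with
  | leaf b => rfl
  | node c l r hl hr =>
    rcases h : step c z with ⟨_ | _, y⟩
    · rw [FreeTree.bind, loc_node_false _ _ h, loc_node_false _ _ h, hl]
    · rw [FreeTree.bind, loc_node_true _ _ h, loc_node_true _ _ h, hr]

theorem loc_recolour {step : S' → Cantor → Bool × Cantor} (φ : S → S') (t : FreeTree S β)
    (z : Cantor) : loc step (t.recolour φ) z = loc (fun c => step (φ c)) t z := by
  induction t generalizing z with
  | leaf b => rfl
  | node c l r hl hr =>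
    simp only [recolour, loc, hl, hr]

theorem loc_mem_leaves (t : FreeTree S β) (z : Cantor) : (loc step t z).1 ∈ t.leaves := by
  induction t generalizing z with
  | leaf b => simp [loc, FreeTree.leaves]
  | node c l r hl hr =>
    rcases h : step c z with ⟨_ | _, y⟩
    · rw [loc_node_false _ _ h]
      exact List.mem_append_left _ (hl y)
    · rw [loc_node_true _ _ h]
      exact List.mem_append_right _ (hr y)

theorem loc_surjective (hs : ∀ c, Function.Surjective (step c)) (t : FreeTree S β) {b : β}
    (hb : b ∈ t.leaves) (y : Cantor) : ∃ z, loc step t z = (b, y) := by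
  induction t with
  | leaf b' =>
    rw [List.mem_singleton.1 hb]
    exact ⟨y, rfl⟩
  | node c l r hl hr =>
    rcases List.mem_append.1 hb with hb | hb
    · obtain ⟨z, hz⟩ := hl hb
      obtain ⟨u, hu⟩ := hs c (false, z)
      exact ⟨u, by rw [loc_node_false _ _ hu, hz]⟩
    · obtain ⟨z, hz⟩ := hr hb
      obtain ⟨u, hu⟩ := hs c (true, z)
      exact ⟨u, by rw [loc_node_true _ _ hu, hz]⟩

theorem loc_injective (hs : ∀ c, Function.Injective (step c)) (t : FreeTree S β)
    (ht : t.leaves.Nodup) : Function.Injective (loc step t) := by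
  induction t with
  | leaf b =>
    intro z z' h
    exact (Prod.mk.inj h).2
  | node c l r hl hr =>
    rw [FreeTree.leaves, List.nodup_append] at ht
    intro z z' h
    apply hs c
    rcases hz : step c z with ⟨_ | _, y⟩ <;> rcases hz' : step c z' with ⟨_ | _, y'⟩
    · rw [loc_node_false _ _ hz, loc_node_false _ _ hz'] at h
      rw [hl ht.1 h]
    · rw [loc_node_false _ _ hz, loc_node_true _ _ hz'] at h
      exact (ht.2.2 _ (loc_mem_leaves (step := step) l y) _ (loc_mem_leaves (step := step) r y')
        (congrArg Prod.fst h)).elim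
    · rw [loc_node_true _ _ hz, loc_node_false _ _ hz'] at h
      exact (ht.2.2 _ (loc_mem_leaves (step := step) l y') _ (loc_mem_leaves (step := step) r y)
        (congrArg Prod.fst h).symm).elim
    · rw [loc_node_true _ _ hz, loc_node_true _ _ hz'] at h
      rw [hr ht.2.1 h]

/-- Monochromatic trees split the Cantor space according to the first entries. -/
abbrev locA (t : FreeTree Unit β) (z : Cantor) : β × Cantor :=
  loc (fun _ z => (z 0, Cantor.tail z)) t z

theorem exists_word (T : FreeTree Unit β) (z : Cantor) :
    ∃ w b y, z = app w y ∧ T.minDepth ≤ w.length ∧ ∀ y', locA T (app w y') = (b, y') := by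
  induction T generalizing z with
  | leaf b => exact ⟨[], b, z, rfl, le_rfl, fun _ => rfl⟩
  | node c l r hl hr =>
    rw [← cons_tail z]
    cases z 0
    · obtain ⟨w, b, y, h1, hb, h2⟩ := hl (Cantor.tail z)
      exact ⟨false :: w, b, y, by rw [h1, app_cons], by simp only [minDepth, List.length_cons]; omega, h2⟩
    · obtain ⟨w, b, y, h1, hb, h2⟩ := hr (Cantor.tail z)
      exact ⟨true :: w, b, y, by rw [h1, app_cons], by simp only [minDepth, List.length_cons]; omega, h2⟩

theorem stepA_bijective : Function.Bijective fun z : Cantor => (z 0, Cantor.tail z) := by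
  constructor
  · intro z z' h
    rw [← cons_tail z, ← cons_tail z', (Prod.mk.inj h).1, (Prod.mk.inj h).2]
  · rintro ⟨b, y⟩
    exact ⟨cons b y, rfl⟩

theorem exists_word_of_mem (T : FreeTree Unit β) {b : β} (hb : b ∈ T.leaves) :
    ∃ w, ∀ y, locA T (app w y) = (b, y) := by
  obtain ⟨z, hz⟩ := loc_surjective (step := fun _ z => (z 0, Cantor.tail z))
    (fun _ => stepA_bijective.2) T hb (const false)
  obtain ⟨w, b', y, rfl, -, h⟩ := exists_word T z
  refine ⟨w, fun y => ?_⟩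
  rw [h y, ← (Prod.mk.inj ((h _).symm.trans hz)).1]

/-- A monochromatic tree with distinct labels is determined by the points it locates. -/
theorem eq_of_locA_eq {T T' : FreeTree Unit β} (hT : T.leaves.Nodup) (hT' : T'.leaves.Nodup)
    (h : ∀ z, locA T z = locA T' z) : T = T' := by
  induction T generalizing T' with
  | leaf b =>
    cases T' with
    | leaf b' => rw [(Prod.mk.inj (h (const true))).1]
    | node c l r =>
      rw [FreeTree.leaves, List.nodup_append] at hT'
      have h1 := loc_mem_leaves (step := fun _ z => (z 0, Cantor.tail z)) l (const false)
      have h2 := loc_mem_leaves (step := fun _ z => (z 0, Cantor.tail z)) r (const true)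
      have h3 := congrArg Prod.fst (h (cons false (const false)))
      have h4 := congrArg Prod.fst (h (cons true (const true)))
      exact (hT'.2.2 _ h1 _ h2 (h3.symm.trans h4)).elim
  | node c l r hl hr =>
    cases T' with
    | leaf b' =>
      rw [FreeTree.leaves, List.nodup_append] at hT
      have h1 := loc_mem_leaves (step := fun _ z => (z 0, Cantor.tail z)) l (const false)
      have h2 := loc_mem_leaves (step := fun _ z => (z 0, Cantor.tail z)) r (const true)
      have h3 := congrArg Prod.fst (h (cons false (const false)))
      have h4 := congrArg Prod.fst (h (cons true (const true)))
      exact (hT.2.2 _ h1 _ h2 (h3.trans h4.symm)).elim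
    | node c' l' r' =>
      rw [FreeTree.leaves, List.nodup_append] at hT hT'
      rw [hl hT.1 hT'.1 fun z => h (cons false z), hr hT.2.1 hT'.2.1 fun z => h (cons true z)]

/-- The part of a monochromatic tree below a word. -/
theorem exists_subtree (T : FreeTree Unit β) (u : List Bool) :
    (∃ T' : FreeTree Unit β, ∀ z, locA T (app u z) = locA T' z) ∨
      ∃ b v, v ≠ [] ∧ ∀ z, locA T (app u z) = (b, app v z) := by
  induction T generalizing u with
  | leaf b =>
    cases u with
    | nil => exact .inl ⟨leaf b, fun _ => rfl⟩
    | cons c u => exact .inr ⟨b, c :: u, by simp, fun _ => rfl⟩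
  | node c l r hl hr =>
    cases u with
    | nil => exact .inl ⟨node c l r, fun _ => rfl⟩
    | cons c' u =>
      cases c'
      exacts [hl u, hr u]

/-- The address of the `i`-th leaf. -/
def leafWord : FreeTree S β → ℕ → List Bool
  | .leaf _, _ => []
  | .node _ l r, i => if i < l.size then false :: leafWord l i else true :: leafWord r (i - l.size)

theorem leafWord_last (t : FreeTree S β) :
    leafWord t (t.size - 1) = List.replicate (lastDepth t) true := by
  induction t with
  | leaf b => rfl
  | node c l r hl hr =>
    have := size_pos r
    have h1 : ¬ (node c l r).size - 1 < l.size := by simp only [size]; omega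
    have h2 : (node c l r).size - 1 - l.size = r.size - 1 := by simp only [size]; omega
    rw [leafWord, if_neg h1, h2, hr, lastDepth, List.replicate_succ]

theorem exists_leafWord (t : FreeTree S β) (z : Cantor) :
    ∃ i y, i < t.size ∧ z = app (leafWord t i) y := by
  induction t generalizing z with
  | leaf b => exact ⟨0, z, by simp [size], rfl⟩
  | node c l r hl hr =>
    rw [← cons_tail z]
    cases z 0
    · obtain ⟨i, y, hi, h⟩ := hl (Cantor.tail z)
      exact ⟨i, y, by simp only [size]; omega, by rw [leafWord, if_pos hi, app_cons, ← h]⟩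
    · obtain ⟨i, y, hi, h⟩ := hr (Cantor.tail z)
      refine ⟨l.size + i, y, by simp only [size]; omega, ?_⟩
      rw [leafWord, if_neg (by omega), Nat.add_sub_cancel_left, app_cons, ← h]

/-- Only the colour `a` is constrained, so the lemma serves both the monochromatic trees and the
model of the two-coloured category. -/
theorem loc_graft_leafWord {step : Colour → Cantor → Bool × Cantor}
    (ha : ∀ z, step .a z = (z 0, Cantor.tail z)) (t : FreeTree Unit β)
    (f : ℕ → FreeTree Colour γ) {i : ℕ} (hi : i < t.size) (y : Cantor) :
    loc step ((aTree t).graft f) (app (leafWord t i) y) = loc step (f i) y := by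
  induction t generalizing f i with
  | leaf b =>
    simp only [size, Nat.lt_one_iff] at hi
    subst hi; rfl
  | node c l r hl hr =>
    have h : (aTree (node c l r)).graft f =
        node .a ((aTree l).graft f) ((aTree r).graft fun i => f (l.size + i)) := by
      change (node Colour.a (aTree l) (aTree r)).graft f = _
      rw [graft_node, size_recolour]
    rw [h, leafWord]
    split_ifs with hi'
    · rw [loc_node_false _ _ (ha _)]
      exact hl f hi'
    · simp only [size] at hi
      rw [loc_node_true _ _ (ha _)]
      have := hr (fun i => f (l.size + i)) (i := i - l.size) (by omega)
      rwa [Nat.add_sub_cancel' (not_lt.1 hi')] at this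

/-- Once each leaf is labelled by its own number, locating the point recovers both the number and
the remainder. -/
theorem leafWord_injective (t : FreeTree Unit β) {i j : ℕ} (hi : i < t.size) (hj : j < t.size)
    {y y' : Cantor} (h : app (leafWord t i) y = app (leafWord t j) y') : i = j ∧ y = y' := by
  have h1 := loc_graft_leafWord (step := fun _ z => (z 0, Cantor.tail z)) (fun _ => rfl) t leaf hi y
  have h2 := loc_graft_leafWord (step := fun _ z => (z 0, Cantor.tail z)) (fun _ => rfl) t leaf hj y'
  rw [h, h2] at h1
  exact ⟨(Prod.mk.inj h1).1.symm, (Prod.mk.inj h1).2.symm⟩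

end Locate

/-! ### The model of the category on the Cantor space -/

section Model

variable (x : FreeTree Unit Unit)

/-- The addresses of the leaves of the infinite tree obtained by repeatedly glueing `x` on the last
leaf of `x`. -/
def cellWord (i : ℕ) : List Bool :=
  (List.replicate (i / x.carets) (leafWord x x.carets)).flatten ++ leafWord x (i % x.carets)

/-- The point `y` of the `i`-th cell. -/
def cell (i : ℕ) (y : Cantor) : Cantor := app (cellWord x i) y

variable {x}

theorem cell_of_lt {i : ℕ} (hi : i < x.carets) (y : Cantor) : cell x i y = app (leafWord x i) y := by
  simp [cell, cellWord, Nat.div_eq_of_lt hi, Nat.mod_eq_of_lt hi]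

theorem carets_pos (hx : 2 ≤ x.size) : 0 < x.carets := by rw [size_eq_carets] at hx; omega

theorem cell_add (hx : 2 ≤ x.size) (i : ℕ) (y : Cantor) :
    cell x (i + x.carets) y = app (leafWord x x.carets) (cell x i y) := by
  rw [cell, cell, cellWord, cellWord, Nat.add_div_right _ (carets_pos hx), Nat.add_mod_right,
    List.replicate_succ, List.flatten_cons, List.append_assoc, app_append]

theorem leafWord_carets : leafWord x x.carets = List.replicate (lastDepth x) true := by
  rw [← leafWord_last, size_eq_carets, Nat.add_sub_cancel]

theorem lastDepth_pos (hx : 2 ≤ x.size) : 0 < lastDepth x := by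
  cases x with
  | leaf b => simp [size] at hx
  | node c l r => simp [lastDepth]

theorem leafWord_ne {i : ℕ} (hi : i < x.carets) (y : Cantor) (z : Cantor) :
    app (leafWord x i) y ≠ app (leafWord x x.carets) z := by
  intro h
  have := (leafWord_injective x (by rw [size_eq_carets]; omega)
    (by rw [size_eq_carets]; omega) h).1
  omega

theorem cell_ne_const (hx : 2 ≤ x.size) (i : ℕ) (y : Cantor) : cell x i y ≠ const true := by
  induction i using Nat.strong_induction_on with
  | _ i ih =>
    intro h
    by_cases hi : i < x.carets
    · rw [cell_of_lt hi, ← app_replicate_const true (lastDepth x), ← leafWord_carets] at h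
      exact leafWord_ne hi _ _ h
    · obtain ⟨j, rfl⟩ := Nat.exists_eq_add_of_le' (not_lt.1 hi)
      rw [cell_add hx] at h
      exact ih j (by have := carets_pos hx; omega) (app_eq_const h).2

theorem cell_injective (hx : 2 ≤ x.size) {i j : ℕ} {y y' : Cantor}
    (h : cell x i y = cell x j y') : i = j ∧ y = y' := by
  have hp := carets_pos hx
  induction i using Nat.strong_induction_on generalizing j with
  | _ i ih =>
    by_cases hi : i < x.carets <;> by_cases hj : j < x.carets
    · rw [cell_of_lt hi, cell_of_lt hj] at h
      exact leafWord_injective x (by rw [size_eq_carets]; omega) (by rw [size_eq_carets]; omega) h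
    · obtain ⟨j, rfl⟩ := Nat.exists_eq_add_of_le' (not_lt.1 hj)
      rw [cell_of_lt hi, cell_add hx] at h
      exact (leafWord_ne hi _ _ h).elim
    · obtain ⟨i, rfl⟩ := Nat.exists_eq_add_of_le' (not_lt.1 hi)
      rw [cell_of_lt hj, cell_add hx] at h
      exact (leafWord_ne hj _ _ h.symm).elim
    · obtain ⟨i, rfl⟩ := Nat.exists_eq_add_of_le' (not_lt.1 hi)
      obtain ⟨j, rfl⟩ := Nat.exists_eq_add_of_le' (not_lt.1 hj)
      rw [cell_add hx, cell_add hx] at h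
      obtain ⟨h1, h2⟩ := ih i (by omega) (app_injective _ h)
      exact ⟨by omega, h2⟩

/-- A sequence other than the maximum has a zero. Unless it lies in one of the first cells, it
starts with the `lastDepth x` ones that lead to the last leaf of `x`; removing them brings the zero
closer to the front. -/
theorem exists_cell (hx : 2 ≤ x.size) {z : Cantor} (hz : z ≠ const true) :
    ∃ i y, z = cell x i y := by
  obtain ⟨k, hk⟩ : ∃ k, z k = false := by
    by_contra h
    push Not at h
    exact hz (funext fun k => by simpa [const] using h k)
  clear hz
  induction k using Nat.strong_induction_on generalizing z with
  | _ k ih =>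
    obtain ⟨i, y, hi, rfl⟩ := exists_leafWord x z
    rw [size_eq_carets] at hi
    by_cases hi' : i < x.carets
    · exact ⟨i, y, (cell_of_lt hi' y).symm⟩
    · obtain rfl : i = x.carets := by omega
      by_cases hk' : k < lastDepth x
      · exfalso
        have h1 : ∀ (m : ℕ), k < m → app (List.replicate m true) y k = true := by
          intro m hm
          clear * - hm
          induction m generalizing k with
          | zero => omega
          | succ m ih =>
            cases k with
            | zero => rfl
            | succ k => exact ih k (by omega)
        rw [leafWord_carets, h1 _ hk'] at hk
        exact Bool.noConfusion hk
      · obtain ⟨k, rfl⟩ := Nat.exists_eq_add_of_le (not_lt.1 hk')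
        have h1 := app_length_add (leafWord x x.carets) y k
        rw [leafWord_carets, List.length_replicate, ← leafWord_carets, hk] at h1
        obtain ⟨j, y', rfl⟩ := ih k (by have := lastDepth_pos hx; omega) h1.symm
        exact ⟨j + x.carets, y', (cell_add hx j y').symm⟩

variable (x)

open Classical in
/-- The way in which a caret of colour `a` or `b` splits the Cantor space. -/
noncomputable def step : Colour → Cantor → Bool × Cantor
  | .a, z => (z 0, Cantor.tail z)
  | .b, z =>
    if h : ∃ p : ℕ × Cantor, z = cell x p.1 p.2 then
      if h.choose.1 = 0 then (false, h.choose.2) else (true, cell x (h.choose.1 - 1) h.choose.2)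
    else (true, z)

variable {x}

/-- As the cells are disjoint, the decomposition picked by choice in `step` is the given one. -/
theorem step_b_cell_zero (hx : 2 ≤ x.size) (y : Cantor) : step x .b (cell x 0 y) = (false, y) := by
  have h : ∃ p : ℕ × Cantor, cell x 0 y = cell x p.1 p.2 := ⟨(0, y), rfl⟩
  obtain ⟨h1, h2⟩ := cell_injective hx h.choose_spec
  rw [step, dif_pos h, if_pos h1.symm, ← h2]

theorem step_b_cell_succ (hx : 2 ≤ x.size) (i : ℕ) (y : Cantor) :
    step x .b (cell x (i + 1) y) = (true, cell x i y) := by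
  have h : ∃ p : ℕ × Cantor, cell x (i + 1) y = cell x p.1 p.2 := ⟨(i + 1, y), rfl⟩
  obtain ⟨h1, h2⟩ := cell_injective hx h.choose_spec
  rw [step, dif_pos h, if_neg (by omega), ← h2, ← h1, Nat.add_sub_cancel]

theorem step_b_const (hx : 2 ≤ x.size) : step x .b (const true) = (true, const true) := by
  have h : ¬ ∃ p : ℕ × Cantor, const true = cell x p.1 p.2 := by
    rintro ⟨p, hp⟩
    exact cell_ne_const hx _ _ hp.symm
  rw [step, dif_neg h]

theorem step_bijective (hx : 2 ≤ x.size) (c : Colour) : Function.Bijective (step x c) := by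
  cases c with
  | a => exact stepA_bijective
  | b =>
    constructor
    · intro z z' h
      by_cases hz : z = const true <;> by_cases hz' : z' = const true
      · rw [hz, hz']
      · obtain ⟨i, y, rfl⟩ := exists_cell hx hz'
        rw [hz, step_b_const hx] at h
        cases i with
        | zero => rw [step_b_cell_zero hx] at h; simp at h
        | succ i =>
          rw [step_b_cell_succ hx] at h
          exact (cell_ne_const hx _ _ (Prod.mk.inj h).2.symm).elim
      · obtain ⟨i, y, rfl⟩ := exists_cell hx hz
        rw [hz', step_b_const hx] at h
        cases i with
        | zero => rw [step_b_cell_zero hx] at h; simp at h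
        | succ i =>
          rw [step_b_cell_succ hx] at h
          exact (cell_ne_const hx _ _ (Prod.mk.inj h).2).elim
      · obtain ⟨i, y, rfl⟩ := exists_cell hx hz
        obtain ⟨j, y', rfl⟩ := exists_cell hx hz'
        cases i <;> cases j <;>
          simp only [step_b_cell_zero hx, step_b_cell_succ hx, Prod.mk.injEq, true_and,
            Bool.false_eq_true, false_and, reduceCtorEq] at h
        · rw [h]
        · obtain ⟨rfl, rfl⟩ := cell_injective hx h
          rfl
    · rintro ⟨_ | _, z⟩
      · exact ⟨_, step_b_cell_zero hx z⟩
      · by_cases hz : z = const true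
        · exact ⟨_, by rw [hz, step_b_const hx]⟩
        · obtain ⟨i, y, rfl⟩ := exists_cell hx hz
          exact ⟨_, step_b_cell_succ hx i y⟩

theorem loc_bVine_cell (hx : 2 ≤ x.size) {γ : Type} (k : ℕ) (f : ℕ → FreeTree Colour γ) {i : ℕ}
    (hi : i < k) (y : Cantor) :
    loc (step x) ((bVine k).graft f) (cell x i y) = loc (step x) (f i) y := by
  induction k generalizing f i with
  | zero => omega
  | succ k ih =>
    rw [rightVine_graft]
    cases i with
    | zero => rw [loc_node_false _ _ (step_b_cell_zero hx y)]
    | succ i =>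
      rw [loc_node_true _ _ (step_b_cell_succ hx i y)]
      exact ih (fun i => f (i + 1)) (by omega)

theorem loc_bVine_cell_add (hx : 2 ≤ x.size) {γ : Type} (k : ℕ) (f : ℕ → FreeTree Colour γ)
    (i : ℕ) (y : Cantor) :
    loc (step x) ((bVine k).graft f) (cell x (i + k) y) = loc (step x) (f k) (cell x i y) := by
  induction k generalizing f with
  | zero => rfl
  | succ k ih =>
    rw [rightVine_graft, ← Nat.add_assoc, loc_node_true _ _ (step_b_cell_succ hx _ y)]
    exact ih fun i => f (i + 1)

theorem loc_bVine_const (hx : 2 ≤ x.size) {γ : Type} (k : ℕ) (f : ℕ → FreeTree Colour γ) :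
    loc (step x) ((bVine k).graft f) (const true) = loc (step x) (f k) (const true) := by
  induction k generalizing f with
  | zero => rfl
  | succ k ih =>
    rw [rightVine_graft, loc_node_true _ _ (step_b_const hx)]
    exact ih fun i => f (i + 1)

/-- `step` is made for this identity. The first `x.carets` cells are the cones of the leaves of `x`
other than the last; on the later cells, moving back `x.carets` times removes precisely the address
of the last leaf; the maximum goes to the last leaf on both sides. -/
theorem loc_skein (hx : 2 ≤ x.size) {γ : Type} (f : ℕ → FreeTree Colour γ) (z : Cantor) :
    loc (step x) ((aTree x).graft f) z = loc (step x) ((bVine x.carets).graft f) z := by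
  have hsz : x.carets < x.size := by rw [size_eq_carets]; omega
  by_cases hz : z = const true
  · rw [hz, loc_bVine_const hx]
    conv_lhs => rw [← app_replicate_const true (lastDepth x), ← leafWord_carets]
    exact loc_graft_leafWord (fun _ => rfl) x f hsz _
  · obtain ⟨i, y, rfl⟩ := exists_cell hx hz
    by_cases hi : i < x.carets
    · rw [loc_bVine_cell hx _ _ hi, cell_of_lt hi]
      exact loc_graft_leafWord (fun _ => rfl) x f (hi.trans hsz) _
    · obtain ⟨j, rfl⟩ := Nat.exists_eq_add_of_le' (not_lt.1 hi)
      rw [loc_bVine_cell_add hx, cell_add hx]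
      exact loc_graft_leafWord (fun _ => rfl) x f hsz _

theorem loc_eq_of_equiv (hx : 2 ≤ x.size) {β : Type} {t t' : FreeTree Colour β}
    (h : (vinePresentation x).Equiv t t') (z : Cantor) : loc (step x) t z = loc (step x) t' z := by
  induction h generalizing z with
  | skein h f =>
    obtain ⟨rfl, rfl⟩ := h
    exact loc_skein hx f z
  | refl t => rfl
  | symm _ ih => exact (ih z).symm
  | trans _ _ ih ih' => exact (ih z).trans (ih' z)
  | node c _ _ ih ih' => simp only [loc, ih, ih']

theorem loc_aTree {β : Type} (T : FreeTree Unit β) (z : Cantor) :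
    loc (step x) (aTree T) z = locA T z := loc_recolour _ _ _

/-- The location of a point in a tree of the category. -/
noncomputable def treeLoc (hx : 2 ≤ x.size) {β : Type} (t : (vinePresentation x).Tree β)
    (z : Cantor) : β × Cantor :=
  Quotient.lift (s := (vinePresentation x).setoid β) (fun t => loc (step x) t z)
    (fun _ _ h => loc_eq_of_equiv hx h z) t

theorem treeLoc_mk (hx : 2 ≤ x.size) {β : Type} (t : FreeTree Colour β) (z : Cantor) :
    treeLoc hx (Tree.mk _ t) z = loc (step x) t z := rfl

theorem treeLoc_bind (hx : 2 ≤ x.size) {β γ : Type} (t : (vinePresentation x).Tree β)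
    (f : β → (vinePresentation x).Tree γ) (z : Cantor) :
    treeLoc hx (t.bind f) z = treeLoc hx (f (treeLoc hx t z).1) (treeLoc hx t z).2 := by
  obtain ⟨t, rfl⟩ := Tree.exists_mk t
  obtain ⟨f, rfl⟩ := Tree.exists_mk_family f
  rw [Tree.mk_bind]
  exact loc_bind t f z

theorem treeLoc_pure (hx : 2 ≤ x.size) {β : Type} (b : β) (z : Cantor) :
    treeLoc hx (Tree.pure b) z = (b, z) := rfl

theorem treeLoc_mem_leaves (hx : 2 ≤ x.size) {β : Type} (t : (vinePresentation x).Tree β)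
    (z : Cantor) : (treeLoc hx t z).1 ∈ t.leaves := by
  obtain ⟨t, rfl⟩ := Tree.exists_mk t
  exact loc_mem_leaves t z

end Model

end ForestSkein


namespace ForestSkein

open SkeinPresentation FreeTree Cantor

/-! ### The Cantor space as the canonical space -/

section CanonicalModel

variable {x : FreeTree Unit Unit} {X : ThompsonType} {k m n : ℕ}

theorem Forest.leaves_one {S : Type} {P : SkeinPresentation S} (t : Forest P X 1 n) :
    t.leaves = (t.tree 0).leaves := by
  simp [Forest.leaves, List.finRange_succ]

/-- The location of a point in a forest with one root. -/
noncomputable def forestLoc (hx : 2 ≤ x.size) (t : Forest (vinePresentation x) X 1 n)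
    (z : Cantor) : Fin n × Cantor := treeLoc hx (t.tree 0) z

theorem forestLoc_comp (hx : 2 ≤ x.size) (t : Forest (vinePresentation x) X 1 m)
    (f : Forest (vinePresentation x) X m n) (z : Cantor) :
    forestLoc hx (t.comp f) z = treeLoc hx (f.tree (forestLoc hx t z).1) (forestLoc hx t z).2 :=
  treeLoc_bind hx _ _ z

theorem forestLoc_bijective (hx : 2 ≤ x.size) (t : Forest (vinePresentation x) X 1 n) :
    Function.Bijective (forestLoc hx t) := by
  obtain ⟨t', ht'⟩ := Tree.exists_mk (t.tree 0)
  have h1 : t'.leaves = t.leaves := by rw [Forest.leaves_one, ← ht']; rfl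
  have h2 : ∀ z, forestLoc hx t z = loc (step x) t' z := by
    intro z
    rw [forestLoc, ← ht']; rfl
  constructor
  · intro z z' h
    rw [h2, h2] at h
    exact loc_injective (fun c => (step_bijective hx c).1) t' (h1 ▸ t.nodup_leaves) h
  · rintro ⟨j, y⟩
    obtain ⟨z, hz⟩ := loc_surjective (fun c => (step_bijective hx c).2) t' (b := j)
      (h1 ▸ t.mem_leaves j) y
    exact ⟨z, (h2 z).trans hz⟩

/-- The point of the canonical space that is given by a point of the Cantor space. -/
noncomputable def toPoint (hx : 2 ≤ x.size) (z : Cantor) :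
    CanonicalSpace (vinePresentation x) where
  leaf t := (forestLoc hx t z).1
  compat t f := by
    rw [forestLoc_comp]
    exact treeLoc_mem_leaves hx _ _

theorem label_toPoint (hx : 2 ≤ x.size) (z : Cantor) (t : Forest (vinePresentation x) .V 1 n) :
    (toPoint hx z).label t = (forestLoc hx t z).1 := by
  have h : forestLoc hx t.plane z =
      (t.perm.symm (forestLoc hx t z).1, (forestLoc hx t z).2) := by
    change treeLoc hx ((t.tree 0).bind fun j => Tree.pure (t.perm.symm j)) z = _
    rw [treeLoc_bind, treeLoc_pure]; rfl
  change t.perm (forestLoc hx t.plane z).1 = _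
  rw [h]
  exact t.perm.apply_symm_apply _

/-- `Moves` tests the labels in all refinements, and these depend only on the leaf and on the
remainder found by `forestLoc`. -/
theorem move_toPoint (hx : 2 ≤ x.size) (hV : IsOre (ForestCategory (vinePresentation x) .V))
    {p q : Forest (vinePresentation x) .V 1 n} {z z' : Cantor}
    (h : forestLoc hx p z' = forestLoc hx q z) :
    CanonicalSpace.move hV p q (toPoint hx z) = toPoint hx z' := by
  refine CanonicalSpace.Moves.unique hV (CanonicalSpace.moves_move hV p q _) fun f => ?_
  rw [label_toPoint, label_toPoint, forestLoc_comp, forestLoc_comp, h]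

theorem continuous_locA {β : Type} [TopologicalSpace β] [DiscreteTopology β]
    (T : FreeTree Unit β) : Continuous fun z => (locA T z).1 := by
  induction T with
  | leaf b => exact continuous_const
  | node c l r hl hr =>
    have ht : Continuous Cantor.tail := continuous_pi fun i => continuous_apply (i + 1)
    have h : (fun z => (locA (node c l r) z).1) = fun z : Cantor =>
        (fun p : Bool × β × β => bif p.1 then p.2.2 else p.2.1)
          (z 0, (locA l (Cantor.tail z)).1, (locA r (Cantor.tail z)).1) := by
      funext z
      change (bif z 0 then locA r (Cantor.tail z) else locA l (Cantor.tail z)).1 = _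
      cases z 0 <;> rfl
    rw [h]
    exact (continuous_of_discreteTopology
        (f := fun p : Bool × β × β => bif p.1 then p.2.2 else p.2.1)).comp
      ((continuous_apply 0).prodMk ((hl.comp ht).prodMk (hr.comp ht)))

theorem forestLoc_colour_full (hx : 2 ≤ x.size) (D : ℕ) (z : Cantor) :
    forestLoc hx ((fullForest X 1 D).colour (vinePresentation x) .a) z =
      locA (full D (fullLabel 1 D 0)) z := loc_aTree _ z

theorem exists_factor_full (hx : 2 ≤ x.size) (t : Forest (vinePresentation x) X 1 n) :
    ∃ D₀, ∀ D ≥ D₀, ∃ e, t.comp e = (fullForest X 1 D).colour (vinePresentation x) .a := by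
  obtain ⟨D₀, h⟩ := t.exists_comp_eq_full (vine_dividesDeep hx 0)
  refine ⟨D₀, fun D hD => ?_⟩
  obtain ⟨e, he, -⟩ := h D hD
  exact ⟨e, he⟩

/-- As `t` divides a full `a`-coloured tree, the chosen leaf is a function of finitely many digits,
although carets `b` read unboundedly many. -/
theorem continuous_forestLoc (hx : 2 ≤ x.size) (t : Forest (vinePresentation x) X 1 n) :
    Continuous fun z => (forestLoc hx t z).1 := by
  obtain ⟨D, h⟩ := exists_factor_full hx t
  obtain ⟨e, he⟩ := h D le_rfl
  choose r hr using fun j => e.exists_mem_leaves j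
  have h1 : (fun z => (forestLoc hx t z).1) =
      fun z => r (locA (full D (fullLabel 1 D 0)) z).1 := by
    funext z
    refine e.eq_of_mem_leaves ?_ (hr _)
    rw [← forestLoc_colour_full (X := X) hx, ← he, forestLoc_comp]
    exact treeLoc_mem_leaves hx _ _
  rw [h1]
  exact (continuous_of_discreteTopology (f := r)).comp (continuous_locA _)

theorem continuous_toPoint (hx : 2 ≤ x.size) : Continuous (toPoint hx) :=
  continuous_induced_rng.2 (continuous_pi fun t => continuous_forestLoc hx t.2)

theorem nodup_full (D : ℕ) : (full D (fullLabel 1 D 0)).leaves.Nodup :=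
  (fullForest .F 1 D).nodup_leaves_tree 0

/-- The full `a`-coloured tree of depth `i + 1` reveals the digit number `i`. -/
theorem toPoint_injective (hx : 2 ≤ x.size) : Function.Injective (toPoint hx) := by
  intro z z' h
  funext i
  have h1 : (locA (full (i + 1) (fullLabel 1 (i + 1) 0)) z).1 =
      (locA (full (i + 1) (fullLabel 1 (i + 1) 0)) z').1 := by
    rw [← forestLoc_colour_full (X := .F) hx, ← forestLoc_colour_full (X := .F) hx]
    exact congrArg (fun p : CanonicalSpace _ => p.leaf _) h
  obtain ⟨w, b, y, rfl, hw, h2⟩ := exists_word (full (i + 1) (fullLabel 1 (i + 1) 0)) z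
  obtain ⟨w', b', y', rfl, -, h2'⟩ := exists_word (full (i + 1) (fullLabel 1 (i + 1) 0)) z'
  rw [h2, h2'] at h1
  obtain rfl : b = b' := h1
  have h3 : app w y' = app w' y' := loc_injective (fun _ => stepA_bijective.1) _ (nodup_full _)
    ((h2 y').trans (h2' y').symm)
  rw [minDepth_full] at hw
  rw [← h3]
  have h4 : ∀ (w : List Bool) (i : ℕ), i < w.length → app w y i = app w y' i := by
    intro w i hi
    induction w generalizing i with
    | nil => simp at hi
    | cons c w ih =>
      cases i with
      | zero => rfl
      | succ i => exact ih i (by simpa using hi)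
  exact h4 w i hw

/-- By compactness: each tree prescribes a nonempty closed set of sequences, and these sets are
directed because any two trees divide a common full one. -/
theorem toPoint_surjective (hx : 2 ≤ x.size) : Function.Surjective (toPoint hx) := by
  intro p
  let K : (Σ n : ℕ, Forest (vinePresentation x) .F 1 n) → Set Cantor :=
    fun t => {z | (forestLoc hx t.2 z).1 = p.leaf t.2}
  have hmul : ∀ {m n : ℕ} (t : Forest (vinePresentation x) .F 1 m)
      (e : Forest (vinePresentation x) .F m n), K ⟨n, t.comp e⟩ ⊆ K ⟨m, t⟩ := by
    intro m n t e z hz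
    refine e.eq_of_mem_leaves (j := p.leaf (t.comp e)) ?_ (p.compat t e)
    rw [← show (forestLoc hx (t.comp e) z).1 = _ from hz, forestLoc_comp]
    exact treeLoc_mem_leaves hx _ _
  have hcl : ∀ t, IsClosed (K t) := fun t =>
    isClosed_eq (continuous_forestLoc hx t.2) continuous_const
  have hne : (⋂ t, K t).Nonempty := by
    have : Nonempty (Σ n : ℕ, Forest (vinePresentation x) .F 1 n) := ⟨⟨1, Forest.id _ _ _⟩⟩
    refine IsCompact.nonempty_iInter_of_directed_nonempty_isCompact_isClosed K ?_ ?_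
      (fun t => (hcl t).isCompact) hcl
    · rintro ⟨m, t⟩ ⟨n, u⟩
      obtain ⟨D₁, h₁⟩ := exists_factor_full hx t
      obtain ⟨D₂, h₂⟩ := exists_factor_full hx u
      obtain ⟨e, he⟩ := h₁ (max D₁ D₂) (le_max_left _ _)
      obtain ⟨f, hf⟩ := h₂ (max D₁ D₂) (le_max_right _ _)
      refine ⟨⟨_, (fullForest .F 1 (max D₁ D₂)).colour _ .a⟩, ?_, ?_⟩
      · rw [← he]; exact hmul t e
      · rw [← hf]; exact hmul u f
    · rintro ⟨n, t⟩
      obtain ⟨z, hz⟩ := (forestLoc_bijective hx t).2 (p.leaf t, const true)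
      exact ⟨z, congrArg Prod.fst hz⟩
  obtain ⟨z, hz⟩ := hne
  refine ⟨z, CanonicalSpace.ext (funext fun n => funext fun t => ?_)⟩
  exact Set.mem_iInter.1 hz ⟨n, t⟩

instance (P : SkeinPresentation Colour) : T2Space (CanonicalSpace P) := by
  refine T2Space.of_injective_continuous
    (f := fun (p : CanonicalSpace P) (t : Σ n : ℕ, Forest P .F 1 n) => (p.leaf t.2 : Fin t.1)) ?_
    continuous_induced_dom
  intro p q h
  exact CanonicalSpace.ext (funext fun n => funext fun t => congrFun h ⟨n, t⟩)

/-- The canonical space is the Cantor space. -/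
noncomputable def pointHomeo (hx : 2 ≤ x.size) : Cantor ≃ₜ CanonicalSpace (vinePresentation x) :=
  Continuous.homeoOfEquivCompactToT2
    (f := Equiv.ofBijective (toPoint hx) ⟨toPoint_injective hx, toPoint_surjective hx⟩)
    (continuous_toPoint hx)

/-! ### Identified points -/

theorem leafWord_zero {S β : Type} (t : FreeTree S β) :
    ∃ k, leafWord t 0 = List.replicate k false := by
  induction t with
  | leaf b => exact ⟨0, rfl⟩
  | node c l r hl hr =>
    obtain ⟨k, hk⟩ := hl
    exact ⟨k + 1, by rw [leafWord, if_pos (size_pos l), hk, List.replicate_succ]⟩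

theorem step_const_false (hx : 2 ≤ x.size) (c : Colour) :
    step x c (const false) = (false, const false) := by
  cases c with
  | a => rfl
  | b =>
    obtain ⟨k, hk⟩ := leafWord_zero x
    have h : cell x 0 (const false) = const false := by
      rw [cell_of_lt (carets_pos hx), hk, app_replicate_const]
    conv_lhs => rw [← h]
    exact step_b_cell_zero hx _

theorem step_const_true (hx : 2 ≤ x.size) (c : Colour) :
    step x c (const true) = (true, const true) := by
  cases c with
  | a => rfl
  | b => exact step_b_const hx

theorem loc_const_false {S β : Type} {step : S → Cantor → Bool × Cantor}
    (h : ∀ c, step c (const false) = (false, const false)) (t : FreeTree S β) :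
    ∃ b, t.leaves.head? = some b ∧ loc step t (const false) = (b, const false) := by
  induction t with
  | leaf b => exact ⟨b, rfl, rfl⟩
  | node c l r hl hr =>
    obtain ⟨b, hb, hb'⟩ := hl
    refine ⟨b, ?_, by rw [loc_node_false _ _ (h c), hb']⟩
    rw [FreeTree.leaves, List.head?_append, hb]; rfl

theorem loc_const_true {S β : Type} {step : S → Cantor → Bool × Cantor}
    (h : ∀ c, step c (const true) = (true, const true)) (t : FreeTree S β) :
    ∃ b, t.leaves.getLast? = some b ∧ loc step t (const true) = (b, const true) := by
  induction t with
  | leaf b => exact ⟨b, rfl, rfl⟩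
  | node c l r hl hr =>
    obtain ⟨b, hb, hb'⟩ := hr
    refine ⟨b, ?_, by rw [loc_node_true _ _ (h c), hb']⟩
    rw [FreeTree.leaves, List.getLast?_append, hb]; rfl

theorem treeLoc_const_false (hx : 2 ≤ x.size) {β : Type} (t : (vinePresentation x).Tree β) :
    ∃ b, t.leaves.head? = some b ∧ treeLoc hx t (const false) = (b, const false) := by
  obtain ⟨t, rfl⟩ := Tree.exists_mk t
  exact loc_const_false (step_const_false hx) t

theorem treeLoc_const_true (hx : 2 ≤ x.size) {β : Type} (t : (vinePresentation x).Tree β) :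
    ∃ b, t.leaves.getLast? = some b ∧ treeLoc hx t (const true) = (b, const true) := by
  obtain ⟨t, rfl⟩ := Tree.exists_mk t
  exact loc_const_true (step_const_true hx) t

theorem isFirst_toPoint_of_eq (hx : 2 ≤ x.size) {t : Forest (vinePresentation x) .F 1 n} {j : Fin n}
    {z : Cantor} (h : forestLoc hx t z = (j, const false)) : (toPoint hx z).IsFirst t j := by
  intro m f
  obtain ⟨b, hb, hb'⟩ := treeLoc_const_false hx (f.tree j)
  rw [hb]
  change some b = some (forestLoc hx (t.comp f) z).1
  rw [forestLoc_comp, h, hb']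

theorem isLast_toPoint_of_eq (hx : 2 ≤ x.size) {t : Forest (vinePresentation x) .F 1 n} {j : Fin n}
    {z : Cantor} (h : forestLoc hx t z = (j, const true)) : (toPoint hx z).IsLast t j := by
  intro m f
  obtain ⟨b, hb, hb'⟩ := treeLoc_const_true hx (f.tree j)
  rw [hb]
  change some b = some (forestLoc hx (t.comp f) z).1
  rw [forestLoc_comp, h, hb']

/-- The smallest point of a cone is unique: its labels in all refinements of `t` are prescribed, so
`Moves.unique` for the trivial fraction `[t, t]` applies. -/
theorem isFirst_toPoint (hx : 2 ≤ x.size) {t : Forest (vinePresentation x) .F 1 n} {j : Fin n}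
    {z : Cantor} : (toPoint hx z).IsFirst t j ↔ forestLoc hx t z = (j, const false) := by
  refine ⟨fun h => ?_, isFirst_toPoint_of_eq hx⟩
  obtain ⟨z₀, hz₀⟩ := (forestLoc_bijective hx t).2 (j, const false)
  have h₀ : (toPoint hx z₀).IsFirst t j := isFirst_toPoint_of_eq hx hz₀
  have : toPoint hx z = toPoint hx z₀ := by
    refine CanonicalSpace.Moves.unique (vine_isOre hx .V) (p := t.toV) (q := t.toV)
      (x := toPoint hx z₀) (fun f => ?_) fun _ => rfl
    exact Option.some_inj.1
      ((CanonicalSpace.extreme_label List.head? (fun g L => List.head?_map) h f).symm.trans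
        (CanonicalSpace.extreme_label List.head? (fun g L => List.head?_map) h₀ f))
  rw [toPoint_injective hx this, hz₀]

theorem isLast_toPoint (hx : 2 ≤ x.size) {t : Forest (vinePresentation x) .F 1 n} {j : Fin n}
    {z : Cantor} : (toPoint hx z).IsLast t j ↔ forestLoc hx t z = (j, const true) := by
  refine ⟨fun h => ?_, isLast_toPoint_of_eq hx⟩
  obtain ⟨z₀, hz₀⟩ := (forestLoc_bijective hx t).2 (j, const true)
  have h₀ : (toPoint hx z₀).IsLast t j := isLast_toPoint_of_eq hx hz₀
  have : toPoint hx z = toPoint hx z₀ := by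
    refine CanonicalSpace.Moves.unique (vine_isOre hx .V) (p := t.toV) (q := t.toV)
      (x := toPoint hx z₀) (fun f => ?_) fun _ => rfl
    exact Option.some_inj.1
      ((CanonicalSpace.extreme_label List.getLast? (fun g L => List.getLast?_map) h f).symm.trans
        (CanonicalSpace.extreme_label List.getLast? (fun g L => List.getLast?_map) h₀ f))
  rw [toPoint_injective hx this, hz₀]

/-- `z` and `y` are the two points of a jump of the Cantor space. -/
def IsJump (z y : Cantor) : Prop :=
  ∃ w, z = app w (cons false (const true)) ∧ y = app w (cons true (const false))

/-- The identifications of the Cantor space that correspond to the identifications of the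
canonical space. -/
def CantorGlued (z y : Cantor) : ThompsonType → Prop
  | .F => IsJump z y
  | .T => IsJump z y ∨ (z = const true ∧ y = const false)
  | .V => False

/-- The word `w` is the address of the last common ancestor of the two leaves: the first is the last
leaf of its left branch, the second the first leaf of its right branch. -/
theorem exists_jump_of_leaves {β : Type} (T : FreeTree Unit β) {A B : List β} {a b : β}
    (h : T.leaves = A ++ a :: b :: B) :
    ∃ w, locA T (app w (cons false (const true))) = (a, const true) ∧
      locA T (app w (cons true (const false))) = (b, const false) := by
  induction T generalizing A B with
  | leaf b' =>
    have := congrArg List.length h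
    simp [FreeTree.leaves] at this
    omega
  | node c l r hl hr =>
    rw [FreeTree.leaves, List.append_eq_append_iff] at h
    have right : ∀ C, r.leaves = C ++ a :: b :: B → ∃ w,
        locA (node c l r) (app w (cons false (const true))) = (a, const true) ∧
          locA (node c l r) (app w (cons true (const false))) = (b, const false) := by
      intro C hC
      obtain ⟨w, h1, h2⟩ := hr hC
      exact ⟨true :: w, h1, h2⟩
    rcases h with ⟨C, -, hC⟩ | ⟨C, hC, hC'⟩
    · exact right C hC
    · match C, hC, hC' with
      | [], _, hC' => exact right [] hC'.symm
      | [a'], hC, hC' =>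
        simp only [List.cons_append, List.nil_append, List.cons.injEq] at hC'
        obtain ⟨rfl, hC'⟩ := hC'
        refine ⟨[], ?_, ?_⟩
        · obtain ⟨b', h1, h2⟩ := loc_const_true (step := fun (_ : Unit) z => (z 0, Cantor.tail z))
            (fun _ => rfl) l
          rw [hC, List.getLast?_concat] at h1
          exact h2.trans (by rw [Option.some_inj.1 h1])
        · obtain ⟨b', h1, h2⟩ := loc_const_false (step := fun (_ : Unit) z => (z 0, Cantor.tail z))
            (fun _ => rfl) r
          rw [← hC', List.head?_cons] at h1
          exact h2.trans (by rw [Option.some_inj.1 h1])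
      | a' :: b' :: C, hC, hC' =>
        simp only [List.cons_append, List.cons.injEq] at hC'
        obtain ⟨rfl, rfl, -⟩ := hC'
        obtain ⟨w, h1, h2⟩ := hl hC
        exact ⟨false :: w, h1, h2⟩

/-- In a refinement of `t`, the last leaf below `j` and the first leaf below `j'` are again
neighbours and carry the same extreme points. So `t` may be replaced by a full `a`-coloured tree,
where addresses are words. -/
theorem isJump_of_follows (hx : 2 ≤ x.size) {t : Forest (vinePresentation x) .F 1 n} {j j' : Fin n}
    {z y : Cantor} (hj : (j : ℕ) + 1 = j') (hz : forestLoc hx t z = (j, const true))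
    (hy : forestLoc hx t y = (j', const false)) : IsJump z y := by
  obtain ⟨D, h⟩ := exists_factor_full hx t
  obtain ⟨e, he⟩ := h D le_rfl
  obtain ⟨a, ha, ha'⟩ := treeLoc_const_true hx (e.tree j)
  obtain ⟨b, hb, hb'⟩ := treeLoc_const_false hx (e.tree j')
  have h1 : ThompsonType.ListFollows (t.comp e).leaves a b .F := by
    rw [Forest.leaves_comp]
    refine ThompsonType.ListFollows.flatMap ha hb ?_
    rw [show t.leaves = List.finRange n from t.admissible]
    exact (ThompsonType.listFollows_iff j j' .F).2 hj
  rw [he, Forest.leaves_one] at h1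
  obtain ⟨A, B, hAB⟩ := h1
  obtain ⟨w, hw, hw'⟩ := exists_jump_of_leaves (full D (fullLabel 1 D 0)) (A := A) (B := B)
    (by rw [← hAB]; exact (FreeTree.leaves_recolour _ _).symm)
  have hinj := (forestLoc_bijective hx ((fullForest .F 1 D).colour (vinePresentation x) .a)).1
  refine ⟨w, hinj ?_, hinj ?_⟩
  · rw [forestLoc_colour_full hx D (app _ _), hw, ← he, forestLoc_comp, hz, ha']
  · rw [forestLoc_colour_full hx D (app _ _), hw', ← he, forestLoc_comp, hy, hb']

theorem cantorGlued_of_glued (hx : 2 ≤ x.size) {z y : Cantor}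
    (h : (toPoint hx z).Glued X (toPoint hx y)) : CantorGlued z y X := by
  obtain ⟨n, t, j, j', hj, hz, hy⟩ := h
  rw [isLast_toPoint] at hz
  rw [isFirst_toPoint] at hy
  cases X with
  | F => exact isJump_of_follows hx hj hz hy
  | T =>
    change ((j : ℕ) + 1) % n = j' at hj
    by_cases h : (j : ℕ) + 1 < n
    · rw [Nat.mod_eq_of_lt h] at hj
      exact .inl (isJump_of_follows hx hj hz hy)
    -- Here the cyclic order wraps around, so that the two points are the maximum and the minimum of
    -- the whole space.
    · have hn : (j : ℕ) + 1 = n := by have := j.isLt; omega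
      rw [hn, Nat.mod_self] at hj
      have hl : (t.tree 0).leaves = List.finRange _ := by rw [← Forest.leaves_one]; exact t.admissible
      obtain ⟨a, ha, ha'⟩ := treeLoc_const_true hx (t.tree 0)
      obtain ⟨b, hb, hb'⟩ := treeLoc_const_false hx (t.tree 0)
      refine .inr ⟨(forestLoc_bijective hx t).1 (hz.trans (ha'.trans ?_).symm),
        (forestLoc_bijective hx t).1 (hy.trans (hb'.trans ?_).symm)⟩
      · rw [hl, List.getLast?_eq_getElem?, List.getElem?_eq_some_iff] at ha
        obtain ⟨h1, h2⟩ := ha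
        congr 1
        rw [← h2]
        ext; simp [← hn]
      · rw [hl, List.head?_eq_getElem?, List.getElem?_eq_some_iff] at hb
        obtain ⟨h1, h2⟩ := hb
        congr 1
        rw [← h2]
        ext; simp [← hj]
  | V => exact hj

/-- The number with given binary digits. -/
def binary : List Bool → ℕ
  | [] => 0
  | b :: w => (bif b then 2 ^ w.length else 0) + binary w

theorem locA_full_app {γ : Type} (w : List Bool) (φ : ℕ → γ) (y : Cantor) :
    locA (full w.length φ) (app w y) = (φ (binary w), y) := by
  induction w generalizing φ with
  | nil => rfl
  | cons b w ih =>
    cases b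
    · refine (ih φ).trans ?_
      simp [binary]
    · exact ih fun i => φ (2 ^ w.length + i)

theorem binary_lt (w : List Bool) : binary w < 2 ^ w.length := by
  induction w with
  | nil => simp [binary]
  | cons b w ih =>
    rw [List.length_cons, pow_succ]
    cases b <;> simp [binary] <;> omega

theorem binary_concat (w : List Bool) : binary (w ++ [false]) + 1 = binary (w ++ [true]) := by
  induction w with
  | nil => rfl
  | cons b w ih =>
    simp only [List.cons_append, binary, List.length_append, List.length_singleton] at ih ⊢
    omega

/-- The two halves of the cone of `w` are consecutive leaves of the full tree of depth `w.length +
1`, numbered by the binary values of their addresses. The second number is still smaller than the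
number of leaves, so nothing wraps around for the type `T`. -/
theorem glued_of_isJump (hx : 2 ≤ x.size) {z y : Cantor} (h : IsJump z y) :
    (toPoint hx z).Glued .F (toPoint hx y) ∧ (toPoint hx z).Glued .T (toPoint hx y) := by
  obtain ⟨w, rfl, rfl⟩ := h
  have hlen : (w ++ [true]).length = (w ++ [false]).length := by simp
  have hlab : ∀ v : List Bool,
      ((fullLabel 1 v.length 0 (binary v) : Fin _) : ℕ) = binary v := by
    intro v
    simp only [fullLabel, Fin.val_zero, zero_mul, zero_add, one_mul]
    exact Nat.mod_eq_of_lt (binary_lt v)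
  have hlab' : ((fullLabel 1 (w ++ [false]).length 0 (binary (w ++ [true])) : Fin _) : ℕ) =
      binary (w ++ [true]) := by
    simp only [fullLabel, Fin.val_zero, zero_mul, zero_add, one_mul]
    rw [← hlen]
    exact Nat.mod_eq_of_lt (binary_lt _)
  have h1 : forestLoc hx ((fullForest .F 1 (w ++ [false]).length).colour (vinePresentation x) .a)
      (app w (cons false (const true))) = (fullLabel 1 _ 0 (binary (w ++ [false])), const true) := by
    rw [forestLoc_colour_full, ← locA_full_app, app_append]; rfl
  have h2 : forestLoc hx ((fullForest .F 1 (w ++ [false]).length).colour (vinePresentation x) .a)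
      (app w (cons true (const false))) = (fullLabel 1 _ 0 (binary (w ++ [true])), const false) := by
    rw [forestLoc_colour_full, ← hlen, ← locA_full_app, app_append]; rfl
  have h3 : binary (w ++ [true]) < 1 * 2 ^ (w ++ [false]).length := by
    rw [one_mul, ← hlen]; exact binary_lt _
  refine ⟨⟨_, _, _, _, ?_, isLast_toPoint_of_eq hx h1, isFirst_toPoint_of_eq hx h2⟩,
    ⟨_, _, _, _, ?_, isLast_toPoint_of_eq hx h1, isFirst_toPoint_of_eq hx h2⟩⟩
  · change (_ : ℕ) + 1 = _
    rw [hlab, hlab', binary_concat]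
  · change ((_ : ℕ) + 1) % _ = _
    rw [hlab, hlab', binary_concat, Nat.mod_eq_of_lt h3]

theorem glued_of_cantorGlued (hx : 2 ≤ x.size) {z y : Cantor} (h : CantorGlued z y X) :
    (toPoint hx z).Glued X (toPoint hx y) := by
  cases X with
  | F => exact (glued_of_isJump hx h).1
  | T =>
    rcases h with h | ⟨rfl, rfl⟩
    · exact (glued_of_isJump hx h).2
    -- In the trivial tree the only leaf follows itself cyclically.
    · exact ⟨1, Forest.id _ _ _, 0, 0, rfl, isLast_toPoint_of_eq hx rfl,
        isFirst_toPoint_of_eq hx rfl⟩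
  | V => exact h.elim

end CanonicalModel

end ForestSkein


namespace ForestSkein

open SkeinPresentation FreeTree Cantor

/-! ### The spaces `E` -/

namespace Cantor

/-- The real number with given binary digits. -/
noncomputable def val (z : Cantor) : ℝ := Real.ofDigits fun i => if z i then (1 : Fin 2) else 0

theorem val_nonneg (z : Cantor) : 0 ≤ val z := Real.ofDigits_nonneg _

theorem val_le_one (z : Cantor) : val z ≤ 1 := Real.ofDigits_le_one _

theorem continuous_val : Continuous val :=
  Real.continuous_ofDigits.comp (continuous_pi fun i =>
    (continuous_of_discreteTopology (f := fun b : Bool => if b then (1 : Fin 2) else 0)).comp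
      (continuous_apply i))

theorem val_cons (b : Bool) (z : Cantor) :
    val (cons b z) = ((if b then 1 else 0) + val z) / 2 := by
  have h := Real.ofDigits_eq_sum_add_ofDigits
    (fun i => if (cons b z) i then (1 : Fin 2) else 0) 1
  have h2 : (fun i => if (cons b z) (i + 1) then (1 : Fin 2) else 0) =
      fun i => if z i then (1 : Fin 2) else 0 := rfl
  rw [h2] at h
  rw [val, h, val]
  cases b <;> simp [Real.ofDigitsTerm] <;> ring

theorem val_const (b : Bool) : val (const b) = if b then 1 else 0 := by
  have h := val_cons b (const b)
  rw [cons_const] at h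
  cases b <;> simp at h ⊢ <;> linarith

theorem eq_const_of_val {z : Cantor} (b : Bool) (h : val z = if b then 1 else 0) : z = const b := by
  funext i
  induction i generalizing z with
  | zero =>
    rw [← cons_tail z, val_cons] at h
    have h1 := val_nonneg (tail z)
    have h2 := val_le_one (tail z)
    cases b <;> cases h0 : z 0 <;> simp [h0, const] at h ⊢ <;> linarith
  | succ i ih =>
    refine ih (z := tail z) ?_
    rw [← cons_tail z, val_cons] at h
    have h1 := val_nonneg (tail z)
    have h2 := val_le_one (tail z)
    cases b <;> cases h0 : z 0 <;> simp [h0] at h ⊢ <;> linarith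

/-- At the first difference of two expansions of one number, the tail after the digit `0` has value
`1` and the tail after the digit `1` has value `0`, which determines both tails. -/
theorem isJump_of_val_eq {z y : Cantor} (h : val z = val y) : z = y ∨ IsJump z y ∨ IsJump y z := by
  by_cases hzy : z = y
  · exact .inl hzy
  refine .inr ?_
  obtain ⟨i, hi⟩ := Function.ne_iff.1 hzy
  clear hzy
  induction i generalizing z y with
  | zero =>
    have hz := val_nonneg (tail z)
    have hz' := val_le_one (tail z)
    have hy := val_nonneg (tail y)
    have hy' := val_le_one (tail y)
    rw [← cons_tail z, ← cons_tail y, val_cons, val_cons] at h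
    cases h0 : z 0 <;> cases h1 : y 0 <;> simp [h0, h1] at h hi
    · refine .inl ⟨[], ?_, ?_⟩
      · rw [← cons_tail z, h0, eq_const_of_val (z := tail z) true (by simp; linarith)]; rfl
      · rw [← cons_tail y, h1, eq_const_of_val (z := tail y) false (by simp; linarith)]; rfl
    · refine .inr ⟨[], ?_, ?_⟩
      · rw [← cons_tail y, h1, eq_const_of_val (z := tail y) true (by simp; linarith)]; rfl
      · rw [← cons_tail z, h0, eq_const_of_val (z := tail z) false (by simp; linarith)]; rfl
  | succ i ih =>
    by_cases h0 : z 0 = y 0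
    · have h' : val (tail z) = val (tail y) := by
        rw [← cons_tail z, ← cons_tail y, val_cons, val_cons, h0] at h
        linarith
      rcases ih h' hi with ⟨w, h1, h2⟩ | ⟨w, h1, h2⟩
      · exact .inl ⟨z 0 :: w, by rw [app_cons, ← h1, cons_tail], by rw [app_cons, ← h2, h0, cons_tail]⟩
      · exact .inr ⟨z 0 :: w, by rw [app_cons, ← h1, h0, cons_tail], by rw [app_cons, ← h2, cons_tail]⟩
    · clear ih hi
      have hz := val_nonneg (tail z)
      have hz' := val_le_one (tail z)
      have hy := val_nonneg (tail y)
      have hy' := val_le_one (tail y)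
      rw [← cons_tail z, ← cons_tail y, val_cons, val_cons] at h
      cases h1 : z 0 <;> cases h2 : y 0 <;> simp [h1, h2] at h h0
      · refine .inl ⟨[], ?_, ?_⟩
        · rw [← cons_tail z, h1, eq_const_of_val (z := tail z) true (by simp; linarith)]; rfl
        · rw [← cons_tail y, h2, eq_const_of_val (z := tail y) false (by simp; linarith)]; rfl
      · refine .inr ⟨[], ?_, ?_⟩
        · rw [← cons_tail y, h2, eq_const_of_val (z := tail y) true (by simp; linarith)]; rfl
        · rw [← cons_tail z, h1, eq_const_of_val (z := tail z) false (by simp; linarith)]; rfl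

theorem val_eq_of_isJump {z y : Cantor} (h : IsJump z y) : val z = val y := by
  obtain ⟨w, rfl, rfl⟩ := h
  induction w with
  | nil => simp [val_cons, val_const]
  | cons b w ih => rw [app_cons, app_cons, val_cons, val_cons, ih]

theorem continuous_cons (b : Bool) : Continuous (cons b) :=
  continuous_pi fun i => by
    cases i with
    | zero => exact continuous_const
    | succ i => exact continuous_apply i

theorem continuous_app (w : List Bool) : Continuous (app w) := by
  induction w with
  | nil => exact continuous_id
  | cons b w ih => exact (continuous_cons b).comp ih

theorem exists_app_mem {U : Set Cantor} (hU : IsOpen U) {z : Cantor} (hz : z ∈ U) :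
    ∃ N, ∀ w y, N ≤ w.length → z = app w y → ∀ y', app w y' ∈ U := by
  obtain ⟨I, u, hu, hu'⟩ := isOpen_pi_iff.1 hU z hz
  refine ⟨I.sup id + 1, fun w y hw hz' y' => hu' fun i hi => ?_⟩
  have hi' : i < w.length := by
    have := Finset.le_sup (f := id) hi
    simp only [id] at this
    omega
  have h : ∀ (w : List Bool) (i : ℕ), i < w.length → app w y' i = app w y i := by
    intro w i hi
    induction w generalizing i with
    | nil => simp at hi
    | cons c w ih =>
      cases i with
      | zero => rfl
      | succ i => exact ih i (by simpa using hi)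
  rw [h w i hi', ← hz']
  exact (hu i hi).2

/-- Eventually constant sequences. -/
def dyadic : Set Cantor := {z | ∃ w b, z = app w (const b)}

theorem countable_dyadic : dyadic.Countable := by
  have : dyadic = Set.range fun p : List Bool × Bool => app p.1 (const p.2) := by
    ext z
    exact ⟨fun ⟨w, b, h⟩ => ⟨(w, b), h.symm⟩, fun ⟨⟨w, b⟩, h⟩ => ⟨w, b, h.symm⟩⟩
  rw [this]
  exact Set.countable_range _

/-- A nonempty open set contains a cone, hence a copy of the whole Cantor space, and the diagonal
argument applies. -/
theorem not_countable_of_isOpen {U : Set Cantor} (hU : IsOpen U) {z : Cantor} (hz : z ∈ U) :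
    ¬ U.Countable := by
  intro h
  obtain ⟨N, hN⟩ := exists_app_mem hU hz
  obtain ⟨w, y, hw, hz'⟩ := exists_eq_app z N
  have h1 : Set.range (app w) ⊆ U := by
    rintro _ ⟨y', rfl⟩
    exact hN w y hw.ge hz' y'
  have h2 := (h.mono h1).preimage_of_injOn (f := app w) (app_injective w).injOn
  rw [Set.preimage_range, Set.countable_univ_iff] at h2
  obtain ⟨f, hf⟩ := exists_surjective_nat Cantor
  obtain ⟨n, hn⟩ := hf fun n => !(f n n)
  have := congrFun hn n
  simp at this

end Cantor

/-! ### The quotient map onto `E` and the action lifted to the Cantor space -/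

section Rigid

variable {x : FreeTree Unit Unit} {X : ThompsonType} {n : ℕ}

theorem dyadic_of_glued {z y : Cantor} (h : CantorGlued z y X) : z ∈ dyadic ∧ y ∈ dyadic := by
  have hj : IsJump z y → z ∈ dyadic ∧ y ∈ dyadic := by
    rintro ⟨w, rfl, rfl⟩
    exact ⟨⟨w ++ [false], true, by rw [app_append]; rfl⟩, ⟨w ++ [true], false, by rw [app_append]; rfl⟩⟩
  cases X with
  | F => exact hj h
  | T =>
    rcases h with h | ⟨rfl, rfl⟩
    · exact hj h
    · exact ⟨⟨[], _, rfl⟩, ⟨[], _, rfl⟩⟩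
  | V => exact h.elim

/-- The quotient map from the Cantor space to the space `E`. -/
noncomputable def rigidPoint (hx : 2 ≤ x.size) (X : ThompsonType) (z : Cantor) :
    RigidSpace (vinePresentation x) X := RigidSpace.mk (toPoint hx z)

theorem continuous_rigidPoint (hx : 2 ≤ x.size) : Continuous (rigidPoint hx X) :=
  continuous_quot_mk.comp (continuous_toPoint hx)

theorem rigidPoint_surjective (hx : 2 ≤ x.size) : Function.Surjective (rigidPoint hx X) := by
  intro p
  obtain ⟨p, rfl⟩ := Quot.exists_rep p
  obtain ⟨z, rfl⟩ := toPoint_surjective hx p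
  exact ⟨z, rfl⟩

/-- The quotient is taken by the equivalence relation generated by the glued pairs. A continuous map
to a Hausdorff space with exactly these identifications shows at once that the quotient is Hausdorff
and that the generated relation identifies nothing more. -/
theorem rigidSpace_of_realization (hx : 2 ≤ x.size) {Y : Type} [TopologicalSpace Y] [T2Space Y]
    (φ : Cantor → Y) (hφ : Continuous φ) (h1 : ∀ z y, CantorGlued z y X → φ z = φ y)
    (h2 : ∀ z y, φ z = φ y → z = y ∨ CantorGlued z y X ∨ CantorGlued y z X) :
    T2Space (RigidSpace (vinePresentation x) X) ∧ ∀ z y, rigidPoint hx X z = rigidPoint hx X y →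
      z = y ∨ CantorGlued z y X ∨ CantorGlued y z X := by
  let Φ : RigidSpace (vinePresentation x) X → Y :=
    Quot.lift (fun p => φ ((pointHomeo hx).symm p)) fun p q h => by
      obtain ⟨z, rfl⟩ := (pointHomeo hx).surjective p
      obtain ⟨y, rfl⟩ := (pointHomeo hx).surjective q
      simp only [Homeomorph.symm_apply_apply]
      exact h1 _ _ (cantorGlued_of_glued hx h)
  have hΦ : ∀ z, Φ (rigidPoint hx X z) = φ z := fun z =>
    congrArg φ ((pointHomeo hx).symm_apply_apply z)
  have hc : Continuous Φ := continuous_quot_lift _ (hφ.comp (pointHomeo hx).symm.continuous)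
  have hg : ∀ {z y}, CantorGlued z y X → rigidPoint hx X z = rigidPoint hx X y := fun h =>
    Quot.sound (glued_of_cantorGlued hx h)
  have hi : Function.Injective Φ := by
    intro p q h
    obtain ⟨z, rfl⟩ := rigidPoint_surjective hx p
    obtain ⟨y, rfl⟩ := rigidPoint_surjective hx q
    rw [hΦ, hΦ] at h
    rcases h2 _ _ h with rfl | h | h
    · rfl
    · exact hg h
    · exact (hg h).symm
  refine ⟨T2Space.of_injective_continuous hi hc, fun z y h => h2 _ _ ?_⟩
  rw [← hΦ, ← hΦ, h]

/-- Binary expansion realises `E^F` in the line and, modulo `1`, `E^T` in the circle. On the circle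
two values differ by `-1`, `0` or `1`; the differences `1` and `-1` force the two constant
sequences. -/
theorem rigidSpace_realization (hx : 2 ≤ x.size) (X : ThompsonType) :
    T2Space (RigidSpace (vinePresentation x) X) ∧ ∀ z y, rigidPoint hx X z = rigidPoint hx X y →
      z = y ∨ CantorGlued z y X ∨ CantorGlued y z X := by
  cases X with
  | F =>
    exact rigidSpace_of_realization hx val continuous_val
      (fun _ _ h => val_eq_of_isJump h) fun _ _ h => isJump_of_val_eq h
  | T =>
    refine rigidSpace_of_realization hx (fun z => (val z : AddCircle (1 : ℝ)))
      ((AddCircle.continuous_mk' 1).comp continuous_val) ?_ ?_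
    · rintro z y (h | ⟨rfl, rfl⟩)
      · rw [val_eq_of_isJump h]
      · simp [val_const]
    · intro z y h
      have h' : ((val z - val y : ℝ) : AddCircle (1 : ℝ)) = 0 := by
        rw [AddCircle.coe_sub, h, sub_self]
      obtain ⟨n, hn⟩ := (AddCircle.coe_eq_zero_iff 1).1 h'
      simp only [zsmul_eq_mul, mul_one] at hn
      have hz := val_nonneg z
      have hz' := val_le_one z
      have hy := val_nonneg y
      have hy' := val_le_one y
      have h1 : (n : ℝ) ≤ 1 := by linarith
      have h2 : (-1 : ℝ) ≤ n := by linarith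
      have h1' : n ≤ 1 := by exact_mod_cast h1
      have h2' : -1 ≤ n := by exact_mod_cast h2
      have hn' : n = -1 ∨ n = 0 ∨ n = 1 := by omega
      rcases hn' with rfl | rfl | rfl
      · push_cast at hn
        exact .inr (.inr (.inr ⟨eq_const_of_val true (by simp; linarith),
          eq_const_of_val false (by simp; linarith)⟩))
      · push_cast at hn
        rcases isJump_of_val_eq (show val z = val y by linarith) with h | h | h
        exacts [.inl h, .inr (.inl (.inl h)), .inr (.inr (.inl h))]
      · push_cast at hn
        exact .inr (.inl (.inr ⟨eq_const_of_val true (by simp; linarith),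
          eq_const_of_val false (by simp; linarith)⟩))
  | V =>
    exact rigidSpace_of_realization hx id continuous_id (fun _ _ h => h.elim)
      fun _ _ h => .inl h

theorem eq_of_rigidPoint_eq (hx : 2 ≤ x.size) {z y : Cantor}
    (h : rigidPoint hx X z = rigidPoint hx X y) : z = y ∨ CantorGlued z y X ∨ CantorGlued y z X :=
  (rigidSpace_realization hx X).2 z y h

/-- Homeomorphisms of the Cantor space are determined on open sets by their effect on `E`. -/
theorem eqOn_of_rigidPoint_eq (hx : 2 ≤ x.size) {g b : Cantor ≃ₜ Cantor} {U : Set Cantor}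
    (hU : IsOpen U) (h : ∀ z ∈ U, rigidPoint hx X (g z) = rigidPoint hx X (b z)) :
    Set.EqOn g b U := by
  intro z hz
  by_contra hne
  -- The points of disagreement form an open set, but `g` sends each of them to an eventually
  -- constant sequence, and there are only countably many of these.
  have ho : IsOpen (U ∩ {z | g z ≠ b z}) := hU.inter (isOpen_ne_fun g.continuous b.continuous)
  refine not_countable_of_isOpen ho ⟨hz, hne⟩ ?_
  refine (countable_dyadic.preimage_of_injOn (f := g) g.injective.injOn).mono ?_
  rintro y ⟨hy, hy'⟩
  rcases eq_of_rigidPoint_eq hx (h y hy) with h | h | h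
  · exact (hy' h).elim
  · exact (dyadic_of_glued h).1
  · exact (dyadic_of_glued h).2

variable (hx : 2 ≤ x.size) (hX : IsOre (ForestCategory (vinePresentation x) X))
  (hV : IsOre (ForestCategory (vinePresentation x) .V))

/-- The canonical action on the Cantor space. -/
noncomputable def cantorAction (g : FSGroup hX) : Cantor ≃ₜ Cantor :=
  ((pointHomeo hx).trans (restrictedAction hX hV g)).trans (pointHomeo hx).symm

theorem toPoint_cantorAction (g : FSGroup hX) (z : Cantor) :
    toPoint hx (cantorAction hx hX hV g z) = restrictedAction hX hV g (toPoint hx z) :=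
  (pointHomeo hx).apply_symm_apply _

theorem rigidPoint_cantorAction (g : FSGroup hX) (z : Cantor) :
    rigidPoint hx X (cantorAction hx hX hV g z) = rigidAction hX hV g (rigidPoint hx X z) :=
  congrArg RigidSpace.mk (toPoint_cantorAction hx hX hV g z)

/-- The element of the group given by two trees with the same number of leaves. -/
noncomputable def forestFrac {S : Type} {P : SkeinPresentation S} (hX : IsOre (ForestCategory P X))
    (p q : Forest P X 1 n) : FSGroup hX :=
  FractionGroup.frac hX (d := ForestCategory.of 1) (x := ⟨n⟩) p q

theorem exists_forestFrac {S : Type} {P : SkeinPresentation S} {hX : IsOre (ForestCategory P X)}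
    (g : FSGroup hX) : ∃ (n : ℕ) (p q : Forest P X 1 n), g = forestFrac hX p q := by
  obtain ⟨n, p, q, h⟩ := FractionGroup.exists_frac g
  exact ⟨n.card, p, q, h⟩

theorem forestFrac_comp {S : Type} {P : SkeinPresentation S} {hX : IsOre (ForestCategory P X)}
    {m : ℕ} (p q : Forest P X 1 n) (f : Forest P X n m) :
    forestFrac hX (p.comp f) (q.comp f) = forestFrac hX p q :=
  FractionGroup.frac_comp (d := ForestCategory.of 1) (x := ⟨n⟩) (y := ⟨m⟩) p q f

theorem forestLoc_cantorAction (p q : Forest (vinePresentation x) X 1 n) (z : Cantor) :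
    forestLoc hx p (cantorAction hx hX hV (forestFrac hX p q) z) = forestLoc hx q z := by
  obtain ⟨z', hz'⟩ := (forestLoc_bijective hx p).2 (forestLoc hx q z)
  have h1 : CanonicalSpace.move hV p.toV q.toV (toPoint hx z) = toPoint hx z' :=
    move_toPoint hx hV hz'
  have h2 : toPoint hx (cantorAction hx hX hV (forestFrac hX p q) z) = toPoint hx z' :=
    (toPoint_cantorAction hx hX hV _ z).trans h1
  rw [toPoint_injective hx h2, hz']

theorem cantorAction_eq_iff (p q : Forest (vinePresentation x) X 1 n) (z y : Cantor) :
    cantorAction hx hX hV (forestFrac hX p q) z = y ↔ forestLoc hx p y = forestLoc hx q z := by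
  constructor
  · rintro rfl
    exact forestLoc_cantorAction hx hX hV p q z
  · intro h
    exact (forestLoc_bijective hx p).1 ((forestLoc_cantorAction hx hX hV p q z).trans h.symm)

/-- Passing to `E` loses no information, so identities between elements can be checked on the Cantor
space. -/
theorem rigidAction_eq_iff (g b : FSGroup hX) :
    rigidAction hX hV g = rigidAction hX hV b ↔
      ∀ z, cantorAction hx hX hV g z = cantorAction hx hX hV b z := by
  constructor
  · intro h z
    refine eqOn_of_rigidPoint_eq (X := X) hx isOpen_univ (fun z _ => ?_) (Set.mem_univ z)
    rw [rigidPoint_cantorAction, rigidPoint_cantorAction, h]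
  · intro h
    ext p
    obtain ⟨z, rfl⟩ := rigidPoint_surjective hx p
    rw [← rigidPoint_cantorAction, ← rigidPoint_cantorAction, h]

theorem restrictedAction_eq_one (hx : 2 ≤ x.size)
    (hX : IsOre (ForestCategory (vinePresentation x) X))
    (hV : IsOre (ForestCategory (vinePresentation x) .V)) {g : FSGroup hX} (h : rigidAction hX hV g = 1) :
    restrictedAction hX hV g = 1 := by
  ext1 p
  obtain ⟨z, rfl⟩ := toPoint_surjective hx p
  have h1 : rigidAction hX hV g = rigidAction hX hV 1 := by rw [h, map_one]
  rw [← toPoint_cantorAction, (rigidAction_eq_iff hx hX hV g 1).1 h1, toPoint_cantorAction, map_one]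

theorem faithfulAction_injective (hx : 2 ≤ x.size)
    (hX : IsOre (ForestCategory (vinePresentation x) X))
    (hV : IsOre (ForestCategory (vinePresentation x) .V)) : Function.Injective (faithfulAction hX hV) := by
  rw [injective_iff_map_eq_one]
  intro g hg
  obtain ⟨g, rfl⟩ := QuotientGroup.mk_surjective g
  exact (QuotientGroup.eq_one_iff g).2 (restrictedAction_eq_one hx hX hV hg)

end Rigid

theorem gammaGroup_eq {S : Type} {P : SkeinPresentation S} (h : ∀ X, IsOre (ForestCategory P X))
    (X : ThompsonType) : gammaGroup h X = (rigidAction (h X) (h .V)).range := by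
  ext f
  constructor
  · rintro ⟨g, rfl⟩
    obtain ⟨g, rfl⟩ := QuotientGroup.mk_surjective g
    exact ⟨g, rfl⟩
  · rintro ⟨g, rfl⟩
    exact ⟨(g : FaithfulQuotient (h X) (h .V)), rfl⟩

theorem mem_thompsonGroup {S : Type} {P : SkeinPresentation S} {X : ThompsonType}
    (h₀ : ∀ X, IsOre (ForestCategory thompson X)) (h : ∀ X, IsOre (ForestCategory P X)) (a : S)
    (f : RigidSpace P X ≃ₜ RigidSpace P X) : f ∈ thompsonGroup h₀ h a X ↔
      ∃ (n : ℕ) (p q : Forest thompson X 1 n),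
        f = rigidAction (h X) (h .V) (forestFrac (h X) (p.colour P a) (q.colour P a)) := by
  constructor
  · rintro ⟨g, rfl⟩
    obtain ⟨n, p, q, rfl⟩ := exists_forestFrac g
    exact ⟨n, p, q, rfl⟩
  · rintro ⟨n, p, q, rfl⟩
    exact ⟨forestFrac (h₀ X) p q, rfl⟩

end ForestSkein


namespace ForestSkein

open SkeinPresentation FreeTree Cantor

/-! ### Germs -/

section SingularSet

variable {Z : Type} [TopologicalSpace Z] {B : Subgroup (Z ≃ₜ Z)} {f f' : Z ≃ₜ Z}

theorem mem_singularSet_of_eqOn {z : Z} (h : ∃ U ∈ 𝓝 z, Set.EqOn f f' U)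
    (hz : z ∈ singularSet B f) : z ∈ singularSet B f' := by
  rintro ⟨b, hb, V, hV, hbV⟩
  obtain ⟨U, hU, hUf⟩ := h
  exact hz ⟨b, hb, U ∩ V, Filter.inter_mem hU hV, fun y hy => (hUf hy.1).trans (hbV hy.2)⟩

theorem singularSet_eq_empty (hf : f ∈ B) : singularSet B f = ∅ :=
  Set.eq_empty_of_forall_notMem fun _ hz => hz ⟨f, hf, _, Filter.univ_mem, fun _ _ => rfl⟩

end SingularSet

section Uncolour

variable {S β γ : Type} {x : FreeTree Unit Unit}

/-- The underlying monochromatic tree. -/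
def uncolour (t : FreeTree S β) : FreeTree Unit β := t.recolour fun _ => ()

theorem uncolour_aTree (t : FreeTree Unit β) : uncolour (aTree t) = t := by
  rw [uncolour, aTree, recolour_recolour, recolour_unit]

/-- A point outside the cone `1^N` leaves the spine at one of its first `N` vertices, all coloured
`a`, and enters a branch that is `a`-coloured already. -/
theorem Spine.loc_eq {D N : ℕ} {v t : FreeTree Colour γ} {w : List Colour}
    (h : Spine D v (List.replicate N .a ++ w) t) {z : Cantor}
    (hz : ∀ y, z ≠ app (List.replicate N true) y) :
    loc (step x) (aTree (uncolour t)) z = loc (step x) t z := by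
  induction N generalizing t z with
  | zero => exact (hz z rfl).elim
  | succ N ih =>
    rw [List.replicate_succ, List.cons_append] at h
    cases h with
    | @cons _ _ s t hs h =>
      rw [← cons_tail z] at hz ⊢
      have h1 : aTree (uncolour (node Colour.a (aTree s) t)) =
          node .a (aTree s) (aTree (uncolour t)) := by
        change node Colour.a (aTree (uncolour (aTree s))) _ = _
        rw [uncolour_aTree]; rfl
      rw [h1]
      cases h0 : z 0
      · rfl
      · refine ih h fun y hy => hz y ?_
        rw [h0, List.replicate_succ, app_cons, ← hy]; rfl

theorem IsSpine.loc_eq {N : ℕ} {t : FreeTree Colour γ} (h : IsSpine N t) {z : Cantor}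
    (hz : ∀ y, z ≠ app (List.replicate N true) y) :
    loc (step x) (aTree (uncolour t)) z = loc (step x) t z := by
  obtain ⟨w, c, h⟩ := h
  exact h.loc_eq hz

end Uncolour

/-! ### Resolutions of elements; finiteness and isolation of singular points -/

section Resolution

variable {x : FreeTree Unit Unit} {X : ThompsonType} {k m n : ℕ}

/-- The underlying monochromatic forest of a forest whose trees are represented by `t`. -/
def Forest.uncolour {S : Type} {P : SkeinPresentation S} (f : Forest P X n m)
    (t : Fin n → FreeTree S (Fin m)) (ht : ∀ i, f.tree i = Tree.mk P (t i)) :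
    Forest thompson X n m where
  tree i := Tree.mk _ (ForestSkein.uncolour (t i))
  admissible := by
    have h := f.admissible
    simp only [ht] at h
    simp only [Tree.leaves_mk, ForestSkein.uncolour, leaves_recolour]
    exact h

open Classical in
/-- Recolouring all the trees of a forest but one by `a`. -/
noncomputable def Forest.isolate {S : Type} {P : SkeinPresentation S} (a : S) (f : Forest P X n m)
    (t : Fin n → FreeTree S (Fin m)) (ht : ∀ i, f.tree i = Tree.mk P (t i)) (i₀ : Fin n) :
    Forest P X n m where
  tree i := if i = i₀ then f.tree i else ((f.uncolour t ht).colour P a).tree i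
  admissible := by
    have h : ∀ i, (if i = i₀ then f.tree i else ((f.uncolour t ht).colour P a).tree i).leaves =
        (f.tree i).leaves := by
      intro i
      split_ifs
      · rfl
      · change ((ForestSkein.uncolour (t i)).recolour _).leaves = _
        rw [leaves_recolour, ForestSkein.uncolour, leaves_recolour, ht]; rfl
    simp only [h]
    exact f.admissible

theorem exists_rep_colour (hx : 2 ≤ x.size) (q : Forest thompson X 1 n) :
    ∃ q₀ : FreeTree Unit (Fin n), q.tree 0 = Tree.mk _ q₀ ∧ q₀.leaves.Nodup ∧
      (∀ i, i ∈ q₀.leaves) ∧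
      ∀ z, forestLoc hx (q.colour (vinePresentation x) .a) z = locA q₀ z := by
  obtain ⟨q₀, hq₀⟩ := Tree.exists_mk (q.tree 0)
  have h1 : q₀.leaves = q.leaves := by rw [Forest.leaves_one, ← hq₀]; rfl
  refine ⟨q₀, hq₀.symm, h1 ▸ q.nodup_leaves, fun i => h1 ▸ q.mem_leaves i, fun z => ?_⟩
  change treeLoc hx ((q.tree 0).colour _ _) z = _
  rw [← hq₀]
  exact loc_aTree q₀ z

theorem exists_word_colour (hx : 2 ≤ x.size) (q : Forest thompson X 1 n) :
    ∃ w : Fin n → List Bool, ∀ i y,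
      forestLoc hx (q.colour (vinePresentation x) .a) (app (w i) y) = (i, y) := by
  obtain ⟨q₀, -, -, hq, hq'⟩ := exists_rep_colour hx q
  choose w hw using fun i => exists_word_of_mem q₀ (hq i)
  exact ⟨w, fun i y => (hq' _).trans (hw i y)⟩

variable (hx : 2 ≤ x.size) (hX : IsOre (ForestCategory (vinePresentation x) X))
  (hV : IsOre (ForestCategory (vinePresentation x) .V))

/-- The elements of the group are quotients of trees, such that the denominators are coloured by
`a` near the root, and everywhere but far to the right of fixed cones. -/
theorem exists_resolution (hx : 2 ≤ x.size)
    (hX : IsOre (ForestCategory (vinePresentation x) X)) (g : FSGroup hX) : ∃ (n : ℕ) (q : Forest thompson X 1 n), ∀ N,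
    ∃ (m : ℕ) (T : Forest thompson X 1 m) (f : Forest (vinePresentation x) X n m)
      (t : Fin n → FreeTree Colour (Fin m)) (_ : ∀ i, f.tree i = Tree.mk _ (t i)),
      g = forestFrac hX (T.colour _ .a) ((q.colour _ .a).comp f) ∧ ∀ i, IsSpine N (t i) := by
  obtain ⟨n, p, q, rfl⟩ := exists_forestFrac g
  obtain ⟨D, h⟩ := exists_factor_full hx q
  obtain ⟨e, he⟩ := h D le_rfl
  -- The denominator is made full and `a`-coloured before `N` is given; only the numerator is
  -- completed afterwards, with quotients adapted to `N`. Hence the cones of the leaves of `q` stay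
  -- fixed as `N` grows.
  refine ⟨_, fullForest X 1 D, fun N => ?_⟩
  obtain ⟨D', h'⟩ := (p.comp e).exists_comp_eq_full (vine_dividesDeep hx N)
  obtain ⟨f, hf, hf'⟩ := h' D' le_rfl
  choose t ht ht' using hf'
  exact ⟨_, fullForest X 1 D', f, t, ht, by rw [← hf, ← he, forestFrac_comp, forestFrac_comp], ht'⟩

theorem cantorAction_eq_of_treeLoc_eq {T : Forest (vinePresentation x) X 1 m}
    {q : Forest (vinePresentation x) X 1 n} {f f' : Forest (vinePresentation x) X n m} {z : Cantor}
    {i : Fin n} {y : Cantor} (hz : forestLoc hx q z = (i, y))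
    (h : treeLoc hx (f.tree i) y = treeLoc hx (f'.tree i) y) :
    cantorAction hx hX hV (forestFrac hX T (q.comp f)) z =
      cantorAction hx hX hV (forestFrac hX T (q.comp f')) z := by
  rw [cantorAction_eq_iff, forestLoc_cantorAction, forestLoc_comp, forestLoc_comp, hz, h]

/-- The image of `K` is compact in a Hausdorff space, hence closed, so its complement is the
required neighbourhood. Agreement off `K` is needed upstairs only. -/
theorem exists_eqOn_of_eq_compl (g b : FSGroup hX) {K : Set Cantor} (hK : IsCompact K)
    (h : ∀ z ∉ K, cantorAction hx hX hV g z = cantorAction hx hX hV b z)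
    {e : RigidSpace (vinePresentation x) X} (he : e ∉ rigidPoint hx X '' K) :
    ∃ U ∈ 𝓝 e, Set.EqOn (rigidAction hX hV g) (rigidAction hX hV b) U := by
  have := (rigidSpace_realization hx X).1
  have hc : IsClosed (rigidPoint hx X '' K) := (hK.image (continuous_rigidPoint hx)).isClosed
  refine ⟨_, hc.isOpen_compl.mem_nhds he, fun e' he' => ?_⟩
  obtain ⟨z, rfl⟩ := rigidPoint_surjective hx e'
  rw [← rigidPoint_cantorAction hx, ← rigidPoint_cantorAction hx, h z fun hz => he' ⟨z, hz, rfl⟩]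

theorem exists_cone_mem {O : Set (RigidSpace (vinePresentation x) X)} (hO : IsOpen O)
    {w : List Bool} (h : rigidPoint hx X (app w (const true)) ∈ O) :
    ∃ N₀, ∀ N ≥ N₀, ∀ y, rigidPoint hx X (app w (app (List.replicate N true) y)) ∈ O := by
  obtain ⟨N₀, hN⟩ := exists_app_mem (hO.preimage (continuous_rigidPoint hx)) h
  refine ⟨N₀, fun N hN' y => ?_⟩
  have := hN (w ++ List.replicate N true) (const true) (by simp; omega)
    (by rw [app_append, app_replicate_const]) y
  rwa [app_append] at this

/-- The points with an address in the cone of `i ∈ A` that starts with `N` ones. -/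
def cones (w : Fin n → List Bool) (N : ℕ) (A : Set (Fin n)) : Set Cantor :=
  ⋃ i ∈ A, Set.range fun y => app (w i) (app (List.replicate N true) y)

theorem isCompact_cones (w : Fin n → List Bool) (N : ℕ) (A : Set (Fin n)) :
    IsCompact (cones w N A) :=
  A.toFinite.isCompact_biUnion fun _ _ =>
    isCompact_range ((continuous_app _).comp (continuous_app _))

theorem mem_cones {w : Fin n → List Bool} {N : ℕ} {A : Set (Fin n)} {i : Fin n} (hi : i ∈ A)
    (y : Cantor) : app (w i) (app (List.replicate N true) y) ∈ cones w N A :=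
  Set.mem_biUnion hi ⟨y, rfl⟩

theorem exists_forestLoc {q : Forest (vinePresentation x) X 1 n} {w : Fin n → List Bool}
    (hw : ∀ i y, forestLoc hx q (app (w i) y) = (i, y)) (z : Cantor) :
    ∃ i y, z = app (w i) y ∧ forestLoc hx q z = (i, y) := by
  rcases h : forestLoc hx q z with ⟨i, y⟩
  exact ⟨i, y, (forestLoc_bijective hx q).1 (h.trans (hw i y).symm), rfl⟩

theorem treeLoc_uncolour {f : Forest (vinePresentation x) X n m}
    {t : Fin n → FreeTree Colour (Fin m)} (ht : ∀ i, f.tree i = Tree.mk _ (t i)) {N : ℕ} {i : Fin n}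
    (hs : IsSpine N (t i)) {y : Cantor} (hy : ∀ y', y ≠ app (List.replicate N true) y') :
    treeLoc hx (((f.uncolour t ht).colour _ .a).tree i) y = treeLoc hx (f.tree i) y := by
  rw [ht]
  exact hs.loc_eq hy

/-- Recolouring `f` by `a` gives an element of the Thompson group that agrees with `g` off the cones
`w i 1^N`. As `N` grows, these cones shrink to the points `w i 1^∞`, so any other point eventually
has a neighbourhood of agreement. -/
theorem singularSet_subset (h₀ : ∀ X, IsOre (ForestCategory thompson X))
    (h : ∀ X, IsOre (ForestCategory (vinePresentation x) X)) {g : FSGroup (h X)}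
    {q : Forest thompson X 1 n} {w : Fin n → List Bool}
    (hw : ∀ i y, forestLoc hx (q.colour (vinePresentation x) .a) (app (w i) y) = (i, y))
    (hg : ∀ N, ∃ (m : ℕ) (T : Forest thompson X 1 m) (f : Forest (vinePresentation x) X n m)
      (t : Fin n → FreeTree Colour (Fin m)) (_ : ∀ i, f.tree i = Tree.mk _ (t i)),
      g = forestFrac (h X) (T.colour _ .a) ((q.colour _ .a).comp f) ∧ ∀ i, IsSpine N (t i)) :
    singularSet (thompsonGroup h₀ h Colour.a X) (rigidAction (h X) (h .V) g) ⊆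
      Set.range fun i => rigidPoint hx X (app (w i) (const true)) := by
  intro e he
  by_contra hne
  have := (rigidSpace_realization hx X).1
  choose N₀ hN₀ using fun i => exists_cone_mem (X := X) hx
    (isOpen_compl_singleton (x := e)) (w := w i) fun h => hne ⟨i, h⟩
  obtain ⟨m, T, f, t, ht, rfl, hs⟩ := hg (Finset.univ.sup N₀)
  obtain ⟨U, hU, hUe⟩ := exists_eqOn_of_eq_compl hx (h X) (h .V)
    (forestFrac (h X) (T.colour _ .a) ((q.colour _ .a).comp f))
    (forestFrac (h X) (T.colour _ .a) ((q.colour _ .a).comp ((f.uncolour t ht).colour _ .a)))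
    (isCompact_cones w (Finset.univ.sup N₀) Set.univ) (e := e) (by
      intro z hz
      obtain ⟨i, y, rfl, hi⟩ := exists_forestLoc hx hw z
      refine cantorAction_eq_of_treeLoc_eq hx _ _ hi (treeLoc_uncolour hx ht (hs i) ?_).symm
      rintro y' rfl
      exact hz (mem_cones (Set.mem_univ i) y')) (by
      rintro ⟨z, hz, hze⟩
      simp only [cones, Set.mem_iUnion] at hz
      obtain ⟨i, -, y, rfl⟩ := hz
      exact hN₀ i _ (Finset.le_sup (f := N₀) (Finset.mem_univ i)) y hze)
  refine he ⟨_, (mem_thompsonGroup h₀ h _ _).2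
    ⟨m, T, q.comp (f.uncolour t ht), rfl⟩, U, hU, ?_⟩
  rw [Forest.colour_comp]
  exact hUe

theorem app_const_ne (w w' : List Bool) : app w (const true) ≠ app w' (const false) := by
  intro h
  have h1 := app_length_add w (const true) w'.length
  have h2 := app_length_add w' (const false) w.length
  rw [h, add_comm, h2] at h1
  exact Bool.noConfusion h1

/-- A sequence ending in ones is never the upper point of a glued pair. So two distinct candidates
for singular points, both of this kind, stay distinct in `E`. -/
theorem not_cantorGlued_const_true (z : Cantor) (w : List Bool) :
    ¬ CantorGlued z (app w (const true)) X := by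
  have hj : ¬ IsJump z (app w (const true)) := by
    rintro ⟨w', -, h⟩
    exact app_const_ne w (w' ++ [true]) (by rw [h, app_append]; rfl)
  intro h
  cases X with
  | F => exact hj h
  | T =>
    rcases h with h | ⟨-, h⟩
    · exact hj h
    · exact app_const_ne w [] h
  | V => exact h

theorem rigidPoint_const_true_injective {q : Forest (vinePresentation x) X 1 n}
    {w : Fin n → List Bool} (hw : ∀ i y, forestLoc hx q (app (w i) y) = (i, y)) {i j : Fin n}
    (h : rigidPoint hx X (app (w i) (const true)) = rigidPoint hx X (app (w j) (const true))) :
    i = j := by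
  rcases eq_of_rigidPoint_eq hx h with h | h | h
  · have := (hw i _).symm.trans ((congrArg _ h).trans (hw j _))
    exact (Prod.mk.inj this).1
  · exact (not_cantorGlued_const_true _ _ h).elim
  · exact (not_cantorGlued_const_true _ _ h).elim

/-- For `N` large, the image in `E` of the cone of the leaf `i` is disjoint from those of the other
leaves. Recolouring by `a` all trees of `f` except the `i`-th does not change the germ at the given
point. Off the cone of `i` the new element is locally in the Thompson group; inside, it agrees
locally with `g`, whose only possible singular point there is the given one. -/
theorem exists_isolated_germ (hx : 2 ≤ x.size) (h₀ : ∀ X, IsOre (ForestCategory thompson X))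
    (h : ∀ X, IsOre (ForestCategory (vinePresentation x) X)) (g : FSGroup (h X))
    {e : RigidSpace (vinePresentation x) X}
    (he : e ∈ singularSet (thompsonGroup h₀ h Colour.a X) (rigidAction (h X) (h .V) g)) :
    ∃ g' : FSGroup (h X),
      (∃ U ∈ 𝓝 e, Set.EqOn (rigidAction (h X) (h .V) g') (rigidAction (h X) (h .V) g) U) ∧
      singularSet (thompsonGroup h₀ h Colour.a X) (rigidAction (h X) (h .V) g') = {e} := by
  have := (rigidSpace_realization hx X).1
  obtain ⟨n, q, hg⟩ := exists_resolution hx (h X) g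
  obtain ⟨w, hw⟩ := exists_word_colour hx q
  have hsub := singularSet_subset hx h₀ h hw hg
  obtain ⟨i, rfl⟩ := hsub he
  dsimp only at he ⊢
  -- disjoint neighbourhoods of the point and of the other candidates
  have hsep : ∀ j, j ≠ i → ∃ N₀, ∀ N ≥ N₀, ∀ y y',
      rigidPoint hx X (app (w i) (app (List.replicate N true) y)) ≠
        rigidPoint hx X (app (w j) (app (List.replicate N true) y')) := by
    intro j hj
    obtain ⟨O, O', hO, hO', h1, h2, hd⟩ := t2_separation
      fun h => hj (rigidPoint_const_true_injective hx hw h).symm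
    obtain ⟨N₁, hN₁⟩ := exists_cone_mem hx hO h1
    obtain ⟨N₂, hN₂⟩ := exists_cone_mem hx hO' h2
    exact ⟨max N₁ N₂, fun N hN y y' => hd.ne_of_mem (hN₁ N (le_of_max_le_left hN) y)
      (hN₂ N (le_of_max_le_right hN) y')⟩
  choose! N₀ hN₀ using hsep
  obtain ⟨m, T, f, t, ht, rfl, hs⟩ := hg (Finset.univ.sup N₀)
  have hN : ∀ j, N₀ j ≤ Finset.univ.sup N₀ := fun j => Finset.le_sup (Finset.mem_univ j)
  generalize Finset.univ.sup N₀ = N at hs hN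
  -- away from the other cones, nothing is changed
  have h1 : ∀ e' ∉ rigidPoint hx X '' cones w N {j | j ≠ i}, ∃ U ∈ 𝓝 e',
      Set.EqOn
        (rigidAction (h X) (h .V) (forestFrac (h X) (T.colour _ .a)
          ((q.colour _ .a).comp (f.isolate .a t ht i))))
        (rigidAction (h X) (h .V) (forestFrac (h X) (T.colour _ .a) ((q.colour _ .a).comp f))) U := by
    intro e' he'
    refine exists_eqOn_of_eq_compl hx (h X) (h .V) _ _ (isCompact_cones w N _) (fun z hz => ?_) he'
    obtain ⟨j, y, rfl, hj⟩ := exists_forestLoc hx hw z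
    refine cantorAction_eq_of_treeLoc_eq hx _ _ hj ?_
    simp only [Forest.isolate]
    split_ifs with hji
    · rfl
    · refine treeLoc_uncolour hx ht (hs j) ?_
      rintro y' rfl
      exact hz (mem_cones (A := {j | j ≠ i}) hji y')
  -- away from the cone of the point, everything is coloured by `a`
  have h2 : ∀ e' ∉ rigidPoint hx X '' cones w N {i}, e' ∉ singularSet
      (thompsonGroup h₀ h Colour.a X) (rigidAction (h X) (h .V) (forestFrac (h X) (T.colour _ .a)
          ((q.colour _ .a).comp (f.isolate .a t ht i)))) := by
    intro e' he' hsing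
    obtain ⟨U, hU, hUe⟩ := exists_eqOn_of_eq_compl hx (h X) (h .V)
      (forestFrac (h X) (T.colour _ .a) ((q.colour _ .a).comp (f.isolate .a t ht i)))
      (forestFrac (h X) (T.colour _ .a) ((q.colour _ .a).comp ((f.uncolour t ht).colour _ .a)))
      (isCompact_cones w N {i}) (e := e') (fun z hz => by
        obtain ⟨j, y, rfl, hj⟩ := exists_forestLoc hx hw z
        refine cantorAction_eq_of_treeLoc_eq hx _ _ hj ?_
        simp only [Forest.isolate]
        split_ifs with hji
        · refine (treeLoc_uncolour hx ht (hs j) ?_).symm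
          rintro y' rfl
          exact hz (mem_cones (A := {i}) hji y')
        · rfl) he'
    refine hsing ⟨_, (mem_thompsonGroup h₀ h _ _).2 ⟨m, T, q.comp (f.uncolour t ht), rfl⟩, U, hU, ?_⟩
    rw [Forest.colour_comp]
    exact hUe
  have hdisj : ∀ e' ∈ rigidPoint hx X '' cones w N {i},
      e' ∉ rigidPoint hx X '' cones w N {j | j ≠ i} := by
    rintro _ ⟨z, hz, rfl⟩ ⟨z', hz', hzz'⟩
    simp only [cones, Set.mem_iUnion] at hz hz'
    obtain ⟨_, rfl, y, rfl⟩ := hz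
    obtain ⟨j, hj, y', rfl⟩ := hz'
    exact hN₀ j hj N (hN j) y y' hzz'.symm
  have hmem : ∀ A j, j ∈ A →
      rigidPoint hx X (app (w j) (const true)) ∈ rigidPoint hx X '' cones w N A := by
    intro A j hj
    exact ⟨_, by simpa only [app_replicate_const] using mem_cones (w := w) (N := N) hj (const true), rfl⟩
  have hgerm := h1 _ (hdisj _ (hmem {i} i rfl))
  refine ⟨_, hgerm, Set.Subset.antisymm (fun e' he' => ?_) ?_⟩
  · have h3 : e' ∈ rigidPoint hx X '' cones w N {i} := by
      by_contra h3
      exact h2 e' h3 he'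
    -- Inside the cone of `i` the new element has the germs of the old one, so its singular points
    -- are among the old candidates.
    obtain ⟨j, rfl⟩ := hsub (mem_singularSet_of_eqOn (h1 e' (hdisj e' h3)) he')
    by_cases hji : j = i
    · rw [hji]; rfl
    · exact (hdisj _ h3 (hmem {j | j ≠ i} j hji)).elim
  · rintro _ rfl
    obtain ⟨U, hU, hUe⟩ := hgerm
    exact mem_singularSet_of_eqOn ⟨U, hU, hUe.symm⟩ he

end Resolution

end ForestSkein


namespace ForestSkein

open SkeinPresentation FreeTree Cantor

/-! ### Elements without singular points -/

section Owner

variable {S β γ : Type} {step : S → Cantor → Bool × Cantor}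

theorem nodup_of_locA_injective {T : FreeTree Unit β} (h : Function.Injective (locA T)) :
    T.leaves.Nodup := by
  induction T with
  | leaf b => simp [FreeTree.leaves]
  | node c l r hl hr =>
    rw [FreeTree.leaves, List.nodup_append]
    refine ⟨hl fun z y hzy => (cons_inj.1 (h (a₁ := cons false z) (a₂ := cons false y) hzy)).2,
      hr fun z y hzy => (cons_inj.1 (h (a₁ := cons true z) (a₂ := cons true y) hzy)).2, ?_⟩
    rintro b hb _ hb' rfl
    obtain ⟨w, hw⟩ := exists_word_of_mem l hb
    obtain ⟨w', hw'⟩ := exists_word_of_mem r hb'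
    have h1 : locA (node c l r) (cons false (app w (const true))) =
        locA (node c l r) (cons true (app w' (const true))) := (hw _).trans (hw' _).symm
    exact Bool.noConfusion (cons_inj.1 (h h1)).1

/-- Each label fills one nonempty block, so collapsing the blocks recovers the list, whatever the
block lengths. -/
theorem eq_of_flatMap_replicate {L L' : List β} (hL : L.Nodup) (hL' : L'.Nodup) {n n' : β → ℕ}
    (hn : ∀ b, 0 < n b) (hn' : ∀ b, 0 < n' b)
    (h : (L.flatMap fun b => List.replicate (n b) b) =
      L'.flatMap fun b => List.replicate (n' b) b) : L = L' := by
  have head : ∀ (n : β → ℕ) (_ : ∀ b, 0 < n b) (b : β) (K : List β),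
      ((b :: K).flatMap fun b => List.replicate (n b) b) =
        b :: (List.replicate (n b - 1) b ++ K.flatMap fun b => List.replicate (n b) b) := by
    intro n hn b K
    obtain ⟨m, hm⟩ := Nat.exists_eq_add_of_lt (hn b)
    rw [List.flatMap_cons, hm]
    simp [List.replicate_succ]
  have notMem : ∀ (n : β → ℕ) (b : β) (K : List β), b ∉ K →
      b ∉ K.flatMap fun b => List.replicate (n b) b := by
    intro n b K hb hb'
    obtain ⟨c, hc, hc'⟩ := List.mem_flatMap.1 hb'
    exact hb (List.eq_of_mem_replicate hc' ▸ hc)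
  induction L generalizing L' with
  | nil =>
    cases L' with
    | nil => rfl
    | cons b K => rw [head n' hn'] at h; simp at h
  | cons b K ih =>
    cases L' with
    | nil => rw [head n hn] at h; simp at h
    | cons b' K' =>
      have h' := h
      rw [head n hn, head n' hn', List.cons.injEq] at h'
      obtain ⟨rfl, -⟩ := h'
      rw [List.nodup_cons] at hL hL'
      rw [List.flatMap_cons, List.flatMap_cons] at h
      classical
      -- The label `b` does not occur later, so the length of the first block is the number of all
      -- occurrences of `b`, and is the same on both sides.
      have hc := congrArg (List.count b) h
      rw [List.count_append, List.count_append, List.count_replicate_self,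
        List.count_replicate_self, List.count_eq_zero_of_not_mem (notMem n b K hL.1),
        List.count_eq_zero_of_not_mem (notMem n' b K' hL'.1), add_zero, add_zero] at hc
      rw [hc] at h
      rw [ih hL.2 hL'.2 (List.append_cancel_left h)]

/-- The leaves of a tree are determined by the map that sends a leaf of a deep multiple to the leaf
of the tree above it. -/
theorem leaves_map_owner (hs : ∀ c, Function.Surjective (step c)) (t : FreeTree S β)
    (f : β → FreeTree S γ) (T : FreeTree Unit γ) (hleaves : (t.bind f).leaves = T.leaves)
    (hloc : ∀ z, loc step (t.bind f) z = locA T z) {o : γ → β}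
    (ho : ∀ z, o (locA T z).1 = (loc step t z).1) :
    T.leaves.map o = t.leaves.flatMap fun b => List.replicate (f b).leaves.length b := by
  rw [← hleaves, leaves_bind, List.map_flatMap]
  refine List.flatMap_congr fun b hb => ?_
  rw [List.eq_replicate_iff]
  refine ⟨List.length_map _, fun b' hb' => ?_⟩
  obtain ⟨c, hc, rfl⟩ := List.mem_map.1 hb'
  obtain ⟨y, hy⟩ := loc_surjective hs (f b) hc (const true)
  obtain ⟨z, hz⟩ := loc_surjective hs t hb y
  have h1 : (locA T z).1 = c := by rw [← hloc, loc_bind, hz, hy]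
  rw [← h1, ho, hz]

end Owner

section Monochromatic

variable {x : FreeTree Unit Unit} {β γ : Type}

/-- A tree that locates points as a monochromatic tree has the same leaves. -/
theorem leaves_eq_of_loc_eq (hx : 2 ≤ x.size) {t : FreeTree Colour β} (ht : t.leaves.Nodup)
    {t' : FreeTree Unit β} (h : ∀ z, locA t' z = loc (step x) t z) : t'.leaves = t.leaves := by
  have hinj : Function.Injective (locA t') := by
    have h1 : locA t' = loc (step x) t := funext h
    rw [h1]
    exact loc_injective (fun c => (step_bijective hx c).1) t ht
  have ht' := nodup_of_locA_injective hinj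
  -- Location of points forgets the planar order, which is recovered from a common deep multiple of
  -- `t` and `t'` with distinct labels.
  obtain ⟨D, hD⟩ := vine_dividesDeep hx 0 β t ht
  obtain ⟨D', hD'⟩ := thompson_dividesDeep β t' ht'
  obtain ⟨f, hf, -⟩ := hD ℕ (full (max D D') id) (by rw [minDepth_full]; exact le_max_left _ _)
  obtain ⟨f', hf', -⟩ := hD' ℕ (full (max D D') id) (by rw [minDepth_full]; exact le_max_right _ _)
  have hf'' := thompson_eq_of_equiv hf'
  rw [recolour_unit] at hf''
  have hnd : (full (max D D') id).leaves.Nodup := by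
    rw [leaves_full, List.map_id]; exact List.nodup_range
  have hleaves : (t.bind f).leaves = (full (max D D') id).leaves :=
    hf.leaves_eq.trans (leaves_recolour _ _)
  generalize full (max D D') id = T at hf hf'' hnd hleaves
  have hloc : ∀ z, loc (step x) (t.bind f) z = locA T z := fun z =>
    (loc_eq_of_equiv hx hf z).trans (loc_aTree T z)
  -- The leaf of `t` above a leaf of the multiple is well defined, since the multiple has distinct
  -- labels. By `h` this owner map is the same for `t` and `t'`.
  have hex : ∀ c : ℕ, ∃ b : β, ∀ z, (locA T z).1 = c → (loc (step x) t z).1 = b := by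
    intro c
    by_cases hc : ∃ z, (locA T z).1 = c
    · obtain ⟨z, hz⟩ := hc
      refine ⟨(loc (step x) t z).1, fun y hy => ?_⟩
      by_contra hne
      rw [← hloc, loc_bind] at hz hy
      have h1 := loc_mem_leaves (step := step x) (f (loc (step x) t z).1) (loc (step x) t z).2
      have h2 := loc_mem_leaves (step := step x) (f (loc (step x) t y).1) (loc (step x) t y).2
      rw [hz] at h1
      rw [hy] at h2
      rw [← hleaves, leaves_bind, List.nodup_flatMap] at hnd
      have : Std.Symm (Function.onFun List.Disjoint fun b => (f b).leaves) :=
        ⟨fun _ _ h => List.Disjoint.symm h⟩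
      have h3 := hnd.2.forall (loc_mem_leaves (step := step x) t y)
        (loc_mem_leaves (step := step x) t z) hne
      exact h3 h2 h1
    · exact ⟨(loc (step x) t (const true)).1, fun z hz => (hc ⟨z, hz⟩).elim⟩
  choose o ho using hex
  have h1 := leaves_map_owner (fun c => (step_bijective hx c).2) t f T hleaves hloc
    (o := o) fun z => (ho _ z rfl).symm
  have h2 := leaves_map_owner (step := fun _ z => (z 0, Cantor.tail z)) (fun _ => stepA_bijective.2)
    t' f' T (by rw [hf'']) (fun z => by rw [hf'']) (o := o) fun z => by
      rw [← ho _ z rfl]; exact congrArg Prod.fst (h z).symm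
  exact (eq_of_flatMap_replicate ht ht' (fun b => List.length_pos_iff.2 (leaves_ne_nil _))
    (fun b => List.length_pos_iff.2 (leaves_ne_nil _)) (h1.symm.trans h2)).symm

theorem Spine.loc_app {D N : ℕ} {v t : FreeTree Colour γ}
    (h : Spine D v (List.replicate N .a) t) (z : Cantor) :
    loc (step x) t (app (List.replicate N true) z) = loc (step x) v z := by
  induction N generalizing t with
  | zero => cases h; rfl
  | succ N ih =>
    rw [List.replicate_succ] at h
    cases h with
    | cons _ s hs h => exact ih h

/-- If the far right part of a tree locates points as a monochromatic tree, then so does the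
tree. -/
theorem Spine.exists_loc_eq {D N : ℕ} {v t : FreeTree Colour γ}
    (h : Spine D v (List.replicate N .a) t) {v' : FreeTree Unit γ}
    (hv : ∀ z, locA v' z = loc (step x) v z) :
    ∃ t' : FreeTree Unit γ, ∀ z, locA t' z = loc (step x) t z := by
  induction N generalizing t with
  | zero => cases h; exact ⟨v', hv⟩
  | succ N ih =>
    rw [List.replicate_succ] at h
    cases h with
    | @cons _ _ s t hs h =>
      obtain ⟨t', ht'⟩ := ih h
      refine ⟨node () s t', fun z => ?_⟩
      rw [← cons_tail z]
      cases z 0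
      · exact (loc_aTree s _).symm
      · exact ht' _

theorem exists_locA_app (T : FreeTree Unit β) :
    ∃ D, ∀ w : List Bool, D ≤ w.length → ∃ b v, ∀ y, locA T (app w y) = (b, app v y) := by
  induction T with
  | leaf b => exact ⟨0, fun w _ => ⟨b, w, fun _ => rfl⟩⟩
  | node c l r hl hr =>
    obtain ⟨D₁, h₁⟩ := hl
    obtain ⟨D₂, h₂⟩ := hr
    refine ⟨max D₁ D₂ + 1, fun w hw => ?_⟩
    match w, hw with
    | false :: w, hw => exact h₁ w (by simp at hw; omega)
    | true :: w, hw => exact h₂ w (by simp at hw; omega)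

end Monochromatic

/-! ### Germs of prefix replacements and the finite germ extension -/

section Germ

variable {x : FreeTree Unit Unit} {X : ThompsonType} {k m n : ℕ}

/-- The elements of the Thompson group act locally by replacing prefixes. -/
theorem exists_cantorAction_app (hx : 2 ≤ x.size)
    (hX : IsOre (ForestCategory (vinePresentation x) X))
    (hV : IsOre (ForestCategory (vinePresentation x) .V)) (p q : Forest thompson X 1 n) :
    ∃ D, ∀ w : List Bool, D ≤ w.length → ∃ u, ∀ y,
      cantorAction hx hX hV (forestFrac hX (p.colour _ .a) (q.colour _ .a)) (app w y) = app u y := by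
  obtain ⟨q₀, -, -, -, hq⟩ := exists_rep_colour hx q
  obtain ⟨w, hw⟩ := exists_word_colour hx p
  obtain ⟨D, hD⟩ := exists_locA_app q₀
  refine ⟨D, fun v hv => ?_⟩
  obtain ⟨i, u, hu⟩ := hD v hv
  refine ⟨w i ++ u, fun y => ?_⟩
  rw [cantorAction_eq_iff, app_append, hw, hq, hu]

/-- Agreement in `E` near the point lifts to agreement on an open subset of the Cantor space, where
elements of the Thompson group replace sufficiently long prefixes. -/
theorem exists_eqOn_cantorAction (hx : 2 ≤ x.size) (h₀ : ∀ X, IsOre (ForestCategory thompson X))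
    (h : ∀ X, IsOre (ForestCategory (vinePresentation x) X)) {g : FSGroup (h X)} {z : Cantor}
    (hz : rigidPoint hx X z ∉
      singularSet (thompsonGroup h₀ h Colour.a X) (rigidAction (h X) (h .V) g)) :
    ∃ D, ∀ w y, D ≤ w.length → z = app w y → ∃ u, ∀ y',
      cantorAction hx (h X) (h .V) g (app w y') = app u y' := by
  obtain ⟨b, hb, U, hU, hUb⟩ := not_not.1 hz
  obtain ⟨n, p, q, rfl⟩ := (mem_thompsonGroup h₀ h _ _).1 hb
  obtain ⟨O, hOU, hO, hzO⟩ := mem_nhds_iff.1 hU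
  have h1 := eqOn_of_rigidPoint_eq (X := X) hx (hO.preimage (continuous_rigidPoint hx))
    (g := cantorAction hx (h X) (h .V) g)
    (b := cantorAction hx (h X) (h .V) (forestFrac (h X) (p.colour _ .a) (q.colour _ .a)))
    fun y hy => by
      rw [rigidPoint_cantorAction, rigidPoint_cantorAction]
      exact hUb (hOU hy)
  obtain ⟨N, hN⟩ := exists_app_mem (hO.preimage (continuous_rigidPoint hx)) hzO
  obtain ⟨D, hD⟩ := exists_cantorAction_app hx (h X) (h .V) p q
  refine ⟨max N D, fun w y hw hz => ?_⟩
  obtain ⟨u, hu⟩ := hD w (le_of_max_le_right hw)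
  exact ⟨u, fun y' => (h1 (hN w y (le_of_max_le_left hw) hz y')).trans (hu y')⟩

/-- The action depends only on how the trees of `f` locate points, so the trees `t' i` may replace
them. That they have the same leaves in the same order is what keeps the new forest of type `X`. -/
theorem mem_thompsonGroup_of_loc (hx : 2 ≤ x.size) (h₀ : ∀ X, IsOre (ForestCategory thompson X))
    (h : ∀ X, IsOre (ForestCategory (vinePresentation x) X)) (T : Forest thompson X 1 m)
    (q : Forest thompson X 1 n) (f : Forest (vinePresentation x) X n m)
    (h' : ∀ i, ∃ t' : FreeTree Unit (Fin m), ∀ z, locA t' z = treeLoc hx (f.tree i) z) :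
    rigidAction (h X) (h .V) (forestFrac (h X) (T.colour _ .a) ((q.colour _ .a).comp f)) ∈
      thompsonGroup h₀ h Colour.a X := by
  choose t' ht' using h'
  choose t ht using fun i => Tree.exists_mk (f.tree i)
  have hleaves : ∀ i, (t' i).leaves = (f.tree i).leaves := fun i => by
    have h1 := f.nodup_leaves_tree i
    rw [← ht i] at h1 ⊢
    refine leaves_eq_of_loc_eq hx h1 fun z => ?_
    rw [ht', ← ht]; rfl
  let f' : Forest thompson X n m :=
    { tree := fun i => Tree.mk _ (t' i)
      admissible := by
        simp only [Tree.leaves_mk, hleaves]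
        exact f.admissible }
  refine (mem_thompsonGroup h₀ h _ _).2 ⟨m, T, q.comp f', ?_⟩
  rw [Forest.colour_comp, rigidAction_eq_iff hx]
  intro z
  exact cantorAction_eq_of_treeLoc_eq hx _ _ rfl ((ht' _ _).symm.trans (loc_aTree _ _).symm)

/-- Since `w i 1^∞` is not singular, for `N` large the action on the cone `w i 1^N` replaces this
prefix by some `u`. Compared with the numerator, the part `r` of the `i`-th tree beyond its first
`N` spine vertices locates points as the subtree of the numerator at `u`; above `r` that tree is
`a`-coloured. -/
theorem mem_thompsonGroup_of_singularSet_eq_empty (hx : 2 ≤ x.size)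
    (h₀ : ∀ X, IsOre (ForestCategory thompson X))
    (h : ∀ X, IsOre (ForestCategory (vinePresentation x) X)) (g : FSGroup (h X))
    (hg : singularSet (thompsonGroup h₀ h Colour.a X) (rigidAction (h X) (h .V) g) = ∅) :
    rigidAction (h X) (h .V) g ∈ thompsonGroup h₀ h Colour.a X := by
  obtain ⟨n, q, hres⟩ := exists_resolution hx (h X) g
  obtain ⟨w, hw⟩ := exists_word_colour hx q
  choose D hD using fun i => exists_eqOn_cantorAction hx h₀ h (g := g) (X := X)
    (z := app (w i) (const true)) (by rw [hg]; exact Set.notMem_empty _)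
  obtain ⟨m, T, f, t, ht, rfl, hs⟩ := hres (Finset.univ.sup D)
  refine mem_thompsonGroup_of_loc hx h₀ h T q f fun i => ?_
  obtain ⟨u, hu⟩ := hD i (w i ++ List.replicate (Finset.univ.sup D) true) (const true)
    (by
      have := Finset.le_sup (f := D) (Finset.mem_univ i)
      simp only [List.length_append, List.length_replicate]
      omega) (by rw [app_append, app_replicate_const])
  obtain ⟨v, c, hv⟩ := hs i
  obtain ⟨r, hr, -⟩ := hv.exists_of_append
  obtain ⟨T₀, -, -, -, hT⟩ := exists_rep_colour hx T
  have key : ∀ y, locA T₀ (app u y) = loc (step x) r y := by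
    intro y
    rw [← hT, ← hu, forestLoc_cantorAction, forestLoc_comp, app_append, hw, ht]
    exact hr.loc_app y
  rcases exists_subtree T₀ u with ⟨T', hT'⟩ | ⟨b, v', hv', hb⟩
  · obtain ⟨t', ht'⟩ := hr.exists_loc_eq (x := x) (v' := T') fun z => (hT' z).symm.trans (key z)
    exact ⟨t', fun z => by rw [ht', ht]; rfl⟩
  -- If `u` went strictly below a leaf `b` of the numerator, `r` would reach only a proper part of
  -- the cone of `b`, whereas location in a tree is onto the cone of each of its leaves.
  · exfalso
    have h1 : b ∈ r.leaves := by
      have := loc_mem_leaves (step := step x) r (const true)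
      rwa [← key, hb] at this
    obtain ⟨c', v', rfl⟩ := List.exists_cons_of_ne_nil hv'
    obtain ⟨y, hy⟩ := loc_surjective (fun c => (step_bijective hx c).2) r h1 (const !c')
    rw [← key, hb] at hy
    have := congrFun (Prod.mk.inj hy).2 0
    simp [const] at this

theorem isFiniteGermExtension (hx : 2 ≤ x.size) (h₀ : ∀ X, IsOre (ForestCategory thompson X))
    (h : ∀ X, IsOre (ForestCategory (vinePresentation x) X)) (X : ThompsonType) :
    IsFiniteGermExtension (thompsonGroup h₀ h Colour.a X) (rigidAction (h X) (h .V)).range where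
  t2 := (rigidSpace_realization hx X).1
  le := by
    intro f hf
    obtain ⟨n, p, q, rfl⟩ := (mem_thompsonGroup h₀ h _ _).1 hf
    exact ⟨_, rfl⟩
  mem_iff := by
    rintro _ ⟨g, rfl⟩
    exact ⟨singularSet_eq_empty, mem_thompsonGroup_of_singularSet_eq_empty hx h₀ h g⟩
  finite := by
    rintro _ ⟨g, rfl⟩
    obtain ⟨n, q, hres⟩ := exists_resolution hx (h X) g
    obtain ⟨w, hw⟩ := exists_word_colour hx q
    exact (Set.finite_range _).subset (singularSet_subset hx h₀ h hw hres)
  exists_germ := by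
    rintro _ ⟨g, rfl⟩ e he
    obtain ⟨g', h1, h2⟩ := exists_isolated_germ hx h₀ h g he
    exact ⟨_, ⟨g', rfl⟩, h1, h2⟩

theorem forestFrac_eq_one {S : Type} {P : SkeinPresentation S} {hX : IsOre (ForestCategory P X)}
    (p : Forest P X 1 n) : forestFrac hX p p = 1 :=
  FractionGroup.frac_self (d := ForestCategory.of 1) (x := ⟨n⟩) p

/-- If a quotient of trees coloured by `a` acts trivially, then the trees are equal. -/
theorem eq_of_cantorAction_eq_id (hx : 2 ≤ x.size)
    (hX : IsOre (ForestCategory (vinePresentation x) X))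
    (hV : IsOre (ForestCategory (vinePresentation x) .V)) {p q : Forest thompson X 1 n}
    (h : ∀ z, cantorAction hx hX hV (forestFrac hX (p.colour _ .a) (q.colour _ .a)) z = z) :
    p = q := by
  obtain ⟨p₀, hp, hp', -, hp''⟩ := exists_rep_colour hx p
  obtain ⟨q₀, hq, hq', -, hq''⟩ := exists_rep_colour hx q
  have h1 : p₀ = q₀ := eq_of_locA_eq hp' hq' fun z => by
    rw [← hp'', ← hq'']
    exact (cantorAction_eq_iff hx hX hV _ _ z z).1 (h z)
  refine Forest.ext (funext fun i => ?_)
  rw [Subsingleton.elim i 0, hp, hq, h1]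

theorem cantorAction_eq_id (hx : 2 ≤ x.size) {hX : IsOre (ForestCategory (vinePresentation x) X)}
    {hV : IsOre (ForestCategory (vinePresentation x) .V)} {g : FSGroup hX}
    (hg : rigidAction hX hV g = 1) (z : Cantor) : cantorAction hx hX hV g z = z := by
  apply toPoint_injective hx
  rw [toPoint_cantorAction, restrictedAction_eq_one hx hX hV hg]
  rfl

theorem thompsonToQuotient_injective (hx : 2 ≤ x.size) (h₀ : IsOre (ForestCategory thompson X))
    (hX : IsOre (ForestCategory (vinePresentation x) X))
    (hV : IsOre (ForestCategory (vinePresentation x) .V)) :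
    Function.Injective (thompsonToQuotient h₀ hX hV Colour.a) := by
  rw [injective_iff_map_eq_one]
  intro g hg
  obtain ⟨n, p, q, rfl⟩ := exists_forestFrac g
  have h1 : rigidAction hX hV (forestFrac hX (p.colour _ .a) (q.colour _ .a)) = 1 := by
    have := congrArg (faithfulAction hX hV) hg
    rwa [map_one] at this
  rw [eq_of_cantorAction_eq_id hx hX hV (cantorAction_eq_id hx h1)]
  exact forestFrac_eq_one q

end Germ

/-! ### Non-trivial extensions -/

section NonTrivial

variable {x : FreeTree Unit Unit} {X : ThompsonType} {k m n : ℕ}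

theorem leafWord_rightVine {k i : ℕ} (hi : i < k) :
    leafWord (rightVine k) i = List.replicate i true ++ [false] := by
  induction k generalizing i with
  | zero => omega
  | succ k ih =>
    cases i with
    | zero => rfl
    | succ i => rw [rightVine, leafWord, size, if_neg (by omega), Nat.add_sub_cancel, ih (by omega)]; rfl

theorem lastDepth_rightVine (k : ℕ) : lastDepth (rightVine k) = k := by
  induction k with
  | zero => rfl
  | succ k ih => rw [rightVine, lastDepth, ih]

theorem cell_rightVine {k : ℕ} (hk : 0 < k) (hx : 2 ≤ (rightVine k).size) (i : ℕ) (y : Cantor) :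
    cell (rightVine k) i y = app (List.replicate i true ++ [false]) y := by
  induction i using Nat.strong_induction_on with
  | _ i ih =>
    by_cases hi : i < k
    · rw [cell_of_lt (by rwa [carets_rightVine]), leafWord_rightVine hi]
    · obtain ⟨j, rfl⟩ := Nat.exists_eq_add_of_le' (not_lt.1 hi)
      have h1 := cell_add hx j y
      rw [leafWord_carets, lastDepth_rightVine, carets_rightVine] at h1
      rw [h1, ih j (by omega), ← app_append, ← List.append_assoc, List.replicate_append_replicate,
        Nat.add_comm]

/-- The cells of a right-vine are the cones `1^i 0`, so the shift of the cells inserts a one, and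
both colours split the Cantor space in the same way. -/
theorem step_rightVine {k : ℕ} (hk : 0 < k) (hx : 2 ≤ (rightVine k).size) (c : Colour)
    (z : Cantor) : step (rightVine k) c z = (z 0, Cantor.tail z) := by
  cases c with
  | a => rfl
  | b =>
    by_cases hz : z = const true
    · rw [hz, step_b_const hx]; rfl
    · obtain ⟨i, y, rfl⟩ := exists_cell hx hz
      cases i with
      | zero => rw [step_b_cell_zero hx, cell_rightVine hk hx]; rfl
      | succ i => rw [step_b_cell_succ hx, cell_rightVine hk hx, cell_rightVine hk hx]; rfl

theorem thompsonGroup_eq_of_rightVine {k : ℕ} (hx : 2 ≤ (rightVine k).size)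
    (h₀ : ∀ X, IsOre (ForestCategory thompson X))
    (h : ∀ X, IsOre (ForestCategory (vinePresentation (rightVine k)) X)) (X : ThompsonType) :
    thompsonGroup h₀ h Colour.a X = (rigidAction (h X) (h .V)).range := by
  refine le_antisymm (isFiniteGermExtension hx h₀ h X).le ?_
  rintro _ ⟨g, rfl⟩
  obtain ⟨n, q, hres⟩ := exists_resolution hx (h X) g
  obtain ⟨m, T, f, t, ht, rfl, -⟩ := hres 0
  refine mem_thompsonGroup_of_loc hx h₀ h T q f fun i => ⟨uncolour (t i), fun z => ?_⟩
  have hk : 0 < k := by rw [size_rightVine] at hx; omega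
  rw [ht, treeLoc_mk, uncolour, locA, loc_recolour]
  congr 1
  funext c z
  exact (step_rightVine hk hx c z).symm

/-- The address `0` of the first leaf makes the left branch trivial; the other addresses, without
their first digit, are those of the right branch. -/
theorem eq_rightVine_of_leafWord (x : FreeTree Unit Unit)
    (h : ∀ i < x.carets, leafWord x i = List.replicate i true ++ [false]) :
    x = rightVine x.carets := by
  induction x with
  | leaf b => rfl
  | node c l r hl hr =>
    cases l with
    | node c' l' r' =>
      have h1 := h 0 (by simp [carets])
      rw [leafWord, if_pos (size_pos _), leafWord, if_pos (size_pos _)] at h1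
      simp at h1
    | leaf b =>
      have h1 : r = rightVine r.carets := hr fun i hi => by
        have := h (i + 1) (by simp only [carets]; omega)
        rw [leafWord, size, if_neg (by omega), Nat.add_sub_cancel, List.replicate_succ,
          List.cons_append, List.cons.injEq] at this
        exact this.2
      simp only [carets]
      rw [zero_add, rightVine, ← h1]

/-- The caret of colour `c`. -/
def caretForest (X : ThompsonType) (P : SkeinPresentation Colour) (c : Colour) : Forest P X 1 2 where
  tree _ := Tree.mk P (node c (leaf 0) (leaf 1))
  admissible := X.admissible_finRange 2

theorem forestLoc_caretForest (hx : 2 ≤ x.size) (c : Colour) (z : Cantor) :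
    forestLoc hx (caretForest X (vinePresentation x) c) z =
      (bif (step x c z).1 then 1 else 0, (step x c z).2) := by
  rcases h : step x c z with ⟨_ | _, y⟩
  · exact loc_node_false _ _ h
  · exact loc_node_true _ _ h

/-- The map that sends the right half to the part of the Cantor space that is below the right
branch of a caret of colour `b`. -/
theorem exists_shift (hx : 2 ≤ x.size) (hX : IsOre (ForestCategory (vinePresentation x) X))
    (hV : IsOre (ForestCategory (vinePresentation x) .V)) (z : Cantor) :
    step x .b (cantorAction hx hX hV (forestFrac hX (caretForest X _ .b) (caretForest X _ .a))
      (cons true z)) = (true, z) := by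
  have h := forestLoc_cantorAction hx hX hV (caretForest X _ .b) (caretForest X _ .a) (cons true z)
  rw [forestLoc_caretForest, forestLoc_caretForest] at h
  have h1 := (Prod.mk.inj h).1
  have h2 := (Prod.mk.inj h).2
  refine Prod.ext ?_ h2
  cases h3 : (step x .b (cantorAction hx hX hV
    (forestFrac hX (caretForest X _ .b) (caretForest X _ .a)) (cons true z))).1
  · rw [h3] at h1
    simp [step] at h1
  · rfl

/-- The test element is the fraction of the carets `b` and `a`; on the right half it is the shift
`β` of the cells. A prefix replacement near the maximum extends to the whole space, because `β`
commutes with the insertion of `lastDepth x` ones. Comparing the image of `β` with the complement of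
the cell `0` then determines all the cells. -/
theorem eq_rightVine_of_thompsonGroup_eq (hx : 2 ≤ x.size)
    (h₀ : ∀ X, IsOre (ForestCategory thompson X))
    (h : ∀ X, IsOre (ForestCategory (vinePresentation x) X)) {X : ThompsonType}
    (heq : thompsonGroup h₀ h Colour.a X = (rigidAction (h X) (h .V)).range) :
    x = rightVine x.carets := by
  have hmem : rigidAction (h X) (h .V)
      (forestFrac (h X) (caretForest X _ .b) (caretForest X _ .a)) ∈
        thompsonGroup h₀ h Colour.a X := heq ▸ ⟨_, rfl⟩
  obtain ⟨n, p, q, hpq⟩ := (mem_thompsonGroup h₀ h _ _).1 hmem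
  rw [rigidAction_eq_iff hx] at hpq
  obtain ⟨D, hD⟩ := exists_cantorAction_app hx (h X) (h .V) p q
  simp only [← hpq] at hD
  clear hpq hmem
  let β : Cantor → Cantor := fun z => cantorAction hx (h X) (h .V)
    (forestFrac (h X) (caretForest X _ .b) (caretForest X _ .a)) (cons true z)
  have hβ : ∀ z, step x .b (β z) = (true, z) := exists_shift hx (h X) (h .V)
  have hinj := (step_bijective hx .b).1
  have hβcell : ∀ i y, β (cell x i y) = cell x (i + 1) y := fun i y =>
    hinj ((hβ _).trans (step_b_cell_succ hx i y).symm)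
  have hβconst : β (const true) = const true := hinj ((hβ _).trans (step_b_const hx).symm)
  -- the map on the cones around the maximum
  obtain ⟨r, hr⟩ : ∃ r, r = lastDepth x := ⟨_, rfl⟩
  have hr0 : 0 < r := hr ▸ lastDepth_pos hx
  have hcell : ∀ N i y, cell x (i + N * x.carets) y =
      app (List.replicate (N * r) true) (cell x i y) := by
    intro N i y
    induction N with
    | zero => simp
    | succ N ih =>
      rw [Nat.add_one_mul, ← Nat.add_assoc, cell_add hx, ih, leafWord_carets, ← hr, ← app_append,
        List.replicate_append_replicate]
      congr 2
      ring
  have hβapp : ∀ N z, β (app (List.replicate (N * r) true) z) =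
      app (List.replicate (N * r) true) (β z) := by
    intro N z
    by_cases hz : z = const true
    · rw [hz, app_replicate_const, hβconst, app_replicate_const]
    · obtain ⟨i, y, rfl⟩ := exists_cell hx hz
      rw [← hcell, hβcell, hβcell, ← hcell]
      congr 1
      omega
  -- The first digit selects the right half, on which `β` lives. The other ones are a multiple of
  -- `r` in number, so that `β` commutes with them, and at least `D` because `r` is positive.
  obtain ⟨u, hu⟩ := hD (true :: List.replicate (D * r) true) (by
    simp only [List.length_cons, List.length_replicate]
    have := Nat.le_mul_of_pos_right D hr0
    omega)
  have hu' : ∀ z, app (List.replicate (D * r) true) (β z) = app u z := fun z =>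
    (hβapp D z).symm.trans (hu z)
  obtain ⟨m, rfl⟩ : ∃ m, u = List.replicate m true := by
    have h1 := hu' (const true)
    rw [hβconst, app_replicate_const] at h1
    exact ⟨_, (app_eq_const h1.symm).1⟩
  -- the map is the insertion of ones
  obtain ⟨k, hk⟩ : ∃ k, ∀ z, β z = app (List.replicate k true) z := by
    rcases le_or_gt (D * r) m with hm | hm
    · obtain ⟨k, rfl⟩ := Nat.exists_eq_add_of_le hm
      refine ⟨k, fun z => app_injective (List.replicate (D * r) true) ?_⟩
      rw [hu', ← app_append, List.replicate_append_replicate]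
    · exfalso
      obtain ⟨k, hk⟩ := Nat.exists_eq_add_of_lt hm
      -- After cancelling `m` ones, the left side still starts with a one, while the right side is
      -- the sequence of zeros.
      have h1 := hu' (const false)
      rw [hk, Nat.add_assoc, ← List.replicate_append_replicate, app_append] at h1
      have h2 := congrFun (app_injective _ h1) 0
      simp [const, List.replicate_succ] at h2
  -- The image of `β` is the cone `1^k`, and its complement is the cell `0`, which is a cone
  -- `0^(j+1)`. Two such cones are complementary only for `k = 1` and `j = 0`.
  have hcell0 : ∀ z, (∀ z', z ≠ β z') → ∃ y, z = cell x 0 y := by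
    intro z hz
    rcases h1 : step x .b z with ⟨_ | _, y⟩
    · exact ⟨y, hinj (h1.trans (step_b_cell_zero hx y).symm)⟩
    · exact (hz y (hinj (h1.trans (hβ y).symm))).elim
  have hne : ∀ z y, β z ≠ cell x 0 y := by
    intro z y hzy
    have h1 := hβ z
    rw [hzy, step_b_cell_zero hx] at h1
    simp at h1
  obtain ⟨j, hj⟩ : ∃ j, leafWord x 0 = List.replicate (j + 1) false := by
    obtain ⟨j, hj⟩ := leafWord_zero x
    cases x with
    | leaf b => simp [size] at hx
    | node c l r' =>
      cases j with
      | zero => rw [leafWord, if_pos (size_pos _)] at hj; simp at hj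
      | succ j => exact ⟨j, hj⟩
  have hc0 : ∀ y, cell x 0 y = cons false (app (List.replicate j false) y) := by
    intro y
    rw [cell_of_lt (carets_pos hx), hj, List.replicate_succ, app_cons]
  obtain rfl : k = 1 := by
    rcases k with _ | _ | k
    · exact (hne (cell x 0 (const true)) (const true) (hk _)).elim
    · rfl
    · exfalso
      obtain ⟨y, hy⟩ := hcell0 (cons true (const false)) fun z' hz' => by
        rw [hk, List.replicate_succ, List.replicate_succ, app_cons, app_cons, cons_inj] at hz'
        have := congrFun hz'.2 0
        simp [const] at this
      rw [hc0, cons_inj] at hy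
      simp at hy
  obtain rfl : j = 0 := by
    rcases j with _ | j
    · rfl
    · exfalso
      obtain ⟨y, hy⟩ := hcell0 (cons false (const true)) fun z' hz' => by
        rw [hk, List.replicate_succ, app_cons, cons_inj] at hz'
        simp at hz'
      rw [hc0, cons_inj, List.replicate_succ, app_cons] at hy
      have := congrFun hy.2 0
      simp [const] at this
  have hall : ∀ i y, cell x i y = app (List.replicate i true ++ [false]) y := by
    intro i
    induction i with
    | zero => exact hc0
    | succ i ih =>
      intro y
      rw [← hβcell, hk, ih, ← app_append]
      rfl
  refine eq_rightVine_of_leafWord x fun i hi => app_left_injective fun z => ?_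
  rw [← cell_of_lt hi, hall]

theorem thompsonGroup_ne_iff (hx : 2 ≤ x.size) (h₀ : ∀ X, IsOre (ForestCategory thompson X))
    (h : ∀ X, IsOre (ForestCategory (vinePresentation x) X)) (X : ThompsonType) :
    thompsonGroup h₀ h Colour.a X ≠ (rigidAction (h X) (h .V)).range ↔
      x ≠ rightVine x.carets := by
  refine not_congr ⟨eq_rightVine_of_thompsonGroup_eq hx h₀ h, fun hxk => ?_⟩
  generalize x.carets = k at hxk
  subst hxk
  exact thompsonGroup_eq_of_rightVine hx h₀ h X

end NonTrivial

end ForestSkein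


namespace ForestSkein

open SkeinPresentation FreeTree Cantor

/-! ### Rewriting spines -/

section Rewriting

variable {x : FreeTree Unit Unit} {γ : Type}

/-- The words `w` and `w'` are related if trees with spine `w` and deep branches are equivalent to
trees with spine `w'`. -/
def Rewrites (x : FreeTree Unit Unit) (w w' : List Colour) : Prop :=
  ∃ K, ∀ (D : ℕ) (γ : Type) (v t : FreeTree Colour γ), Spine (D + K) v w t →
    ∃ t', (vinePresentation x).Equiv t t' ∧ Spine D v w' t'

theorem Rewrites.refl (w : List Colour) : Rewrites x w w :=
  ⟨0, fun _ _ _ t h => ⟨t, .refl t, h⟩⟩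

theorem Rewrites.trans {w w' w'' : List Colour} (h : Rewrites x w w') (h' : Rewrites x w' w'') :
    Rewrites x w w'' := by
  obtain ⟨K, hK⟩ := h
  obtain ⟨K', hK'⟩ := h'
  refine ⟨K' + K, fun D γ v t ht => ?_⟩
  obtain ⟨t', e, ht'⟩ := hK (D + K') γ v t (by rwa [Nat.add_assoc])
  obtain ⟨t'', e', ht''⟩ := hK' D γ v t' ht'
  exact ⟨t'', e.trans e', ht''⟩

theorem Spine.exists_equiv {D : ℕ} {v v' t : FreeTree Colour γ} {w : List Colour}
    (h : Spine D v w t) (hv : (vinePresentation x).Equiv v v') :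
    ∃ t', (vinePresentation x).Equiv t t' ∧ Spine D v' w t' := by
  induction h with
  | nil => exact ⟨v', hv, .nil⟩
  | cons c s hs _ ih =>
    obtain ⟨t', e, ht'⟩ := ih
    exact ⟨_, .node c (.refl _) e, .cons c s hs ht'⟩

theorem Rewrites.append_left (u : List Colour) {w w' : List Colour} (h : Rewrites x w w') :
    Rewrites x (u ++ w) (u ++ w') := by
  obtain ⟨K, hK⟩ := h
  refine ⟨K, fun D γ v t ht => ?_⟩
  obtain ⟨t₁, h1, h2⟩ := ht.exists_of_append
  obtain ⟨t₂, e, h3⟩ := hK D γ v t₁ h2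
  obtain ⟨t₃, e', h4⟩ := (h1.mono (Nat.le_add_right D K)).exists_equiv e
  exact ⟨t₃, e', h4.append h3⟩

theorem Rewrites.append_right {w w' : List Colour} (h : Rewrites x w w') (u : List Colour) :
    Rewrites x (w ++ u) (w' ++ u) := by
  obtain ⟨K, hK⟩ := h
  refine ⟨K, fun D γ v t ht => ?_⟩
  obtain ⟨t₁, h1, h2⟩ := ht.exists_of_append
  obtain ⟨t₂, e, h3⟩ := hK D γ t₁ t h1
  exact ⟨t₂, e, h3.append (h2.mono (Nat.le_add_right D K))⟩

theorem Spine.exists_bVine {D k : ℕ} {v t : FreeTree Colour γ}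
    (h : Spine D v (List.replicate k .b) t) : ∃ σ : ℕ → FreeTree Colour γ,
      t = (bVine k).graft σ ∧ σ k = v ∧
        ∀ i < k, ∃ s : FreeTree Unit γ, σ i = aTree s ∧ D ≤ s.minDepth := by
  induction k generalizing t with
  | zero =>
    cases h
    exact ⟨fun _ => v, rfl, rfl, fun i hi => by omega⟩
  | succ k ih =>
    rw [List.replicate_succ] at h
    cases h with
    | @cons _ _ s t hs h =>
      obtain ⟨σ, rfl, hk, hσ⟩ := ih h
      refine ⟨fun i => if i = 0 then aTree s else σ (i - 1), ?_, by simpa using hk, fun i hi => ?_⟩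
      · rw [rightVine_graft]
        simp
      · dsimp only
        split_ifs with h0
        · exact ⟨s, rfl, hs⟩
        · exact hσ _ (by omega)

/-- This is the skein relation read along the right spine, on which `x` has `lastDepth x` vertices.
-/
theorem rewrites_vine (x : FreeTree Unit Unit) :
    Rewrites x (List.replicate x.carets .b) (List.replicate (lastDepth x) .a) := by
  refine ⟨0, fun D γ v t h => ?_⟩
  obtain ⟨σ, rfl, hv, hσ⟩ := h.exists_bVine
  refine ⟨_, (equiv_vine σ).symm, ?_⟩
  have h1 := spine_graft (D := D) x σ fun i hi => hσ i (by rw [size_eq_carets] at hi; omega)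
  rwa [size_eq_carets, Nat.add_sub_cancel, hv] at h1

/-- This is `equiv_shift` read along the right spine. The depth `x.carets` is spent on finding the
left parts of `x(a)` inside the branches. -/
theorem rewrites_shift (hx : 2 ≤ x.size) :
    Rewrites x (.b :: List.replicate (lastDepth x) .a) (List.replicate (lastDepth x) .a ++ [.b]) := by
  refine ⟨x.carets, fun D γ v t h => ?_⟩
  have hp := carets_pos hx
  cases h with
  | @cons _ _ s t hs h =>
    rw [← List.append_nil (List.replicate _ _)] at h
    obtain ⟨σ, rfl, hσ, hv⟩ := h.exists_graft
    rw [size_eq_carets, Nat.add_sub_cancel] at hv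
    cases hv
    refine ⟨_, equiv_shift hx _ σ, ?_⟩
    have h1 := spine_graft (D := D) x (fun i => if i = 0 then aTree s else if i < x.carets then
      σ (i - 1) else node .b (σ (x.carets - 1)) (σ x.carets)) fun i hi => by
        rw [size_eq_carets] at hi
        split_ifs with h0 h1
        · exact ⟨s, rfl, by omega⟩
        · exact hσ _ (by rw [size_eq_carets]; omega)
        · omega
    refine h1.append ?_
    rw [size_eq_carets, Nat.add_sub_cancel, if_neg (by omega), if_neg (by omega)]
    obtain ⟨s', hs', hd⟩ := hσ (x.carets - 1) (by rw [size_eq_carets]; omega)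
    rw [hs']
    exact .cons _ _ hd .nil

theorem rewrites_shift_iterate (hx : 2 ≤ x.size) (q : ℕ) :
    Rewrites x (.b :: List.replicate (q * lastDepth x) .a)
      (List.replicate (q * lastDepth x) .a ++ [.b]) := by
  induction q with
  | zero => simpa using Rewrites.refl _
  | succ q ih =>
    rw [Nat.add_one_mul, ← List.replicate_append_replicate]
    have h1 := ih.append_right (List.replicate (lastDepth x) .a)
    have h2 := (rewrites_shift hx).append_left (List.replicate (q * lastDepth x) .a)
    rw [List.append_assoc, List.singleton_append] at h1
    rw [List.append_assoc]
    exact h1.trans h2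

variable (hx : 2 ≤ x.size)

/-- The inverse of the right branch of a caret of colour `b`. -/
noncomputable def shift (z : Cantor) : Cantor := ((step_bijective hx .b).2 (true, z)).choose

theorem step_shift (z : Cantor) : step x .b (shift hx z) = (true, z) :=
  ((step_bijective hx .b).2 (true, z)).choose_spec

theorem shift_cell (i : ℕ) (y : Cantor) : shift hx (cell x i y) = cell x (i + 1) y :=
  (step_bijective hx .b).1 ((step_shift hx _).trans (step_b_cell_succ hx i y).symm)

theorem shift_const : shift hx (const true) = const true :=
  (step_bijective hx .b).1 ((step_shift hx _).trans (step_b_const hx).symm)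

/-- The embedding of the Cantor space as the cone below the end of a spine. -/
noncomputable def spineMap : List Colour → Cantor → Cantor
  | [], z => z
  | .a :: w, z => cons true (spineMap w z)
  | .b :: w, z => shift hx (spineMap w z)

theorem spineMap_append (w w' : List Colour) (z : Cantor) :
    spineMap hx (w ++ w') z = spineMap hx w (spineMap hx w' z) := by
  induction w with
  | nil => rfl
  | cons c w ih => cases c <;> simp [spineMap, ih]

theorem Spine.loc_spineMap {D : ℕ} {v t : FreeTree Colour γ} {w : List Colour}
    (h : Spine D v w t) (z : Cantor) :
    loc (step x) t (spineMap hx w z) = loc (step x) v z := by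
  induction h with
  | nil => rfl
  | cons c s _ _ ih =>
    cases c with
    | a => exact ih
    | b =>
      rw [← ih]
      exact loc_node_true _ _ (step_shift hx _)

/-- The first component of a label tells the level of the branch, counted from the end of the spine,
which keeps the labels distinct. Such trees serve to test words. -/
theorem exists_spine (D : ℕ) (w : List Colour) :
    ∃ t : FreeTree Colour (ℕ × ℕ), Spine D (leaf (0, 0)) w t ∧ t.leaves.Nodup ∧
      ∀ p ∈ t.leaves, p.1 ≤ w.length := by
  induction w with
  | nil => exact ⟨leaf (0, 0), .nil, by simp [FreeTree.leaves], by simp [FreeTree.leaves]⟩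
  | cons c w ih =>
    obtain ⟨t, ht, hnd, hle⟩ := ih
    have hl : (aTree (full D fun i => (w.length + 1, i))).leaves =
        (List.range (2 ^ D)).map fun i => (w.length + 1, i) := by
      rw [aTree, leaves_recolour, leaves_full]
    refine ⟨_, .cons c (full D fun i => (w.length + 1, i)) (minDepth_full _ _).ge ht, ?_, ?_⟩
    · rw [FreeTree.leaves, hl, List.nodup_append]
      refine ⟨List.nodup_range.map fun i j h => (Prod.mk.inj h).2, hnd, ?_⟩
      rintro p hp _ hp' rfl
      obtain ⟨i, -, rfl⟩ := List.mem_map.1 hp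
      exact absurd (hle _ hp') (by simp)
    · intro p hp
      rw [FreeTree.leaves, hl] at hp
      rcases List.mem_append.1 hp with hp | hp
      · obtain ⟨i, -, rfl⟩ := List.mem_map.1 hp
        exact le_rfl
      · exact (hle p hp).trans (Nat.le_succ _)

/-- For a tree with spine `w` and distinct labels, both maps send `z` to the point located at `z` in
the last leaf, and location is injective. -/
theorem Rewrites.spineMap_eq {w w' : List Colour} (h : Rewrites x w w') (z : Cantor) :
    spineMap hx w z = spineMap hx w' z := by
  obtain ⟨K, hK⟩ := h
  obtain ⟨t, ht, hnd, -⟩ := exists_spine (0 + K) w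
  obtain ⟨t', e, ht'⟩ := hK 0 _ _ t ht
  refine loc_injective (fun c => (step_bijective hx c).1) t hnd ?_
  rw [ht.loc_spineMap hx, loc_eq_of_equiv hx e, ht'.loc_spineMap hx]

theorem spineMap_replicate_a (e : ℕ) (z : Cantor) :
    spineMap hx (List.replicate e .a) z = app (List.replicate e true) z := by
  induction e with
  | zero => rfl
  | succ e ih => simp [List.replicate_succ, spineMap, ih]

theorem spineMap_replicate_b (k i : ℕ) (y : Cantor) :
    spineMap hx (List.replicate k .b) (cell x i y) = cell x (i + k) y := by
  induction k with
  | zero => rfl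
  | succ k ih => rw [List.replicate_succ, spineMap, ih, shift_cell, Nat.add_assoc]

theorem spineMap_const (w : List Colour) : spineMap hx w (const true) = const true := by
  induction w with
  | nil => rfl
  | cons c w ih => cases c <;> simp [spineMap, ih, shift_const]

end Rewriting

/-! ### Faithful actions -/

section Faithful

variable {x : FreeTree Unit Unit} {X : ThompsonType} {n : ℕ}

/-- Spines whose end is embedded as a cone around the maximum can be rewritten as `a`-coloured
spines. -/
def SpinesRewrite (hx : 2 ≤ x.size) : Prop :=
  ∀ (w : List Colour) (m : ℕ), (∀ z, spineMap hx w z = app (List.replicate m true) z) →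
    ∃ e, Rewrites x w (List.replicate e .a)

/-- As `t` locates points like a part of a monochromatic tree, the cone at the end of its spine is
the cone of a word. It contains the maximum, which `spineMap` fixes, so this word consists of ones.
-/
theorem exists_spineMap_eq (hx : 2 ≤ x.size) {β : Type} {t : FreeTree Colour β}
    (hnd : t.leaves.Nodup) {c : β} {w : List Colour} (h : Spine 0 (leaf c) w t)
    {T : FreeTree Unit β} {u : List Bool} (hT : ∀ z, locA T (app u z) = loc (step x) t z) :
    ∃ m, ∀ z, spineMap hx w z = app (List.replicate m true) z := by
  have h1 : ∀ z, locA T (app u (spineMap hx w z)) = (c, z) := fun z =>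
    (hT _).trans (h.loc_spineMap hx z)
  obtain ⟨v, hv⟩ : ∃ v : List Bool, ∀ z, spineMap hx w z = app v z := by
    rcases exists_subtree T u with ⟨T', hT'⟩ | ⟨b, v, -, hv⟩
    · have h2 : ∀ z, locA T' (spineMap hx w z) = (c, z) := fun z => (hT' _).symm.trans (h1 z)
      have hc : c ∈ T'.leaves := by
        have := loc_mem_leaves (step := fun _ z => (z 0, Cantor.tail z)) T'
          (spineMap hx w (const true))
        rwa [show loc (fun (_ : Unit) z => (z 0, Cantor.tail z)) T' (spineMap hx w (const true)) =
          (c, const true) from h2 _] at this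
      obtain ⟨v, hv⟩ := exists_word_of_mem T' hc
      refine ⟨v, fun z => loc_injective (fun c => (step_bijective hx c).1) t hnd ?_⟩
      rw [← hT, ← hT, hT', hT', h2, hv]
    · have h2 : ∀ z, app v (spineMap hx w z) = z := fun z =>
        (Prod.mk.inj ((hv _).symm.trans (h1 z))).2
      cases v with
      | nil => exact ⟨[], h2⟩
      | cons c' v =>
        have := congrFun (h2 (const !c')) 0
        simp [const] at this
  have h3 := hv (const true)
  rw [spineMap_const] at h3
  rw [(app_eq_const h3.symm).1] at hv
  exact ⟨_, hv⟩

theorem Spine.exists_aTree {γ : Type} {D e : ℕ} {v : FreeTree Unit γ} {t : FreeTree Colour γ}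
    (h : Spine D (aTree v) (List.replicate e .a) t) : ∃ T, t = aTree T := by
  induction e generalizing t with
  | zero => cases h; exact ⟨v, rfl⟩
  | succ e ih =>
    rw [List.replicate_succ] at h
    cases h with
    | @cons _ _ s t hs h =>
      obtain ⟨T, rfl⟩ := ih h
      exact ⟨node () s T, rfl⟩

/-- In a resolution of a trivially acting element, the spine words of the denominator act as powers
of `a` by comparison with the numerator, so they can be rewritten as such. The element then becomes
a fraction of `a`-coloured trees, and such a fraction acts trivially only if its two trees are
equal. -/
theorem rigidAction_injective (hx : 2 ≤ x.size) (hS : SpinesRewrite hx)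
    (hX : IsOre (ForestCategory (vinePresentation x) X))
    (hV : IsOre (ForestCategory (vinePresentation x) .V)) :
    Function.Injective (rigidAction hX hV) := by
  rw [injective_iff_map_eq_one]
  intro g hg
  have hid := cantorAction_eq_id hx hg
  obtain ⟨n, q, hres⟩ := exists_resolution hx hX g
  obtain ⟨m, T, f, t, ht, rfl, hs⟩ := hres 0
  obtain ⟨v, hv⟩ := exists_word_colour hx q
  obtain ⟨T₀, -, -, -, hT⟩ := exists_rep_colour hx T
  choose w c hw using hs
  simp only [List.replicate_zero, List.nil_append] at hw
  have hnd : ∀ i, (t i).leaves.Nodup := fun i => by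
    have := f.nodup_leaves_tree i
    rwa [ht] at this
  have hrw : ∀ i, ∃ e, Rewrites x (w i) (List.replicate e .a) := fun i => by
    obtain ⟨m', hm'⟩ := exists_spineMap_eq hx (hnd i) (hw i) (T := T₀) (u := v i) fun z => by
      rw [← hT, (cantorAction_eq_iff hx hX hV _ _ _ _).1 (hid _), forestLoc_comp, hv, ht]
      rfl
    exact hS _ _ hm'
  choose e K hK using hrw
  -- Rewriting consumes depth in the branches; gluing full trees of depth `D` on all leaves, in
  -- numerator and denominator alike, provides enough for all the spines at once.
  let D := Finset.univ.sup K
  have htree : ∀ i, ∃ U : FreeTree Unit (Fin (m * 2 ^ D)), (vinePresentation x).Equiv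
      ((t i).bind fun j => aTree (full D (fullLabel m D j))) (aTree U) := by
    intro i
    have h1 := (hw i).bind_aTree (D' := D) (fun j => full D (fullLabel m D j))
      fun j => (minDepth_full _ _).ge
    have h2 : 0 + K i ≤ D := by
      rw [zero_add]; exact Finset.le_sup (f := K) (Finset.mem_univ i)
    obtain ⟨t', e', ht'⟩ := hK i 0 _ _ _ (h1.mono h2)
    obtain ⟨U, rfl⟩ := ht'.exists_aTree
    exact ⟨U, e'⟩
  choose U hU using htree
  have hcomp : ∀ i, (f.comp ((fullForest X m D).colour _ .a)).tree i = Tree.mk _ (aTree (U i)) := by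
    intro i
    rw [← Tree.mk_eq_mk.2 (hU i), ← Tree.mk_bind, ← ht i]
    rfl
  let F : Forest thompson X n (m * 2 ^ D) :=
    { tree := fun i => Tree.mk _ (U i)
      admissible := by
        have h1 := (f.comp ((fullForest X m D).colour _ .a)).admissible
        simp only [hcomp, Tree.leaves_mk, aTree, leaves_recolour] at h1
        exact h1 }
  have hF : f.comp ((fullForest X m D).colour _ .a) = F.colour _ .a :=
    Forest.ext (funext hcomp)
  have hg : forestFrac hX (T.colour _ .a) ((q.colour _ .a).comp f) =
      forestFrac hX ((T.comp (fullForest X m D)).colour _ .a) ((q.comp F).colour _ .a) := by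
    rw [Forest.colour_comp, Forest.colour_comp, ← hF, ← Forest.comp_assoc, forestFrac_comp]
  rw [hg] at hid ⊢
  rw [eq_of_cantorAction_eq_id hx hX hV hid]
  exact forestFrac_eq_one _

theorem eq_of_app_replicate {e m : ℕ} {y y' : Cantor}
    (h : app (List.replicate e true) (cons false y) = app (List.replicate m true) (cons false y')) :
    y = y' := by
  induction e generalizing m with
  | zero =>
    cases m with
    | zero => exact (cons_inj.1 h).2
    | succ m => exact Bool.noConfusion (cons_inj.1 h).1
  | succ e ih =>
    cases m with
    | zero => exact Bool.noConfusion (cons_inj.1 h).1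
    | succ m => exact ih (cons_inj.1 h).2

/-- The trees whose right branch is trivial. -/
theorem spinesRewrite_leaf {t : FreeTree Unit Unit} (ht : 2 ≤ t.size)
    (hx : 2 ≤ (node () t (leaf ())).size) : SpinesRewrite hx := by
  have hn : (node () t (leaf ())).carets = t.size := by
    simp only [carets, size_eq_carets]
  have hr : lastDepth (node () t (leaf ())) = 1 := rfl
  have hvine := rewrites_vine (node () t (leaf ()))
  have hshift := rewrites_shift_iterate hx
  rw [hr, hn] at hvine
  simp only [hr, mul_one] at hshift
  -- With `lastDepth = 1` and `t.size` carets, the relations are `b^(t.size) = a` and `b a = a b`,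
  -- which lead to the normal form `a^e b^k`.
  have hnf : ∀ w, ∃ e k, k < t.size ∧
      Rewrites (node () t (leaf ())) w (List.replicate e .a ++ List.replicate k .b) := by
    intro w
    induction w with
    | nil => exact ⟨0, 0, by omega, .refl _⟩
    | cons c w ih =>
      obtain ⟨e, k, hk, h⟩ := ih
      have h1 := h.append_left [c]
      cases c with
      | a => exact ⟨e + 1, k, hk, by rw [List.replicate_succ]; exact h1⟩
      | b =>
        have h2 := (hshift e).append_right (List.replicate k .b)
        rw [List.append_assoc, List.singleton_append, ← List.replicate_succ] at h2
        have h3 : Rewrites (node () t (leaf ())) (.b :: w) _ := h1.trans h2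
        by_cases hk' : k + 1 < t.size
        · exact ⟨e, k + 1, hk', h3⟩
        · have hk'' : k + 1 = t.size := by omega
          refine ⟨e + 1, 0, by omega, h3.trans ?_⟩
          rw [hk'', ← List.replicate_append_replicate, List.replicate_zero, List.append_nil]
          exact hvine.append_left _
  intro w m hw
  obtain ⟨e, k, hk, h⟩ := hnf w
  rcases Nat.eq_zero_or_pos k with rfl | hk0
  · exact ⟨e, by simpa using h⟩
  · exfalso
    have hcell : ∀ i < t.size, ∀ y, cell (node () t (leaf ())) i y =
        cons false (app (leafWord t i) y) := by
      intro i hi y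
      rw [cell_of_lt (by omega), leafWord, if_pos hi, app_cons]
    -- The word moves the cell `0` to the cell `k`, up to leading ones. Both cells start with a
    -- zero, so comparing what follows the first zero gives leaves number `k` and `0` of `t`.
    have h1 := hw (cell (node () t (leaf ())) 0 (const true))
    rw [h.spineMap_eq hx, spineMap_append, spineMap_replicate_b, spineMap_replicate_a, zero_add,
      hcell k hk, hcell 0 (by omega)] at h1
    have := (leafWord_injective t hk (by omega) (eq_of_app_replicate h1)).1
    omega

/-- Reduced words that do not start with `a`, for the relations `b ^ (s + 1) = a ^ 2` and
`b a ^ 2 = a ^ 2 b`. -/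
inductive Reduced (s : ℕ) : List Colour → Prop
  | nil : Reduced s []
  | block {k : ℕ} : 0 < k → k ≤ s → Reduced s (List.replicate k .b)
  | append {k : ℕ} {w : List Colour} : 0 < k → k ≤ s → Reduced s w →
      Reduced s (List.replicate k .b ++ .a :: w)

/-- The trees whose right branch is a caret. -/
theorem spinesRewrite_caret {t : FreeTree Unit Unit} (ht : 2 ≤ t.size)
    (hx : 2 ≤ (node () t (node () (leaf ()) (leaf ()))).size) : SpinesRewrite hx := by
  obtain ⟨x, hxt⟩ : ∃ x, x = node () t (node () (leaf ()) (leaf ())) := ⟨_, rfl⟩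
  have hn : x.carets = t.size + 1 := by
    rw [hxt]; simp only [carets, size_eq_carets]
  have hr : lastDepth x = 2 := by rw [hxt]; rfl
  have hleaf : ∀ i < t.size, leafWord x i = false :: leafWord t i := fun i hi => by
    rw [hxt, leafWord, if_pos hi]
  have hlast : leafWord x t.size = [true, false] := by
    rw [hxt, leafWord, if_neg (lt_irrefl _), Nat.sub_self]; rfl
  rw [← hxt] at hx
  have key : SpinesRewrite hx := by
    clear hxt
    have hvine := rewrites_vine x
    have hshift := rewrites_shift_iterate hx
    rw [hr, hn] at hvine
    simp only [hr] at hshift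
    have hbreduced : ∀ w, Reduced t.size w → ∃ e w', Reduced t.size w' ∧
        Rewrites x (.b :: w) (List.replicate e .a ++ w') := by
      intro w hw
      cases hw with
      | nil => exact ⟨0, _, .block (k := 1) one_pos (by omega), .refl _⟩
      | @block k hk hk' =>
        rcases hk'.lt_or_eq with h | rfl
        · exact ⟨0, _, .block (k := k + 1) (by omega) h, .refl _⟩
        · exact ⟨2, [], .nil, by simpa [List.replicate_succ] using hvine⟩
      | @append k w hk hk' hw =>
        rcases hk'.lt_or_eq with h | rfl
        · exact ⟨0, _, .append (k := k + 1) (by omega) h hw, .refl _⟩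
        · refine ⟨3, w, hw, ?_⟩
          have := hvine.append_right (.a :: w)
          simpa [List.replicate_succ] using this
    -- Pairs of `a` commute with `b` and are collected in front; a full block of `t.size + 1`
    -- letters `b` becomes such a pair.
    have hnf : ∀ w, ∃ e w', Reduced t.size w' ∧ Rewrites x w (List.replicate e .a ++ w') := by
      intro w
      induction w with
      | nil => exact ⟨0, [], .nil, .refl _⟩
      | cons c w ih =>
        obtain ⟨e, w', hw', h⟩ := ih
        have h1 := h.append_left [c]
        cases c with
        | a => exact ⟨e + 1, w', hw', by rw [List.replicate_succ]; exact h1⟩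
        | b =>
          rcases Nat.even_or_odd' e with ⟨q, rfl | rfl⟩
          · obtain ⟨e', w'', hw'', h2⟩ := hbreduced w' hw'
            refine ⟨2 * q + e', w'', hw'', h1.trans ?_⟩
            have h3 := (hshift q).append_right w'
            rw [List.append_assoc, mul_comm] at h3
            rw [← List.replicate_append_replicate, List.append_assoc]
            exact h3.trans (h2.append_left _)
          -- For odd `e` the `b` passes all the pairs and stops before one single `a`, which
          -- separates it from the next block.
          · refine ⟨2 * q, _, .append (k := 1) one_pos (by omega) hw', h1.trans ?_⟩
            have h3 := (hshift q).append_right (.a :: w')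
            rw [List.append_assoc, mul_comm] at h3
            rw [← List.replicate_append_replicate, List.append_assoc]
            exact h3
    have hcell : ∀ q i y, cell x (q * x.carets + i) y =
        app (List.replicate (q * 2) true) (cell x i y) := by
      intro q i y
      induction q with
      | zero => simp
      | succ q ih =>
        rw [Nat.add_one_mul, Nat.add_right_comm, cell_add hx, ih, leafWord_carets, hr, ← app_append,
          List.replicate_append_replicate, Nat.add_one_mul, Nat.add_comm 2]
    -- The point lies in the cell `q * x.carets + t.size`, whose address ends with the word `10` of
    -- the first leaf of the right caret of `x`. Moving on by `k` leads to leaf number `k - 1` of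
    -- the next copy of `t`, and this leaf has a nonempty address because `t` has at least two
    -- leaves.
    have hblock : ∀ k, 0 < k → k ≤ t.size → ∃ u, u ≠ [] ∧ ∀ q y, spineMap hx
        (List.replicate k .b) (app (List.replicate (q * 2) true) (cons true (cons false y))) =
          app (List.replicate ((q + 1) * 2) true) (cons false (app u y)) := by
      intro k hk hk'
      refine ⟨leafWord t (k - 1), ?_, fun q y => ?_⟩
      · cases t with
        | leaf b => simp [size] at ht
        | node c l r => rw [leafWord]; split_ifs <;> simp
      · have h1 : cons true (cons false y) = cell x t.size y := by
          rw [cell_of_lt (by omega), hlast]; rfl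
        rw [h1, ← hcell, spineMap_replicate_b,
          show q * x.carets + t.size + k = (q + 1) * x.carets + (k - 1) by
            rw [Nat.add_one_mul]; omega, hcell, cell_of_lt (by omega), hleaf _ (by omega), app_cons]
    -- Each block inserts a nonempty word after the first zero and leaves an even number of ones
    -- before it; the single `a` in front makes the number odd, as the next block requires. A power
    -- of `a` inserts nothing after the first zero, so only the empty reduced word can act as one.
    have hreduced : ∀ w, Reduced t.size w → w = [] ∨ ∃ j q u, u ≠ [] ∧ ∀ y,
        spineMap hx w (app (List.replicate j true) (cons false y)) =
          app (List.replicate (q * 2) true) (cons false (app u y)) := by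
      intro w hw
      induction hw with
      | nil => exact .inl rfl
      | @block k hk hk' =>
        obtain ⟨u, hu, h⟩ := hblock k hk hk'
        exact .inr ⟨1, 1, u, hu, fun y => h 0 y⟩
      | @append k w hk hk' hw ih =>
        obtain ⟨u, hu, h⟩ := hblock k hk hk'
        rcases ih with rfl | ⟨j, q, u', hu', h'⟩
        · exact .inr ⟨0, 1, u, hu, fun y => by rw [spineMap_append]; exact h 0 y⟩
        · refine .inr ⟨j, q + 1, u ++ u', by simp [hu], fun y => ?_⟩
          rw [spineMap_append, spineMap, h', app_append, ← h]
          congr 1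
          rw [← app_cons, ← List.replicate_succ, List.replicate_succ', app_append]
          rfl
    intro w m hw
    obtain ⟨e, w', hw', h⟩ := hnf w
    rcases hreduced w' hw' with rfl | ⟨j, q, u, hu, hq⟩
    · exact ⟨e, by simpa using h⟩
    · exfalso
      refine hu (app_left_injective (w' := []) fun y => ?_)
      have h1 := hw (app (List.replicate j true) (cons false y))
      rw [h.spineMap_eq hx, spineMap_append, spineMap_replicate_a, hq, ← app_append, ← app_append,
        List.replicate_append_replicate, List.replicate_append_replicate] at h1
      exact eq_of_app_replicate h1
  subst hxt
  exact key

theorem ne_rightVine {t r : FreeTree Unit Unit} (ht : 2 ≤ t.size) :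
    node () t r ≠ rightVine (node () t r).carets := by
  intro h
  rw [carets, rightVine, node.injEq] at h
  rw [h.2.1] at ht
  simp [size] at ht

end Faithful

end ForestSkein

/-! ### The theorem and its corollary -/

theorem theorem5p16 :
    -- the general statement for `⟨a, b | x(a) = ρ(b)⟩`
    (∀ x : FreeTree Unit Unit, 2 ≤ x.size →
      ∃ (h₀ : ∀ X, IsOre (ForestCategory thompson X))
        (h : ∀ X, IsOre (ForestCategory (vinePresentation x) X)),
        ∀ X : ThompsonType,
          Function.Injective (faithfulAction (h X) (h .V)) ∧
          Function.Injective (thompsonToQuotient (h₀ X) (h X) (h .V) Colour.a) ∧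
          IsFiniteGermExtension (thompsonGroup h₀ h Colour.a X) (gammaGroup h X) ∧
          (thompsonGroup h₀ h Colour.a X ≠ gammaGroup h X ↔
            x ≠ FreeTree.rightVine x.carets)) ∧
    -- the groups `G_t`, with `x = Y(t ⊗ I)`
    (∀ t : FreeTree Unit Unit, 2 ≤ t.size →
      ∃ (h₀ : ∀ X, IsOre (ForestCategory thompson X))
        (h : ∀ X, IsOre (ForestCategory (vinePresentation (.node () t (.leaf ()))) X)),
        ∀ X : ThompsonType,
          Function.Injective (rigidAction (h X) (h .V)) ∧
          IsFiniteGermExtension (thompsonGroup h₀ h Colour.a X) (rigidAction (h X) (h .V)).range ∧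
          thompsonGroup h₀ h Colour.a X ≠ (rigidAction (h X) (h .V)).range) ∧
    -- the groups `J_t`, with `x = Y(t ⊗ Y)`
    (∀ t : FreeTree Unit Unit, 2 ≤ t.size →
      ∃ (h₀ : ∀ X, IsOre (ForestCategory thompson X))
        (h : ∀ X, IsOre (ForestCategory
          (vinePresentation (.node () t (.node () (.leaf ()) (.leaf ())))) X)),
        ∀ X : ThompsonType,
          Function.Injective (rigidAction (h X) (h .V)) ∧
          IsFiniteGermExtension (thompsonGroup h₀ h Colour.a X) (rigidAction (h X) (h .V)).range ∧
          thompsonGroup h₀ h Colour.a X ≠ (rigidAction (h X) (h .V)).range) := by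
  refine ⟨fun x hx => ⟨thompson_isOre, vine_isOre hx, fun X => ⟨faithfulAction_injective hx _ _,
    thompsonToQuotient_injective hx _ _ _, ?_, ?_⟩⟩, fun t ht => ?_, fun t ht => ?_⟩
  · rw [gammaGroup_eq]
    exact isFiniteGermExtension hx _ _ X
  · rw [gammaGroup_eq]
    exact thompsonGroup_ne_iff hx _ _ X
  · have hx : 2 ≤ (FreeTree.node () t (.leaf ())).size := by
      simp only [FreeTree.size]; omega
    exact ⟨thompson_isOre, vine_isOre hx, fun X =>
      ⟨rigidAction_injective hx (spinesRewrite_leaf ht hx) _ _, isFiniteGermExtension hx _ _ X,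
        (thompsonGroup_ne_iff hx _ _ X).2 (ne_rightVine ht)⟩⟩
  · have hx : 2 ≤ (FreeTree.node () t (.node () (.leaf ()) (.leaf ()))).size := by
      simp only [FreeTree.size]; omega
    exact ⟨thompson_isOre, vine_isOre hx, fun X =>
      ⟨rigidAction_injective hx (spinesRewrite_caret ht hx) _ _, isFiniteGermExtension hx _ _ X,
        (thompsonGroup_ne_iff hx _ _ X).2 (ne_rightVine ht)⟩⟩
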